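/- Notation. $S(0,1)$ is the space of classes of a.e. equal measurable real functions on $(0,1)$ with Lebesgue measure $m$, and $\mu(t;x)=\inf\{s\ge 0: m(|x|>s)\le t\}$, $0<t<1$, is the decreasing rearrangement of $x\in S(0,1)$. The Calderón operator is $(Sz)(t)=\frac1t\int_0^t z(s)\,ds+\int_t^1\frac{z(s)}{s}\,ds$. The martingale transform $T$ is $Tx=\sum_{m\ge 0}(\mathbb E_{2m}x-\mathbb E_{2m-1}x)$, $x\in L_1(0,1)$ (convergence in measure), where $\mathbb E_n$ is the conditional expectation with respect to the $n$-th dyadic $\sigma$-algebra and $\mathbb E_{-1}=0$. A symmetric (quasi-)Banach function space is a linear subspace $E\subset S(0,1)$ with a complete (quasi-)norm such that, for $x\in E$ and $y\in S(0,1)$: $|y|\le|x|$ implies $y\in E$, $\|y\|_E\le\|x\|_E$; and $\mu(y)=\mu(x)$ implies $y\in E$, $\|y\|_E=\|x\|_E$. For such $E\subset L_1$ set $$\mathcal S_E=\{x\in L_{1,\infty}:\ \exists\, y\in E,\ \mu(x)\le S\mu(y)\},\qquad \|x\|_{\mathcal S_E}=\inf\{\|y\|_E:\ y\in E,\ \mu(x)\le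 S\mu(y)\},$$ where $L_{1,\infty}=\{x\in S(0,1):\sup_{0<t<1}t\,\mu(t;x)<\infty\}$. For an increasing $\omega:[0,1)\to[0,1)$ let $\Lambda_\omega=\{x\in S(0,1):\|x\|_{\Lambda_\omega}=\int_0^1\mu(s;x)\,d\omega(s)<\infty\}$ (Lebesgue–Stieltjes integral over $(0,1)$). Statement. Let $\phi:[0,1)\to[0,1)$ be an increasing concave function, not identically zero, with $\phi(0+)=0$, and let $$\psi(u)=\inf_{1<w<1/u}\frac{\phi(uw)}{1+\log w},\qquad u\in[0,1)\quad(1/0=\infty).$$ Suppose that for some constant $c$ $$\int_0^u\frac{\psi(t)}{t}\,dt+u\int_u^1\frac{\psi(t)}{t^2}\,dt\le c\,\phi(u),\qquad u\in(0,1).$$ Then $\mathcal S_{\Lambda_\phi}=\Lambda_\psi$, as sets and with equivalent functionals. Moreover, $\Lambda_\psi$ is the optimal symmetric (quasi-)Banach range of $T$ on $\Lambda_\phi$, that is: (a) $\Lambda_\psi$ is a symmetric quasi-Banach function space, $T:\Lambda_\phi\to\Lambda_\psi$ is bounded, and $\Lambda_\psi\subset G$ continuously for every symmetric quasi-Banach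 function space $G$ such that $T:\Lambda_\phi\to G$ is bounded; (b) $\Lambda_\psi$ admits an equivalent norm under which it is a symmetric Banach function space, and with this norm it is the optimal range in the same sense among symmetric Banach function spaces. -/

import Mathlib

open MeasureTheory Set Filter Topology

noncomputable section

namespace HaarRange

/-! ### Measurable functions on the unit interval -/

/-- Lebesgue measure on the interval `(0,1)`. -/
abbrev leb : Measure ℝ := (volume : Measure ℝ).restrict (Ioo 0 1)

/-- The space `S(0,1)` of (classes of a.e. equal) measurable real functions on `(0,1)`. -/
abbrev S01 : Type := ℝ →ₘ[leb] ℝ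

/-- The decreasing right-continuous rearrangement `μ(t; x)`, used for `0 < t < 1`. -/
def rearr (x : S01) (t : ℝ) : ℝ :=
  sInf {s : ℝ | 0 ≤ s ∧ leb {u | s < |x u|} ≤ ENNReal.ofReal t}

/-- The Calderón operator `(S z)(t) = (1/t) ∫₀ᵗ z + ∫ₜ¹ z(s)/s ds`. -/
def calderon (z : ℝ → ℝ) (t : ℝ) : ℝ :=
  (1 / t) * (∫ s in Ioo 0 t, z s) + ∫ s in Ioo t 1, z s / s

/-! ### Symmetric (quasi-)Banach function spaces -/

/-- A set of functions on `(0,1)` together with a real-valued functional, of which only the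
values on that set matter. -/
structure FunctionSpace where
  carrier : Set S01
  qnorm : S01 → ℝ

/-- `E` is a linear space of functions on which the functional is a quasi-norm, with constant `K`
in the quasi-triangle inequality. -/
structure IsQuasiNormed (K : ℝ) (E : FunctionSpace) : Prop where
  zero_mem : (0 : S01) ∈ E.carrier
  add_mem : ∀ x ∈ E.carrier, ∀ y ∈ E.carrier, x + y ∈ E.carrier
  smul_mem : ∀ (a : ℝ), ∀ x ∈ E.carrier, a • x ∈ E.carrier
  nonneg : ∀ x ∈ E.carrier, 0 ≤ E.qnorm x
  eq_zero_iff : ∀ x ∈ E.carrier, (E.qnorm x = 0 ↔ x = 0)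
  smul_eq : ∀ (a : ℝ), ∀ x ∈ E.carrier, E.qnorm (a • x) = |a| * E.qnorm x
  add_le : ∀ x ∈ E.carrier, ∀ y ∈ E.carrier, E.qnorm (x + y) ≤ K * (E.qnorm x + E.qnorm y)

/-- Every Cauchy sequence of `E` converges in `E`. -/
def IsComplete (E : FunctionSpace) : Prop :=
  ∀ u : ℕ → S01, (∀ n, u n ∈ E.carrier) →
    (∀ ε > 0, ∃ N, ∀ m ≥ N, ∀ n ≥ N, E.qnorm (u m - u n) < ε) →
    ∃ x ∈ E.carrier, Tendsto (fun n => E.qnorm (u n - x)) atTop (𝓝 0)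

/-- The ideal property and the invariance under rearrangement. -/
structure IsSymmetric (E : FunctionSpace) : Prop where
  ideal : ∀ x ∈ E.carrier, ∀ y : S01, (∀ᵐ t ∂leb, |y t| ≤ |x t|) →
    y ∈ E.carrier ∧ E.qnorm y ≤ E.qnorm x
  rearr_inv : ∀ x ∈ E.carrier, ∀ y : S01, (∀ t ∈ Ioo (0 : ℝ) 1, rearr y t = rearr x t) →
    y ∈ E.carrier ∧ E.qnorm y = E.qnorm x

/-- Symmetric quasi-Banach function spaces on `(0,1)`. -/
def IsSymmetricQuasiBanach (E : FunctionSpace) : Prop :=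
  (∃ K, IsQuasiNormed K E) ∧ IsComplete E ∧ IsSymmetric E

/-- Symmetric Banach function spaces on `(0,1)`. -/
def IsSymmetricBanach (E : FunctionSpace) : Prop :=
  IsQuasiNormed 1 E ∧ IsComplete E ∧ IsSymmetric E

/-- `E ⊆ F` with a bounded inclusion map. -/
def Embeds (E F : FunctionSpace) : Prop :=
  E.carrier ⊆ F.carrier ∧ ∃ C : ℝ, ∀ x ∈ E.carrier, F.qnorm x ≤ C * E.qnorm x

/-- Equality of the spaces as sets, with equivalent functionals. -/
def SameSpace (E F : FunctionSpace) : Prop :=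
  Embeds E F ∧ Embeds F E

/-! ### The martingale transform -/

/-- The `n`-th dyadic σ-algebra: it is generated by the intervals `[k 2⁻ⁿ, (k+1) 2⁻ⁿ)`. -/
abbrev dyadic (n : ℕ) : MeasurableSpace ℝ :=
  MeasurableSpace.comap (fun t : ℝ => ⌊(2 : ℝ) ^ n * t⌋) ⊤

theorem dyadic_le (n : ℕ) : dyadic n ≤ (inferInstance : MeasurableSpace ℝ) := by
  refine Measurable.comap_le ?_
  exact (measurable_const.mul measurable_id).floor

/-- The martingale difference `𝔼ₙ x - 𝔼ₙ₋₁ x`, where `𝔼₋₁ = 0`. -/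
def martDiff (x : S01) : ℕ → ℝ → ℝ
  | 0 => leb[x | dyadic 0]
  | n + 1 => leb[x | dyadic (n + 1)] - leb[x | dyadic n]

/-- `z = T x`, where `T x = ∑ₘ (𝔼₂ₘ x - 𝔼₂ₘ₋₁ x)` as a series converging in measure. -/
def IsTransform (x z : S01) : Prop :=
  TendstoInMeasure leb (fun N : ℕ => ∑ m ∈ Finset.range N, martDiff x (2 * m)) atTop z

/-- `T` is a bounded operator from `E` to `F`: the series defining `T x` converges in measure for
every `x ∈ E`, its sum lies in `F`, and its norm is controlled by that of `x`. -/
def TransformBounded (E F : FunctionSpace) : Prop :=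
  ∃ C : ℝ, ∀ x ∈ E.carrier, ∃ z ∈ F.carrier, IsTransform x z ∧ F.qnorm z ≤ C * E.qnorm x

/-- `F` is the optimal range of `T` on `E` in the class `P` of spaces: `F` belongs to `P`, `T` is
bounded from `E` to `F`, and `F` embeds in every space of the class with that property. -/
def IsOptimalRange (P : FunctionSpace → Prop) (E F : FunctionSpace) : Prop :=
  P F ∧ TransformBounded E F ∧ ∀ G, P G → TransformBounded E G → Embeds F G

/-- The least receptacle `𝒮_E` of the Calderón operator on `E`: all `x ∈ L_{1,∞}` such that
`μ(x) ≤ S μ(y)` for some `y ∈ E`, with the infimum of the norms of such `y`. -/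
def calderonRange (E : FunctionSpace) : FunctionSpace where
  carrier := {x | (∃ C : ℝ, ∀ t ∈ Ioo (0 : ℝ) 1, t * rearr x t ≤ C) ∧
    ∃ y ∈ E.carrier, ∀ t ∈ Ioo (0 : ℝ) 1, rearr x t ≤ calderon (rearr y) t}
  qnorm x := sInf {r | ∃ y ∈ E.carrier,
    (∀ t ∈ Ioo (0 : ℝ) 1, rearr x t ≤ calderon (rearr y) t) ∧ r = E.qnorm y}

/-! ### Lorentz spaces -/

/-- An increasing function from `[0,1)` to `[0,1)`; values outside `[0,1)` are irrelevant. -/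
structure IsWeight (ω : ℝ → ℝ) : Prop where
  mapsTo : MapsTo ω (Ico 0 1) (Ico 0 1)
  mono : MonotoneOn ω (Ico 0 1)

/-- Monotone extension to the real line of a function from `[0,1)` to `[0,1)`. -/
def ext (ω : ℝ → ℝ) (t : ℝ) : ℝ := if t < 1 then ω (max t 0) else 1

theorem IsWeight.monotone_ext {ω : ℝ → ℝ} (h : IsWeight ω) : Monotone (ext ω) := by
  intro s t hst
  unfold ext
  split_ifs with h1 h2 h2
  · exact h.mono ⟨le_max_right _ _, max_lt h1 one_pos⟩ ⟨le_max_right _ _, max_lt h2 one_pos⟩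
      (max_le_max_right 0 hst)
  · exact (h.mapsTo ⟨le_max_right _ _, max_lt h1 one_pos⟩).2.le
  · exact absurd (hst.trans_lt h2) h1
  · exact le_rfl

/-- The Lebesgue–Stieltjes measure `dω` on `(0,1)`. -/
def IsWeight.measure {ω : ℝ → ℝ} (h : IsWeight ω) : Measure ℝ :=
  h.monotone_ext.stieltjesFunction.measure.restrict (Ioo 0 1)

/-- The Lorentz space `Λ_ω`, with the functional `∫₀¹ μ(s; x) dω(s)`. -/
def lorentz (ω : ℝ → ℝ) (h : IsWeight ω) : FunctionSpace where
  carrier := {x | ∫⁻ s, ENNReal.ofReal (rearr x s) ∂h.measure < ⊤}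
  qnorm x := (∫⁻ s, ENNReal.ofReal (rearr x s) ∂h.measure).toReal

/-- An increasing concave function `φ : [0,1) → [0,1)` with `φ(0+) = 0`, not identically zero. -/
structure IsLorentzFunction (φ : ℝ → ℝ) : Prop extends IsWeight φ where
  concave : ConcaveOn ℝ (Ico 0 1) φ
  tendsto_zero : Tendsto φ (𝓝[>] 0) (𝓝 0)
  ne_zero : ∃ t ∈ Ico (0 : ℝ) 1, φ t ≠ 0

/-- `ψ(u) = inf { φ(uw) / (1 + log w) : 1 < w < 1/u }` for `u ∈ [0,1)`, where `1/0 = ∞`. -/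
def psi (φ : ℝ → ℝ) (u : ℝ) : ℝ :=
  sInf {r | ∃ w : ℝ, 1 < w ∧ u * w < 1 ∧ r = φ (u * w) / (1 + Real.log w)}

theorem IsWeight.psi {φ : ℝ → ℝ} (h : IsWeight φ) : IsWeight (psi φ) := by
  have hbdd : ∀ u ∈ Ico (0 : ℝ) 1, ∀ r ∈ {r | ∃ w : ℝ, 1 < w ∧ u * w < 1 ∧
      r = φ (u * w) / (1 + Real.log w)}, 0 ≤ r := by
    rintro u hu _ ⟨w, hw, huw, rfl⟩
    have h1 := (h.mapsTo ⟨mul_nonneg hu.1 (by linarith), huw⟩).1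
    have h2 := Real.log_pos hw
    positivity
  have hle : ∀ u ∈ Ico (0 : ℝ) 1, ∀ w : ℝ, 1 < w → u * w < 1 →
      HaarRange.psi φ u ≤ φ (u * w) / (1 + Real.log w) := fun u hu w hw huw =>
    csInf_le ⟨0, hbdd u hu⟩ ⟨w, hw, huw, rfl⟩
  have hex : ∀ u ∈ Ico (0 : ℝ) 1, ∃ w : ℝ, 1 < w ∧ u * w < 1 := by
    intro u hu
    refine ⟨2 / (1 + u), ?_, ?_⟩
    · rw [lt_div_iff₀ (by linarith [hu.1])]; linarith [hu.2]
    · rw [← mul_div_assoc, div_lt_one (by linarith [hu.1])]; linarith [hu.2]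
  refine ⟨fun u hu => ⟨Real.sInf_nonneg (hbdd u hu), ?_⟩, ?_⟩
  · obtain ⟨w, hw, huw⟩ := hex u hu
    have h1 := h.mapsTo ⟨mul_nonneg hu.1 (by linarith), huw⟩
    have h2 := Real.log_pos hw
    refine (hle u hu w hw huw).trans_lt ?_
    rw [div_lt_one (by linarith)]
    linarith [h1.2]
  · intro u hu v hv huv
    obtain ⟨w₀, hw₀, hvw₀⟩ := hex v hv
    refine le_csInf ⟨_, w₀, hw₀, hvw₀, rfl⟩ ?_
    rintro _ ⟨w, hw, hvw, rfl⟩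
    have huw : u * w ≤ v * w := mul_le_mul_of_nonneg_right huv (by linarith)
    have h2 := Real.log_pos hw
    refine (hle u hu w hw (huw.trans_lt hvw)).trans ?_
    exact div_le_div_of_nonneg_right (h.mono ⟨mul_nonneg hu.1 (by linarith), huw.trans_lt hvw⟩
      ⟨mul_nonneg hv.1 (by linarith), hvw⟩ huw) (by linarith)

end HaarRange

end

/-! Everything is reduced to indicators of initial intervals `(0,b)`. The superlevel sets of a
decreasing function are initial intervals, so an inequality between the integrals of all decreasing
functions against two measures need only be checked on `(0,b)` (`lintegral_antitone_le`). In a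
Lorentz space with weight `ω` the indicator of `(0,b)` has norm `ω(b)`. The weights in use are
quasi-concave, and `ψ` inherits this property from `φ` (`IsQuasiconcave.psi`).

Upper bound for the Calderón operator. Its kernel `1/max(s,t)` is symmetric, so Tonelli moves it
onto the measure `dψ`. The test on `(0,b)` then produces the left-hand side of the hypothesis plus a
term at most `b`, and `b` is itself at most a multiple of `φ(b)` (`exists_lintegral_cal_le`). This
gives `𝒮_{Λ_φ} ⊆ Λ_ψ`.

Lower bound. The function `w χ_(0,s)` with `w = 1/(1 + log(s/u))` has Hardy transform `z(t) + ∫ₜ¹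
z/r` at least `1` on `(0,u)`, and its cost in `Λ_φ` is `φ(s)/(1 + log(s/u))`. The infimum of this
cost over `s` is exactly `ψ(u)`. Cutting a rearrangement into its increments along `2⁻ʲ` and summing
near-optimal choices dominates any function of `Λ_ψ` by the Hardy transform of a decreasing `z` in
`Λ_φ` with comparable norm (`exists_le_hardy`). The Calderón operator dominates the Hardy transform,
so `Λ_ψ ⊆ 𝒮_{Λ_φ}`.

Boundedness of `T`. Two Bellman functions on the dyadic tree give a weak type `(1,1)` inequality and
an exponential inequality for bounded functions. Together they say that if `|x| ≤ a` and `‖x‖₁ ≤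
ab`, then the partial sums of `Tx` have rearrangement at most `16a` times the Calderón transform of
`χ_(0,b)` (`rearrFun_treeFun_le_cal`). A general `x` is split into layers between consecutive
truncation levels, and the estimates are added. Adding requires a true triangle inequality, so `ψ`
is replaced by the equivalent concave weight `concaveHull`, which also provides the Banach norm of
(b). Lower semicontinuity of Lorentz functionals in measure passes to the limit. The limit exists by
the weak type inequality and the `L₁` density of dyadic step functions.

Optimality. Given a decreasing `z`, `extremal z` places its values on the intervals `[4⁻ᵐ/2, 4⁻ᵐ)`
and zero on the other dyadic blocks. Along the branch towards the origin all even martingale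
differences are then positive, so the transform adds up `∑ z(4⁻ᵐ⁻¹)`, which is comparable to the
Hardy transform of `z` (`hardy_le_rearrFun`). Dilations are bounded on symmetric spaces, so every
symmetric range of `T` contains whatever these Hardy transforms dominate, in particular `Λ_ψ`
(`embeds_of_transformBounded`). -/

noncomputable section

namespace HaarRange

/-! ### Decreasing rearrangements -/

/-- The decreasing rearrangement of a function on `(0,1)`. -/
def rearrFun (f : ℝ → ℝ) (t : ℝ) : ℝ :=
  sInf {s : ℝ | 0 ≤ s ∧ leb {u | s < |f u|} ≤ ENNReal.ofReal t}

theorem rearr_eq_rearrFun (x : S01) : rearr x = rearrFun x := rfl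

theorem leb_univ : leb univ = 1 := by simp [leb]

instance : IsProbabilityMeasure leb := ⟨leb_univ⟩

theorem rearrFun_congr {f g : ℝ → ℝ} (h : f =ᵐ[leb] g) : rearrFun f = rearrFun g := by
  funext t
  have : ∀ s : ℝ, leb {u | s < |f u|} = leb {u | s < |g u|} := fun s => by
    refine measure_congr ?_
    filter_upwards [h] with u hu
    exact congrArg (fun r => s < |r|) hu
  simp only [rearrFun, this]

theorem rearr_mk {f : ℝ → ℝ} (hf : AEStronglyMeasurable f leb) :
    rearr (AEEqFun.mk f hf) = rearrFun f := by
  rw [rearr_eq_rearrFun]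
  exact rearrFun_congr (AEEqFun.coeFn_mk f hf)

theorem rearrFun_nonneg (f : ℝ → ℝ) (t : ℝ) : 0 ≤ rearrFun f t :=
  Real.sInf_nonneg fun _ h => h.1

theorem rearrFun_bddBelow (f : ℝ → ℝ) (t : ℝ) :
    BddBelow {s : ℝ | 0 ≤ s ∧ leb {u | s < |f u|} ≤ ENNReal.ofReal t} := ⟨0, fun _ h => h.1⟩

theorem nullMeasurableSet_lt_abs {f : ℝ → ℝ} (hf : AEMeasurable f leb) (s : ℝ) :
    NullMeasurableSet {u | s < |f u|} leb :=
  nullMeasurableSet_lt aemeasurable_const hf.abs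

/-- The sets `{n < |f|}` decrease to the empty set and the measure is finite. This keeps the infimum
in `rearrFun` away from the default value `0` of an infimum over the empty set. -/
theorem exists_meas_lt_abs_le {f : ℝ → ℝ} (hf : AEMeasurable f leb) {t : ℝ} (ht : 0 < t) :
    ∃ s : ℝ, 0 ≤ s ∧ leb {u | s < |f u|} ≤ ENNReal.ofReal t := by
  have h : Tendsto (fun n : ℕ => leb {u | (n : ℝ) < |f u|}) atTop
      (𝓝 (leb (⋂ n : ℕ, {u | (n : ℝ) < |f u|}))) := by
    refine tendsto_measure_iInter_atTop (fun n => nullMeasurableSet_lt_abs hf n) ?_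
      ⟨0, measure_ne_top _ _⟩
    intro m n hmn u hu
    exact lt_of_le_of_lt (Nat.cast_le.2 hmn : (m : ℝ) ≤ n) hu
  have h0 : (⋂ n : ℕ, {u | (n : ℝ) < |f u|}) = ∅ := by
    ext u
    simp only [mem_iInter, mem_ofPred_eq, mem_empty_iff_false, iff_false, not_forall, not_lt]
    exact exists_nat_ge _
  rw [h0, measure_empty] at h
  obtain ⟨n, hn⟩ := (h.eventually (gt_mem_nhds (ENNReal.ofReal_pos.2 ht))).exists
  exact ⟨n, n.cast_nonneg, hn.le⟩

theorem tendsto_meas_add_lt {f : ℝ → ℝ} (s : ℝ) :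
    Tendsto (fun n : ℕ => leb {u | s + 1 / ((n : ℝ) + 1) < |f u|}) atTop
      (𝓝 (leb {u | s < |f u|})) := by
  have h0 : {u | s < |f u|} = ⋃ n : ℕ, {u | s + 1 / ((n : ℝ) + 1) < |f u|} := by
    ext u
    simp only [mem_iUnion, mem_ofPred_eq]
    constructor
    · intro h
      obtain ⟨n, hn⟩ := exists_nat_one_div_lt (sub_pos.2 h)
      exact ⟨n, by linarith⟩
    · rintro ⟨n, hn⟩
      have : 0 < 1 / ((n : ℝ) + 1) := Nat.one_div_pos_of_nat
      linarith
  rw [h0]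
  refine tendsto_measure_iUnion_atTop ?_
  intro m n hmn u hu
  have : 1 / ((n : ℝ) + 1) ≤ 1 / ((m : ℝ) + 1) := Nat.one_div_le_one_div hmn
  simp only [mem_ofPred_eq] at hu ⊢
  linarith

/-- The distribution function is right continuous, so the infimum is attained. All later facts about
rearrangements go through this equivalence. -/
theorem rearrFun_le_iff {f : ℝ → ℝ} (hf : AEMeasurable f leb) {t s : ℝ} (ht : 0 < t)
    (hs : 0 ≤ s) : rearrFun f t ≤ s ↔ leb {u | s < |f u|} ≤ ENNReal.ofReal t := by
  constructor
  · intro h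
    refine le_of_tendsto (tendsto_meas_add_lt (f := f) s) (Eventually.of_forall fun n => ?_)
    have hn : 0 < 1 / ((n : ℝ) + 1) := Nat.one_div_pos_of_nat
    obtain ⟨r, hr, hrs⟩ := exists_lt_of_csInf_lt (exists_meas_lt_abs_le hf ht)
      (show rearrFun f t < s + 1 / ((n : ℝ) + 1) by linarith)
    exact (measure_mono fun u hu => hrs.trans hu).trans hr.2
  · intro h
    exact csInf_le (rearrFun_bddBelow f t) ⟨hs, h⟩

theorem lt_rearrFun_iff {f : ℝ → ℝ} (hf : AEMeasurable f leb) {t s : ℝ} (ht : 0 < t)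
    (hs : 0 ≤ s) : s < rearrFun f t ↔ ENNReal.ofReal t < leb {u | s < |f u|} := by
  rw [← not_le, rearrFun_le_iff hf ht hs, not_le]

theorem rearrFun_antitoneOn {f : ℝ → ℝ} (hf : AEMeasurable f leb) :
    AntitoneOn (rearrFun f) (Ioi 0) := by
  intro s hs t ht hst
  rw [rearrFun_le_iff hf ht (rearrFun_nonneg f s)]
  exact ((rearrFun_le_iff hf hs (rearrFun_nonneg f s)).1 le_rfl).trans
    (ENNReal.ofReal_le_ofReal hst)

theorem aemeasurable_of_antitoneOn_Ioo {z : ℝ → ℝ} (hz : AntitoneOn z (Ioo 0 1))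
    (ν : Measure ℝ) : AEMeasurable z (ν.restrict (Ioo 0 1)) :=
  aemeasurable_restrict_of_antitoneOn measurableSet_Ioo hz

theorem rearrFun_antitoneOn_Ioo {f : ℝ → ℝ} (hf : AEMeasurable f leb) :
    AntitoneOn (rearrFun f) (Ioo 0 1) :=
  (rearrFun_antitoneOn hf).mono fun _ h => h.1

theorem rearrFun_aemeasurable {f : ℝ → ℝ} (hf : AEMeasurable f leb) :
    AEMeasurable (rearrFun f) leb :=
  aemeasurable_of_antitoneOn_Ioo (rearrFun_antitoneOn_Ioo hf) _

/-- A function and its decreasing rearrangement are equimeasurable. -/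
theorem leb_lt_rearrFun {f : ℝ → ℝ} (hf : AEMeasurable f leb) {s : ℝ} (hs : 0 ≤ s) :
    leb {u | s < rearrFun f u} = leb {u | s < |f u|} := by
  have hfin : leb {u | s < |f u|} ≠ ⊤ := measure_ne_top _ _
  have h1 : (leb {u | s < |f u|}).toReal ≤ 1 := by
    have := prob_le_one (μ := leb) (s := {u | s < |f u|})
    simpa using ENNReal.toReal_mono ENNReal.one_ne_top this
  -- Inside `(0,1)` the superlevel set of the rearrangement is exactly an initial interval whose
  -- length is the value of the distribution function.
  have h : {u | s < rearrFun f u} ∩ Ioo 0 1 = Ioo 0 (leb {u | s < |f u|}).toReal := by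
    ext u
    simp only [mem_inter_iff, mem_ofPred_eq, mem_Ioo]
    constructor
    · rintro ⟨h, h0, -⟩
      rw [lt_rearrFun_iff hf h0 hs] at h
      exact ⟨h0, (ENNReal.ofReal_lt_iff_lt_toReal h0.le hfin).1 h⟩
    · rintro ⟨h0, h⟩
      exact ⟨(lt_rearrFun_iff hf h0 hs).2 ((ENNReal.ofReal_lt_iff_lt_toReal h0.le hfin).2 h),
        h0, h.trans_le h1⟩
  rw [leb, Measure.restrict_apply' measurableSet_Ioo, h, Real.volume_Ioo, sub_zero,
    ENNReal.ofReal_toReal hfin]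

theorem rearrFun_rearrFun {f : ℝ → ℝ} (hf : AEMeasurable f leb) :
    rearrFun (rearrFun f) = rearrFun f := by
  funext t
  have : ∀ s : ℝ, 0 ≤ s ∧ leb {u | s < |rearrFun f u|} ≤ ENNReal.ofReal t ↔
      0 ≤ s ∧ leb {u | s < |f u|} ≤ ENNReal.ofReal t := fun s => by
    refine and_congr_right fun hs => ?_
    simp only [abs_of_nonneg (rearrFun_nonneg f _)]
    rw [leb_lt_rearrFun hf hs]
  simp only [rearrFun] at this ⊢
  simp only [this]

theorem rearrFun_mono {f g : ℝ → ℝ} (hf : AEMeasurable f leb) (hg : AEMeasurable g leb)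
    (h : ∀ᵐ u ∂leb, |f u| ≤ |g u|) {t : ℝ} (ht : 0 < t) : rearrFun f t ≤ rearrFun g t := by
  rw [rearrFun_le_iff hf ht (rearrFun_nonneg g t)]
  refine le_trans (measure_mono_ae ?_)
    ((rearrFun_le_iff hg ht (rearrFun_nonneg g t)).1 le_rfl)
  filter_upwards [h] with u hu h'
  exact lt_of_lt_of_le h' hu

theorem rearrFun_add_le {f g : ℝ → ℝ} (hf : AEMeasurable f leb) (hg : AEMeasurable g leb)
    {s t : ℝ} (hs : 0 < s) (ht : 0 < t) :
    rearrFun (f + g) (s + t) ≤ rearrFun f s + rearrFun g t := by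
  have hf0 := rearrFun_nonneg f s
  have hg0 := rearrFun_nonneg g t
  rw [rearrFun_le_iff (hf.add hg) (by positivity) (by positivity), ENNReal.ofReal_add hs.le ht.le]
  refine le_trans (measure_mono (t := {u | rearrFun f s < |f u|} ∪ {u | rearrFun g t < |g u|})
    fun u hu => ?_) ((measure_union_le _ _).trans (add_le_add
      ((rearrFun_le_iff hf hs hf0).1 le_rfl) ((rearrFun_le_iff hg ht hg0).1 le_rfl)))
  by_contra hcon
  simp only [mem_union, mem_ofPred_eq, not_or, not_lt, Pi.add_apply] at hcon hu
  linarith [abs_add_le (f u) (g u)]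

theorem rearrFun_const_mul (a : ℝ) {f : ℝ → ℝ} (hf : AEMeasurable f leb) {t : ℝ} (ht : 0 < t) :
    rearrFun (fun u => a * f u) t = |a| * rearrFun f t := by
  rcases eq_or_ne a 0 with rfl | ha
  · refine le_antisymm ?_ (by simpa using rearrFun_nonneg _ _)
    rw [rearrFun_le_iff (hf.const_mul 0) ht (by simp)]
    simp
  have ha' : 0 < |a| := abs_pos.2 ha
  have key : ∀ s, 0 ≤ s → (rearrFun (fun u => a * f u) t ≤ s ↔ |a| * rearrFun f t ≤ s) := by
    intro s hs
    rw [rearrFun_le_iff (hf.const_mul a) ht hs, ← le_div_iff₀' ha',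
      rearrFun_le_iff hf ht (by positivity)]
    simp only [abs_mul, div_lt_iff₀' ha']
  refine le_antisymm ((key _ (by have := rearrFun_nonneg f t; positivity)).2 le_rfl)
    ((key _ (rearrFun_nonneg _ _)).1 le_rfl)

theorem rearrFun_le_of_antitoneOn {z : ℝ → ℝ} (hz : AntitoneOn z (Ioo 0 1))
    (hz0 : ∀ t ∈ Ioo (0 : ℝ) 1, 0 ≤ z t) {t : ℝ} (ht : t ∈ Ioo (0 : ℝ) 1) :
    rearrFun z t ≤ z t := by
  rw [rearrFun_le_iff (aemeasurable_of_antitoneOn_Ioo hz _) ht.1 (hz0 t ht), leb,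
    Measure.restrict_apply' measurableSet_Ioo]
  refine (measure_mono (t := Ioo 0 t) ?_).trans (by simp)
  rintro u ⟨hu, hu1⟩
  refine ⟨hu1.1, lt_of_not_ge fun h => ?_⟩
  simp only [mem_ofPred_eq, abs_of_nonneg (hz0 u hu1)] at hu
  exact absurd (hz ht hu1 h) (not_le.2 hu)

/-- A decreasing `z` need not be right continuous, so it may exceed its rearrangement at `t`. Only
its values strictly to the right of `t` are controlled. -/
theorem le_rearrFun_of_antitoneOn {z : ℝ → ℝ} (hz : AntitoneOn z (Ioo 0 1))
    {t v : ℝ} (ht : 0 < t) (htv : t < v) (hv : v < 1) : z v ≤ rearrFun z t := by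
  by_contra! hcon
  have h0 := rearrFun_nonneg z t
  have h := (rearrFun_le_iff (aemeasurable_of_antitoneOn_Ioo hz _) ht h0).1 le_rfl
  rw [leb, Measure.restrict_apply' measurableSet_Ioo] at h
  have h2 : Ioo 0 v ⊆ {u | rearrFun z t < |z u|} ∩ Ioo 0 1 := by
    intro u hu
    have hu1 : u ∈ Ioo (0 : ℝ) 1 := ⟨hu.1, hu.2.trans hv⟩
    exact ⟨lt_of_lt_of_le hcon ((hz hu1 ⟨ht.trans htv, hv⟩ hu.2.le).trans (le_abs_self _)), hu1⟩
  have h3 := (measure_mono h2).trans h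
  rw [Real.volume_Ioo, sub_zero, ENNReal.ofReal_le_ofReal_iff ht.le] at h3
  linarith

/-! ### Rearrangements and convergence in measure -/

/-- The decreasing rearrangement is lower semicontinuous for convergence in measure. -/
theorem ofReal_rearrFun_le_liminf {v : ℕ → ℝ → ℝ} {f : ℝ → ℝ}
    (hv : ∀ n, AEMeasurable (v n) leb) (hf : AEMeasurable f leb)
    (h : TendstoInMeasure leb v atTop f) {t : ℝ} (ht : 0 < t) :
    ENNReal.ofReal (rearrFun f t) ≤ liminf (fun n => ENNReal.ofReal (rearrFun (v n) t)) atTop := by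
  refine le_of_forall_lt fun c hc => ?_
  obtain ⟨s, hs, hcs, hsf⟩ : ∃ s : ℝ, 0 ≤ s ∧ c < ENNReal.ofReal s ∧ s < rearrFun f t := by
    have hc' : c ≠ ⊤ := hc.ne_top
    have h1 : c.toReal < rearrFun f t := (ENNReal.lt_ofReal_iff_toReal_lt hc').1 hc
    refine ⟨(c.toReal + rearrFun f t) / 2, ?_, ?_, by linarith⟩
    · have := rearrFun_nonneg f t
      positivity
    · rw [ENNReal.lt_ofReal_iff_toReal_lt hc']
      linarith
  rw [lt_rearrFun_iff hf ht hs] at hsf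
  -- The level is raised from `s` to `s + ε` without losing the strict inequality. This margin
  -- absorbs the error `|v n - f|`.
  obtain ⟨k, hk⟩ := ((tendsto_meas_add_lt (f := f) s).eventually (lt_mem_nhds hsf)).exists
  set ε : ℝ := 1 / ((k : ℝ) + 1) with hε
  have hε0 : 0 < ε := Nat.one_div_pos_of_nat
  have h2 := tendstoInMeasure_iff_norm.1 h ε hε0
  have hpos : 0 < leb {u | s + ε < |f u|} - ENNReal.ofReal t := tsub_pos_of_lt hk
  refine hcs.trans_le (le_liminf_of_le (by isBoundedDefault) ?_)
  filter_upwards [h2.eventually (gt_mem_nhds hpos)] with n hn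
  refine ENNReal.ofReal_le_ofReal (le_of_lt ((lt_rearrFun_iff (hv n) ht hs).2 ?_))
  by_contra! hcon
  refine absurd (?_ : leb {u | s + ε < |f u|} ≤ leb {u | s < |v n u|} +
    leb {u | ε ≤ ‖v n u - f u‖}) (not_le.2 ?_)
  · refine (measure_mono fun u hu => ?_).trans (measure_union_le _ _)
    by_contra hcon
    simp only [mem_union, mem_ofPred_eq, not_or, not_lt, not_le, Real.norm_eq_abs] at hcon hu
    have := abs_sub_abs_le_abs_sub (f u) (v n u)
    rw [abs_sub_comm] at this
    linarith
  · calc _ < ENNReal.ofReal t + (leb {u | s + ε < |f u|} - ENNReal.ofReal t) :=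
          ENNReal.add_lt_add_of_le_of_lt (measure_ne_top _ _) hcon hn
      _ = _ := add_tsub_cancel_of_le hk.le

/-- A sequence which is Cauchy in measure converges in measure. -/
theorem exists_tendstoInMeasure_of_cauchy {v : ℕ → ℝ → ℝ} (hv : ∀ n, AEMeasurable (v n) leb)
    (h : ∀ ε > 0, ∀ δ > 0, ∃ N, ∀ m ≥ N, ∀ n ≥ N,
      leb {u | ε < |v m u - v n u|} ≤ ENNReal.ofReal δ) :
    ∃ x : S01, TendstoInMeasure leb v atTop x := by
  have h' : ∀ k : ℕ, ∃ N, ∀ m ≥ N, ∀ n ≥ N,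
      leb {u | (1 / 2 : ℝ) ^ k < |v m u - v n u|} ≤ ENNReal.ofReal ((1 / 2) ^ k) :=
    fun k => h _ (by positivity) _ (by positivity)
  choose N hN using h'
  -- The sum makes `φ` monotone and at least `N k`; the added `k` makes it tend to infinity.
  let φ : ℕ → ℕ := fun k => ∑ i ∈ Finset.range (k + 1), N i + k
  have hφN : ∀ k, N k ≤ φ k := fun k => by
    have := Finset.single_le_sum (f := N) (fun i _ => Nat.zero_le _)
      (Finset.self_mem_range_succ k)
    exact this.trans (Nat.le_add_right _ _)
  have hφm : ∀ k, φ k ≤ φ (k + 1) := fun k => by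
    simp only [φ, Finset.sum_range_succ _ (k + 1)]
    omega
  have hφk : ∀ k, k ≤ φ k := fun k => Nat.le_add_left _ _
  -- Borel–Cantelli: consecutive terms of the subsequence eventually differ by at most `2⁻ᵏ` almost
  -- everywhere.
  have hbc : ∀ᵐ u ∂leb, ∀ᶠ k in atTop,
      u ∉ {u | (1 / 2 : ℝ) ^ k < |v (φ k) u - v (φ (k + 1)) u|} := by
    refine ae_eventually_notMem ?_
    refine ne_top_of_le_ne_top ?_ (ENNReal.tsum_le_tsum fun k =>
      hN k _ (hφN k) _ ((hφN k).trans (hφm k)))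
    rw [← ENNReal.ofReal_tsum_of_nonneg (fun k => by positivity) summable_geometric_two]
    exact ENNReal.ofReal_ne_top
  have hconv : ∀ᵐ u ∂leb, ∃ l, Tendsto (fun k => v (φ k) u) atTop (𝓝 l) := by
    filter_upwards [hbc] with u hu
    obtain ⟨K, hK⟩ := eventually_atTop.1 hu
    have hc : CauchySeq (fun k => v (φ (k + K)) u) := by
      refine cauchySeq_of_le_geometric (1 / 2) ((1 / 2) ^ K) (by norm_num) fun k => ?_
      have := hK (k + K) (by omega)
      simp only [not_lt] at this
      rw [Real.dist_eq, ← pow_add, add_comm K k, show k + 1 + K = k + K + 1 by ring]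
      exact this
    obtain ⟨l, hl⟩ := cauchySeq_tendsto_of_complete hc
    exact ⟨l, (tendsto_add_atTop_iff_nat K).1 hl⟩
  obtain ⟨w, hwm, hw⟩ := measurable_limit_of_tendsto_metrizable_ae (fun k => hv (φ k)) hconv
  refine ⟨AEEqFun.mk w hwm.aestronglyMeasurable, ?_⟩
  refine TendstoInMeasure.congr_right (AEEqFun.coeFn_mk w hwm.aestronglyMeasurable).symm ?_
  have hsub : TendstoInMeasure leb (fun k => v (φ k)) atTop w :=
    tendstoInMeasure_of_tendsto_ae (fun k => (hv _).aestronglyMeasurable) hw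
  rw [tendstoInMeasure_iff_norm] at hsub ⊢
  intro ε hε
  rw [ENNReal.tendsto_nhds_zero]
  intro δ hδ
  rcases eq_or_ne δ ⊤ with rfl | hδt
  · simp
  have hδ' : 0 < δ.toReal := ENNReal.toReal_pos hδ.ne' hδt
  obtain ⟨M, hM⟩ := h (ε / 4) (by positivity) (δ.toReal / 2) (by positivity)
  have h2 := (ENNReal.tendsto_nhds_zero.1 (hsub (ε / 2) (by positivity)))
    (ENNReal.ofReal (δ.toReal / 2)) (ENNReal.ofReal_pos.2 (by positivity))
  obtain ⟨k, hk, hkM⟩ := (h2.and (eventually_ge_atTop M)).exists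
  filter_upwards [eventually_ge_atTop M] with n hn
  calc leb {u | ε ≤ ‖v n u - w u‖}
      ≤ leb ({u | ε / 4 < |v n u - v (φ k) u|} ∪ {u | ε / 2 ≤ ‖v (φ k) u - w u‖}) := by
        refine measure_mono fun u hu => ?_
        by_contra hcon
        simp only [mem_union, mem_ofPred_eq, not_or, not_lt, not_le, Real.norm_eq_abs] at hcon hu
        linarith [abs_sub_le (v n u) (v (φ k) u) (w u)]
    _ ≤ ENNReal.ofReal (δ.toReal / 2) + ENNReal.ofReal (δ.toReal / 2) :=
        (measure_union_le _ _).trans (add_le_add (hM n hn _ (hkM.trans (hφk k))) hk)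
    _ = δ := by
        rw [← ENNReal.ofReal_add (by positivity) (by positivity), add_halves,
          ENNReal.ofReal_toReal hδt]

/-! ### Comparison of integrals of decreasing functions -/

theorem measure_Ioo_zero_one_le {ν : Measure ℝ} {B : ENNReal}
    (h : ∀ b ∈ Ioo (0 : ℝ) 1, ν (Ioo 0 b) ≤ B) : ν (Ioo 0 1) ≤ B := by
  -- The shift to `n + 2` keeps every endpoint inside `(0,1)`, already for `n = 0`.
  have h0 : Ioo (0 : ℝ) 1 = ⋃ n : ℕ, Ioo (0 : ℝ) (1 - 1 / ((n : ℝ) + 2)) := by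
    ext u
    simp only [mem_iUnion, mem_Ioo]
    constructor
    · rintro ⟨h0, h1⟩
      obtain ⟨n, hn⟩ := exists_nat_one_div_lt (sub_pos.2 h1)
      refine ⟨n, h0, ?_⟩
      have : 1 / ((n : ℝ) + 2) ≤ 1 / ((n : ℝ) + 1) :=
        one_div_le_one_div_of_le (by positivity) (by linarith)
      linarith
    · rintro ⟨n, h0, h1⟩
      have : 0 < 1 / ((n : ℝ) + 2) := by positivity
      exact ⟨h0, by linarith⟩
  rw [h0]
  have hmono : Monotone fun n : ℕ => Ioo (0 : ℝ) (1 - 1 / ((n : ℝ) + 2)) := by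
    intro m n hmn
    refine Ioo_subset_Ioo_right (sub_le_sub_left ?_ _)
    exact one_div_le_one_div_of_le (by positivity) (by gcongr)
  rw [hmono.measure_iUnion]
  refine iSup_le fun n => h _ ⟨?_, ?_⟩
  · have : 1 / ((n : ℝ) + 2) ≤ 1 / 2 :=
      one_div_le_one_div_of_le (by positivity) (by linarith [n.cast_nonneg (α := ℝ)])
    linarith
  · have : 0 < 1 / ((n : ℝ) + 2) := by positivity
    linarith

/-- Such a set is an initial interval up to its right endpoint, which carries no `ν₁` mass. If the
supremum is `1`, the bound comes from exhausting `(0,1)` from below. -/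
theorem measure_le_of_isLowerSet {ν₁ ν₂ : Measure ℝ} [NullSingletonClass ν₁]
    (h : ∀ b ∈ Ioo (0 : ℝ) 1, ν₁ (Ioo 0 b) ≤ ν₂ (Ioo 0 b)) {A : Set ℝ} (hA : A ⊆ Ioo 0 1)
    (hlow : ∀ t ∈ A, ∀ s, 0 < s → s ≤ t → s ∈ A) : ν₁ A ≤ ν₂ A := by
  rcases A.eq_empty_or_nonempty with rfl | hne
  · simp
  have hbdd : BddAbove A := ⟨1, fun t ht => (hA ht).2.le⟩
  have h1 : sSup A ≤ 1 := csSup_le hne fun t ht => (hA ht).2.le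
  have h0 : 0 < sSup A := by
    obtain ⟨t, ht⟩ := hne
    exact (hA ht).1.trans_le (le_csSup hbdd ht)
  have hsub : Ioo 0 (sSup A) ⊆ A := by
    rintro s ⟨hs0, hs⟩
    obtain ⟨t, ht, hst⟩ := exists_lt_of_lt_csSup hne hs
    exact hlow t ht s hs0 hst.le
  have hsup : A ⊆ Ioc 0 (sSup A) := fun t ht => ⟨(hA ht).1, le_csSup hbdd ht⟩
  have key : ν₁ (Ioo 0 (sSup A)) ≤ ν₂ (Ioo 0 (sSup A)) := by
    rcases h1.lt_or_eq with h1 | h1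
    · exact h _ ⟨h0, h1⟩
    · rw [h1]
      exact measure_Ioo_zero_one_le fun b hb =>
        (h b hb).trans (measure_mono (Ioo_subset_Ioo_right hb.2.le))
  calc ν₁ A ≤ ν₁ (Ioc 0 (sSup A)) := measure_mono hsup
    _ = ν₁ (Ioo 0 (sSup A)) := (measure_congr Ioo_ae_eq_Ioc).symm
    _ ≤ ν₂ (Ioo 0 (sSup A)) := key
    _ ≤ ν₂ A := measure_mono hsub

/-- Layer cake formula: each superlevel set of a decreasing function is an initial interval. This is
the comparison principle used throughout. -/
theorem lintegral_antitone_le {ν₁ ν₂ : Measure ℝ} [NullSingletonClass ν₁]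
    (h : ∀ b ∈ Ioo (0 : ℝ) 1, ν₁ (Ioo 0 b) ≤ ν₂ (Ioo 0 b)) {f : ℝ → ℝ}
    (hf : AntitoneOn f (Ioo 0 1)) (hf0 : ∀ t ∈ Ioo (0 : ℝ) 1, 0 ≤ f t) :
    ∫⁻ t in Ioo 0 1, ENNReal.ofReal (f t) ∂ν₁ ≤ ∫⁻ t in Ioo 0 1, ENNReal.ofReal (f t) ∂ν₂ := by
  have hnn : ∀ ν : Measure ℝ, 0 ≤ᵐ[ν.restrict (Ioo 0 1)] f := fun ν =>
    (ae_restrict_iff' measurableSet_Ioo).2 (Eventually.of_forall hf0)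
  rw [lintegral_eq_lintegral_meas_lt _ (hnn ν₁) (aemeasurable_of_antitoneOn_Ioo hf _),
    lintegral_eq_lintegral_meas_lt _ (hnn ν₂) (aemeasurable_of_antitoneOn_Ioo hf _)]
  refine lintegral_mono fun s => ?_
  simp only [Measure.restrict_apply' measurableSet_Ioo]
  refine measure_le_of_isLowerSet h inter_subset_right ?_
  rintro t ⟨ht, ht1⟩ r hr hrt
  have hr1 : r ∈ Ioo (0 : ℝ) 1 := ⟨hr, hrt.trans_lt ht1.2⟩
  exact ⟨lt_of_lt_of_le ht (hf hr1 ht1 hrt), hr1⟩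

/-! ### Quasi-concave weights -/

/-- Weights for which `ω(u)` increases and `ω(u)/u` decreases, positive on `(0,1)` and vanishing
at the origin. -/
structure IsQuasiconcave (ω : ℝ → ℝ) : Prop extends IsWeight ω where
  zero : ω 0 = 0
  tendsto_zero : Tendsto ω (𝓝[>] 0) (𝓝 0)
  pos : ∀ u ∈ Ioo (0 : ℝ) 1, 0 < ω u
  mul_le_mul : ∀ u v : ℝ, 0 < u → u ≤ v → v < 1 → u * ω v ≤ v * ω u

namespace IsQuasiconcave

variable {ω : ℝ → ℝ}

/-- Monotonicity of `ω` and of `ω(u)/u` in opposite directions gives `|ω(v) - ω(u)| ≤ (ω(u)/u)|v -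
u|`. -/
theorem continuousAt (h : IsQuasiconcave ω) {u : ℝ} (hu : u ∈ Ioo (0 : ℝ) 1) :
    ContinuousAt ω u := by
  have hb : ∀ᶠ v in 𝓝 u, |ω v - ω u| ≤ ω u / u * |v - u| := by
    filter_upwards [Ioo_mem_nhds hu.1 hu.2] with v hv
    rw [div_mul_eq_mul_div, le_div_iff₀ hu.1]
    rcases le_total u v with huv | huv
    · have h1 := h.mono ⟨hu.1.le, hu.2⟩ ⟨hv.1.le, hv.2⟩ huv
      rw [abs_of_nonneg (by linarith), abs_of_nonneg (by linarith)]
      linarith [h.mul_le_mul u v hu.1 huv hv.2]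
    · have h1 := h.mono ⟨hv.1.le, hv.2⟩ ⟨hu.1.le, hu.2⟩ huv
      rw [abs_of_nonpos (by linarith), abs_of_nonpos (by linarith)]
      linarith [h.mul_le_mul v u hv.1 huv hu.2]
  rw [ContinuousAt, tendsto_iff_dist_tendsto_zero]
  refine squeeze_zero' (Eventually.of_forall fun v => dist_nonneg) hb ?_
  have : Tendsto (fun v => ω u / u * |v - u|) (𝓝 u) (𝓝 (ω u / u * |u - u|)) :=
    (Continuous.tendsto (by fun_prop) u)
  simpa using this

theorem ext_eq {u : ℝ} (hu : u ∈ Ico (0 : ℝ) 1) : ext ω u = ω u := by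
  simp [ext, hu.2, max_eq_left hu.1]

theorem continuousAt_ext (h : IsQuasiconcave ω) {u : ℝ} (hu : u ∈ Ioo (0 : ℝ) 1) :
    ContinuousAt (ext ω) u := by
  refine (h.continuousAt hu).congr ?_
  filter_upwards [Ioo_mem_nhds hu.1 hu.2] with v hv
  exact (ext_eq ⟨hv.1.le, hv.2⟩).symm

theorem stieltjes_eq (h : IsQuasiconcave ω) {u : ℝ} (hu : u ∈ Ioo (0 : ℝ) 1) :
    h.toIsWeight.monotone_ext.stieltjesFunction u = ω u := by
  rw [Monotone.stieltjesFunction_eq, (h.continuousAt_ext hu).continuousWithinAt.rightLim_eq,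
    ext_eq ⟨hu.1.le, hu.2⟩]

theorem leftLim_stieltjes_eq (h : IsQuasiconcave ω) {u : ℝ} (hu : u ∈ Ioo (0 : ℝ) 1) :
    Function.leftLim h.toIsWeight.monotone_ext.stieltjesFunction u = ω u := by
  refine leftLim_eq_of_tendsto ?_
  refine Tendsto.congr' ?_ ((h.continuousAt hu).tendsto.mono_left nhdsWithin_le_nhds)
  filter_upwards [Ioo_mem_nhdsLT hu.1] with v hv
  exact (h.stieltjes_eq ⟨hv.1, hv.2.trans hu.2⟩).symm

theorem stieltjes_zero (h : IsQuasiconcave ω) :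
    h.toIsWeight.monotone_ext.stieltjesFunction 0 = 0 := by
  rw [Monotone.stieltjesFunction_eq]
  refine rightLim_eq_of_tendsto ?_
  refine Tendsto.congr' ?_ h.tendsto_zero
  filter_upwards [Ioo_mem_nhdsGT one_pos] with v hv
  exact (ext_eq ⟨hv.1.le, hv.2⟩).symm

theorem measure_Ioo (h : IsQuasiconcave ω) {u : ℝ} (hu : u ∈ Ioo (0 : ℝ) 1) :
    h.toIsWeight.measure (Ioo 0 u) = ENNReal.ofReal (ω u) := by
  rw [IsWeight.measure, Measure.restrict_apply measurableSet_Ioo,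
    inter_eq_left.2 (Ioo_subset_Ioo_right hu.2.le), StieltjesFunction.measure_Ioo,
    h.leftLim_stieltjes_eq hu, h.stieltjes_zero, sub_zero]

theorem noAtoms (h : IsQuasiconcave ω) : NullSingletonClass h.toIsWeight.measure := by
  refine ⟨fun u => ?_⟩
  rw [IsWeight.measure, Measure.restrict_apply (measurableSet_singleton u)]
  by_cases hu : u ∈ Ioo (0 : ℝ) 1
  · rw [inter_eq_left.2 (singleton_subset_iff.2 hu), StieltjesFunction.measure_singleton,
      h.leftLim_stieltjes_eq hu, h.stieltjes_eq hu, sub_self, ENNReal.ofReal_zero]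
  · rw [singleton_inter_eq_empty.2 hu, measure_empty]

end IsQuasiconcave

theorem IsWeight.measure_restrict {ω : ℝ → ℝ} (h : IsWeight ω) :
    h.measure.restrict (Ioo 0 1) = h.measure := by
  rw [IsWeight.measure, Measure.restrict_restrict measurableSet_Ioo, inter_self]

theorem IsQuasiconcave.measure_Ioo_one_le {ω : ℝ → ℝ} (h : IsQuasiconcave ω) :
    h.toIsWeight.measure (Ioo 0 1) ≤ 1 := by
  refine measure_Ioo_zero_one_le fun b hb => ?_
  rw [h.measure_Ioo hb]
  exact ENNReal.ofReal_le_one.2 (h.mapsTo ⟨hb.1.le, hb.2⟩).2.le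

theorem IsQuasiconcave.isFiniteMeasure {ω : ℝ → ℝ} (h : IsQuasiconcave ω) :
    IsFiniteMeasure h.toIsWeight.measure := by
  refine ⟨?_⟩
  rw [← h.toIsWeight.measure_restrict, Measure.restrict_apply_univ]
  exact h.measure_Ioo_one_le.trans_lt ENNReal.one_lt_top

/-- For `v < 1` this is the decrease of `ω(u)/u`. For `v ≥ 1` only the mass on `(0,1)` counts, and
it is a limit of the former case. -/
theorem IsQuasiconcave.measure_Ioo_le {ω : ℝ → ℝ} (h : IsQuasiconcave ω) {b v : ℝ}
    (hb : b ∈ Ioo (0 : ℝ) 1) (hbv : b ≤ v) :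
    h.toIsWeight.measure (Ioo 0 v) ≤ ENNReal.ofReal (v / b) * ENNReal.ofReal (ω b) := by
  have hvb : 1 ≤ v / b := (one_le_div hb.1).2 hbv
  have key : ∀ w ∈ Ioo (0 : ℝ) 1, w ≤ v →
      h.toIsWeight.measure (Ioo 0 w) ≤ ENNReal.ofReal (v / b) * ENNReal.ofReal (ω b) := by
    intro w hw hwv
    have hωb := h.pos b hb
    rw [h.measure_Ioo hw, ← ENNReal.ofReal_mul (by positivity)]
    refine ENNReal.ofReal_le_ofReal ?_
    rcases le_total b w with hbw | hbw
    · have := h.mul_le_mul b w hb.1 hbw hw.2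
      rw [div_mul_eq_mul_div, le_div_iff₀ hb.1]
      nlinarith
    · exact (h.mono ⟨hw.1.le, hw.2⟩ ⟨hb.1.le, hb.2⟩ hbw).trans (by nlinarith)
  rcases lt_or_ge v 1 with hv | hv
  · exact key v ⟨hb.1.trans_le hbv, hv⟩ le_rfl
  · calc h.toIsWeight.measure (Ioo 0 v) ≤ h.toIsWeight.measure (Ioo 0 1) := by
          rw [← h.toIsWeight.measure_restrict, Measure.restrict_apply measurableSet_Ioo,
            Measure.restrict_apply measurableSet_Ioo, inter_self]
          exact measure_mono inter_subset_right
      _ ≤ _ := measure_Ioo_zero_one_le fun w hw => key w hw (hw.2.le.trans hv)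

/-- Dilations are bounded on decreasing functions. -/
theorem IsQuasiconcave.lintegral_half_le {ω : ℝ → ℝ} (h : IsQuasiconcave ω) {z : ℝ → ℝ}
    (hz : AntitoneOn z (Ioo 0 1)) (hz0 : ∀ t ∈ Ioo (0 : ℝ) 1, 0 ≤ z t) :
    ∫⁻ t, ENNReal.ofReal (z (t / 2)) ∂h.toIsWeight.measure ≤
      2 * ∫⁻ t, ENNReal.ofReal (z t) ∂h.toIsWeight.measure := by
  set ν := h.toIsWeight.measure with hν
  have := h.noAtoms
  have hm : Measurable fun t : ℝ => t / 2 := by fun_prop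
  have hme : MeasurableEmbedding fun t : ℝ => t / 2 :=
    (Homeomorph.mulRight₀ (2 : ℝ)⁻¹ (by norm_num)).measurableEmbedding
  have hna : NullSingletonClass (ν.map fun t => t / 2) := by
    refine ⟨fun u => ?_⟩
    rw [Measure.map_apply hm (measurableSet_singleton u)]
    have : (fun t : ℝ => t / 2) ⁻¹' {u} = {2 * u} := by
      ext t
      simp only [mem_preimage, mem_singleton_iff]
      constructor <;> intro <;> linarith
    rw [this, measure_singleton]
  -- The push-forward of `dω` under `t ↦ t/2` gives `(0,b)` the mass of `(0,2b)`, at most twice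
  -- `ω(b)`.
  have hcomp : ∀ b ∈ Ioo (0 : ℝ) 1, (ν.map fun t => t / 2) (Ioo 0 b) ≤
      ((2 : ENNReal) • ν) (Ioo 0 b) := by
    intro b hb
    rw [Measure.map_apply hm measurableSet_Ioo, Measure.smul_apply, smul_eq_mul,
      h.measure_Ioo hb]
    have : (fun t : ℝ => t / 2) ⁻¹' Ioo 0 b = Ioo 0 (2 * b) := by
      ext t
      simp only [mem_preimage, mem_Ioo]
      constructor <;> rintro ⟨h1, h2⟩ <;> constructor <;> linarith
    rw [this]
    refine (h.measure_Ioo_le hb (by linarith [hb.1])).trans ?_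
    rw [mul_div_assoc, div_self hb.1.ne', mul_one]
    simp
  have key := lintegral_antitone_le hcomp hz hz0
  rw [Measure.restrict_smul, lintegral_smul_measure, h.toIsWeight.measure_restrict,
    smul_eq_mul] at key
  refine le_trans ?_ key
  rw [hme.restrict_map, hme.lintegral_map]
  rw [hν, ← h.toIsWeight.measure_restrict, ← hν, Measure.restrict_restrict (hm measurableSet_Ioo)]
  refine lintegral_mono' (Measure.restrict_mono ?_ le_rfl) le_rfl
  rintro t ⟨h1, h2⟩
  refine ⟨⟨?_, ?_⟩, h1, h2⟩
  · show 0 < t / 2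
    linarith
  · show t / 2 < 1
    linarith

/-! ### Lorentz spaces -/

/-- The functional of a Lorentz space, with values in `[0,∞]`. -/
def lnorm (ν : Measure ℝ) (f : ℝ → ℝ) : ENNReal := ∫⁻ s, ENNReal.ofReal (rearrFun f s) ∂ν

theorem mem_lorentz {ω : ℝ → ℝ} {h : IsWeight ω} {x : S01} :
    x ∈ (lorentz ω h).carrier ↔ lnorm h.measure x < ⊤ := Iff.rfl

theorem qnorm_lorentz {ω : ℝ → ℝ} (h : IsWeight ω) (x : S01) :
    (lorentz ω h).qnorm x = (lnorm h.measure x).toReal := rfl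

theorem IsWeight.lintegral_mono {ω : ℝ → ℝ} (h : IsWeight ω) {F G : ℝ → ENNReal}
    (hFG : ∀ t ∈ Ioo (0 : ℝ) 1, F t ≤ G t) : ∫⁻ t, F t ∂h.measure ≤ ∫⁻ t, G t ∂h.measure := by
  rw [← h.measure_restrict]
  exact setLIntegral_mono' measurableSet_Ioo hFG

theorem IsWeight.aemeasurable {ω : ℝ → ℝ} (h : IsWeight ω) {z : ℝ → ℝ}
    (hz : AntitoneOn z (Ioo 0 1)) : AEMeasurable z h.measure := by
  rw [← h.measure_restrict]
  exact aemeasurable_of_antitoneOn_Ioo hz _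

theorem lnorm_mono {ω : ℝ → ℝ} (h : IsWeight ω) {f g : ℝ → ℝ} (hf : AEMeasurable f leb)
    (hg : AEMeasurable g leb) (hfg : ∀ᵐ u ∂leb, |f u| ≤ |g u|) :
    lnorm h.measure f ≤ lnorm h.measure g :=
  h.lintegral_mono fun _ ht => ENNReal.ofReal_le_ofReal (rearrFun_mono hf hg hfg ht.1)

theorem lnorm_congr (ν : Measure ℝ) {f g : ℝ → ℝ} (h : f =ᵐ[leb] g) : lnorm ν f = lnorm ν g := by
  rw [lnorm, lnorm, rearrFun_congr h]

theorem lnorm_const_mul {ω : ℝ → ℝ} (h : IsWeight ω) (a : ℝ) {f : ℝ → ℝ}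
    (hf : AEMeasurable f leb) :
    lnorm h.measure (fun u => a * f u) = ENNReal.ofReal |a| * lnorm h.measure f := by
  rw [lnorm, lnorm, ← lintegral_const_mul'' _
    (h.aemeasurable (rearrFun_antitoneOn_Ioo hf)).ennreal_ofReal]
  have key : ∀ t ∈ Ioo (0 : ℝ) 1, ENNReal.ofReal (rearrFun (fun u => a * f u) t) =
      ENNReal.ofReal |a| * ENNReal.ofReal (rearrFun f t) := fun t ht => by
    rw [rearrFun_const_mul a hf ht.1, ENNReal.ofReal_mul (abs_nonneg a)]
  exact le_antisymm (h.lintegral_mono fun t ht => (key t ht).le)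
    (h.lintegral_mono fun t ht => (key t ht).ge)

/-- Lower semicontinuity of Lorentz functionals under convergence in measure. -/
theorem lnorm_le_of_tendstoInMeasure {ω : ℝ → ℝ} (h : IsWeight ω) {v : ℕ → ℝ → ℝ} {f : ℝ → ℝ}
    (hv : ∀ n, AEMeasurable (v n) leb) (hf : AEMeasurable f leb)
    (hvf : TendstoInMeasure leb v atTop f) {B : ENNReal}
    (hB : ∀ᶠ n in atTop, lnorm h.measure (v n) ≤ B) : lnorm h.measure f ≤ B := by
  calc lnorm h.measure f
      ≤ ∫⁻ t, liminf (fun n => ENNReal.ofReal (rearrFun (v n) t)) atTop ∂h.measure :=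
        h.lintegral_mono fun t ht => ofReal_rearrFun_le_liminf hv hf hvf ht.1
    _ ≤ liminf (fun n => lnorm h.measure (v n)) atTop :=
        lintegral_liminf_le' fun n =>
          (h.aemeasurable (rearrFun_antitoneOn_Ioo (hv n))).ennreal_ofReal
    _ ≤ B := by
        refine (liminf_le_limsup (by isBoundedDefault) (by isBoundedDefault)).trans ?_
        exact limsup_le_of_le (by isBoundedDefault) hB

/-- The bound `μ(t; f+g) ≤ μ(t/2; f) + μ(t/2; g)` is combined with the bound `2` for the dilation.
-/
theorem IsQuasiconcave.lnorm_add_le {ω : ℝ → ℝ} (h : IsQuasiconcave ω) {f g : ℝ → ℝ}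
    (hf : AEMeasurable f leb) (hg : AEMeasurable g leb) :
    lnorm h.toIsWeight.measure (f + g) ≤
      2 * (lnorm h.toIsWeight.measure f + lnorm h.toIsWeight.measure g) := by
  have half : AntitoneOn (fun t => rearrFun f (t / 2)) (Ioo 0 1) := fun s hs t ht hst =>
    rearrFun_antitoneOn hf (half_pos hs.1) (half_pos ht.1) (by linarith)
  calc lnorm h.toIsWeight.measure (f + g)
      ≤ ∫⁻ t, ENNReal.ofReal (rearrFun f (t / 2)) + ENNReal.ofReal (rearrFun g (t / 2))
          ∂h.toIsWeight.measure := by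
        refine h.toIsWeight.lintegral_mono fun t ht => ?_
        rw [← ENNReal.ofReal_add (rearrFun_nonneg _ _) (rearrFun_nonneg _ _)]
        refine ENNReal.ofReal_le_ofReal ?_
        have := rearrFun_add_le hf hg (half_pos ht.1) (half_pos ht.1)
        rwa [add_halves] at this
    _ = ∫⁻ t, ENNReal.ofReal (rearrFun f (t / 2)) ∂h.toIsWeight.measure +
          ∫⁻ t, ENNReal.ofReal (rearrFun g (t / 2)) ∂h.toIsWeight.measure :=
        lintegral_add_left' (h.toIsWeight.aemeasurable half).ennreal_ofReal _
    _ ≤ _ := by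
        rw [mul_add]
        exact add_le_add
          (h.lintegral_half_le (rearrFun_antitoneOn_Ioo hf) fun t _ => rearrFun_nonneg _ _)
          (h.lintegral_half_le (rearrFun_antitoneOn_Ioo hg) fun t _ => rearrFun_nonneg _ _)

theorem IsQuasiconcave.mul_rearrFun_le {ω : ℝ → ℝ} (h : IsQuasiconcave ω) {f : ℝ → ℝ}
    (hf : AEMeasurable f leb) {t : ℝ} (ht : t ∈ Ioo (0 : ℝ) 1) :
    ENNReal.ofReal (rearrFun f t) * ENNReal.ofReal (ω t) ≤ lnorm h.toIsWeight.measure f := by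
  rw [← h.measure_Ioo ht, ← setLIntegral_const]
  refine le_trans (setLIntegral_mono' measurableSet_Ioo fun s hs => ?_)
    (setLIntegral_le_lintegral (Ioo 0 t) _)
  exact ENNReal.ofReal_le_ofReal (rearrFun_antitoneOn hf hs.1 ht.1 hs.2.le)

/-- A Chebyshev inequality: smallness in the Lorentz functional forces smallness in measure, since
`ω(t) > 0`. -/
theorem leb_lt_abs_le_of_lnorm {ω : ℝ → ℝ} (h : IsQuasiconcave ω) {f : ℝ → ℝ}
    (hf : AEMeasurable f leb) {t s : ℝ} (ht : t ∈ Ioo (0 : ℝ) 1) (hs : 0 ≤ s)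
    (hle : lnorm h.toIsWeight.measure f ≤ ENNReal.ofReal (s * ω t)) :
    leb {u | s < |f u|} ≤ ENNReal.ofReal t := by
  rw [← rearrFun_le_iff hf ht.1 hs]
  have h1 := (h.mul_rearrFun_le hf ht).trans hle
  have hω := h.pos t ht
  rw [← ENNReal.ofReal_mul (rearrFun_nonneg f t), ENNReal.ofReal_le_ofReal_iff (by positivity)]
    at h1
  exact le_of_mul_le_mul_right h1 hω

theorem eq_zero_of_lnorm_eq_zero {ω : ℝ → ℝ} (h : IsQuasiconcave ω) {x : S01}
    (hx : lnorm h.toIsWeight.measure x = 0) : x = 0 := by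
  have h0 : leb {u | 0 < |x u|} = 0 := by
    refine le_antisymm (le_of_forall_gt fun c hc => ?_) bot_le
    obtain ⟨t, ht0, htc⟩ : ∃ t : ℝ, t ∈ Ioo (0 : ℝ) 1 ∧ ENNReal.ofReal t < c := by
      rcases eq_or_ne c ⊤ with rfl | hct
      · exact ⟨1 / 2, by norm_num, ENNReal.ofReal_lt_top⟩
      · have hc' : 0 < c.toReal := ENNReal.toReal_pos hc.ne' hct
        refine ⟨min (c.toReal / 2) (1 / 2), ⟨by positivity,
          (min_le_right _ _).trans_lt (by norm_num)⟩, ?_⟩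
        rw [ENNReal.ofReal_lt_iff_lt_toReal (by positivity) hct]
        exact (min_le_left _ _).trans_lt (by linarith)
    exact (leb_lt_abs_le_of_lnorm h x.aestronglyMeasurable.aemeasurable ht0 le_rfl
      (by simp [hx])).trans_lt htc
  refine AEEqFun.ext ?_
  have h1 : ∀ᵐ u ∂leb, ¬ 0 < |x u| := by
    rw [ae_iff]
    simpa only [not_not] using h0
  filter_upwards [h1, AEEqFun.coeFn_zero (μ := leb) (β := ℝ)] with u hu hu0
  rw [hu0]
  simpa using hu

theorem lnorm_zero {ω : ℝ → ℝ} (h : IsWeight ω) : lnorm h.measure (0 : ℝ → ℝ) = 0 := by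
  have := lnorm_const_mul h 0 (f := 0) aemeasurable_const
  simpa [Pi.zero_def] using this

theorem lnorm_coe_zero {ω : ℝ → ℝ} (h : IsWeight ω) : lnorm h.measure (0 : S01) = 0 := by
  rw [lnorm_congr _ AEEqFun.coeFn_zero, lnorm_zero]

theorem lnorm_coe_smul {ω : ℝ → ℝ} (h : IsWeight ω) (a : ℝ) (x : S01) :
    lnorm h.measure (a • x : S01) = ENNReal.ofReal |a| * lnorm h.measure x := by
  rw [← lnorm_const_mul h a x.aestronglyMeasurable.aemeasurable]
  exact lnorm_congr _ (AEEqFun.coeFn_smul a x)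

/-- A Lorentz space is quasi-normed as soon as its functional satisfies the quasi-triangle
inequality. -/
theorem isQuasiNormed_lorentz {ω : ℝ → ℝ} (h : IsQuasiconcave ω) {K : NNReal}
    (hK : ∀ f g : ℝ → ℝ, AEMeasurable f leb → AEMeasurable g leb →
      lnorm h.toIsWeight.measure (f + g) ≤
        K * (lnorm h.toIsWeight.measure f + lnorm h.toIsWeight.measure g)) :
    IsQuasiNormed K (lorentz ω h.toIsWeight) := by
  have hadd : ∀ x y : S01, lnorm h.toIsWeight.measure (x + y : S01) ≤
      K * (lnorm h.toIsWeight.measure x + lnorm h.toIsWeight.measure y) := fun x y => by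
    rw [lnorm_congr _ (AEEqFun.coeFn_add x y)]
    exact hK _ _ x.aestronglyMeasurable.aemeasurable y.aestronglyMeasurable.aemeasurable
  have hfin : ∀ x ∈ (lorentz ω h.toIsWeight).carrier, ∀ y ∈ (lorentz ω h.toIsWeight).carrier,
      K * (lnorm h.toIsWeight.measure x + lnorm h.toIsWeight.measure y) < ⊤ := fun x hx y hy =>
    ENNReal.mul_lt_top ENNReal.coe_lt_top (ENNReal.add_lt_top.2 ⟨hx, hy⟩)
  refine ⟨?_, ?_, ?_, ?_, ?_, ?_, ?_⟩
  · rw [mem_lorentz, lnorm_coe_zero]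
    exact ENNReal.zero_lt_top
  · exact fun x hx y hy => (hadd x y).trans_lt (hfin x hx y hy)
  · intro a x hx
    rw [mem_lorentz, lnorm_coe_smul]
    exact ENNReal.mul_lt_top ENNReal.ofReal_lt_top hx
  · exact fun x _ => ENNReal.toReal_nonneg
  · intro x hx
    rw [qnorm_lorentz]
    constructor
    · intro h0
      rw [ENNReal.toReal_eq_zero_iff] at h0
      exact eq_zero_of_lnorm_eq_zero h (h0.resolve_right (ne_of_lt hx))
    · rintro rfl
      rw [lnorm_coe_zero, ENNReal.toReal_zero]
  · intro a x _
    rw [qnorm_lorentz, lnorm_coe_smul, ENNReal.toReal_mul, ENNReal.toReal_ofReal (abs_nonneg a)]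
    rfl
  · intro x hx y hy
    rw [qnorm_lorentz, qnorm_lorentz, qnorm_lorentz, ← ENNReal.toReal_add (mem_lorentz.1 hx).ne
      (mem_lorentz.1 hy).ne]
    have := ENNReal.toReal_mono (hfin x hx y hy).ne (hadd x y)
    rwa [ENNReal.toReal_mul, ENNReal.coe_toReal] at this

theorem isSymmetric_lorentz {ω : ℝ → ℝ} (h : IsWeight ω) : IsSymmetric (lorentz ω h) := by
  refine ⟨fun x hx y hy => ?_, fun x hx y hy => ?_⟩
  · have hle : lnorm h.measure y ≤ lnorm h.measure x :=
      lnorm_mono h y.aestronglyMeasurable.aemeasurable x.aestronglyMeasurable.aemeasurable hy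
    exact ⟨hle.trans_lt hx, ENNReal.toReal_mono (ne_of_lt hx) hle⟩
  · have heq : lnorm h.measure y = lnorm h.measure x :=
      le_antisymm (h.lintegral_mono fun t ht => (congrArg ENNReal.ofReal (hy t ht)).le)
        (h.lintegral_mono fun t ht => (congrArg ENNReal.ofReal (hy t ht)).ge)
    exact ⟨mem_lorentz.2 (heq ▸ hx), congrArg ENNReal.toReal heq⟩

/-- A Cauchy sequence is Cauchy in measure, hence has a limit in measure. Lower semicontinuity of
the functional, applied to `v m - v n` as `n → ∞`, turns this into convergence in the space. -/
theorem isComplete_lorentz {ω : ℝ → ℝ} (h : IsQuasiconcave ω) :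
    IsComplete (lorentz ω h.toIsWeight) := by
  intro v hv hc
  have hadd : ∀ x y : S01, x ∈ (lorentz ω h.toIsWeight).carrier →
      y ∈ (lorentz ω h.toIsWeight).carrier → x - y ∈ (lorentz ω h.toIsWeight).carrier := by
    have hq := isQuasiNormed_lorentz h (K := 2) fun f g hf hg => by
      simpa using h.lnorm_add_le hf hg
    intro x y hx hy
    have := hq.add_mem x hx _ (hq.smul_mem (-1) y hy)
    rwa [neg_one_smul, ← sub_eq_add_neg] at this
  have hm : ∀ x : S01, AEMeasurable x leb := fun x => x.aestronglyMeasurable.aemeasurable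
  have hlt : ∀ {m n : ℕ} {ε : ℝ}, 0 < ε → (lorentz ω h.toIsWeight).qnorm (v m - v n) < ε →
      lnorm h.toIsWeight.measure (v m - v n : S01) ≤ ENNReal.ofReal ε := by
    intro m n ε hε hlt
    rw [ENNReal.le_ofReal_iff_toReal_le ((mem_lorentz.1 (hadd _ _ (hv m) (hv n))).ne) hε.le]
    exact hlt.le
  obtain ⟨x, hx⟩ := exists_tendstoInMeasure_of_cauchy (v := fun n => v n) (fun n => hm _) (by
    intro ε hε δ hδ
    set t := min δ (1 / 2) with ht
    have ht1 : t ∈ Ioo (0 : ℝ) 1 := ⟨by positivity, (min_le_right _ _).trans_lt (by norm_num)⟩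
    have hω := h.pos t ht1
    obtain ⟨N, hN⟩ := hc (ε * ω t) (by positivity)
    refine ⟨N, fun m hm' n hn => ?_⟩
    have h1 := leb_lt_abs_le_of_lnorm h (hm _) ht1 hε.le (hlt (by positivity) (hN m hm' n hn))
    refine le_trans (le_of_eq (measure_congr ?_)) (h1.trans
      (ENNReal.ofReal_le_ofReal (min_le_left _ _)))
    filter_upwards [AEEqFun.coeFn_sub (v m) (v n)] with u hu
    refine propext ?_
    show ε < |v m u - v n u| ↔ ε < |(v m - v n : S01) u|
    rw [hu]
    rfl)
  have key : ∀ ε > 0, ∃ N, ∀ m ≥ N, lnorm h.toIsWeight.measure (v m - x : S01) ≤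
      ENNReal.ofReal ε := by
    intro ε hε
    obtain ⟨N, hN⟩ := hc ε hε
    refine ⟨N, fun m hm' => ?_⟩
    refine lnorm_le_of_tendstoInMeasure h.toIsWeight (v := fun n => (v m - v n : S01))
      (fun n => hm _) (hm _) ?_ (eventually_atTop.2 ⟨N, fun n hn => hlt hε (hN m hm' n hn)⟩)
    have h1 : TendstoInMeasure leb (fun n u => v m u - v n u) atTop (fun u => v m u - x u) := by
      rw [tendstoInMeasure_iff_norm] at hx ⊢
      intro ε hε
      have := hx ε hε
      simpa only [sub_sub_sub_cancel_left, norm_sub_rev] using this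
    exact h1.congr (fun n => (AEEqFun.coeFn_sub (v m) (v n)).symm)
      (AEEqFun.coeFn_sub (v m) x).symm
  refine ⟨x, ?_, ?_⟩
  · obtain ⟨N, hN⟩ := key 1 one_pos
    have h1 : v N - x ∈ (lorentz ω h.toIsWeight).carrier :=
      (hN N le_rfl).trans_lt ENNReal.ofReal_lt_top
    have := hadd _ _ (hv N) h1
    rwa [sub_sub_cancel] at this
  · rw [Metric.tendsto_atTop]
    intro ε hε
    obtain ⟨N, hN⟩ := key (ε / 2) (half_pos hε)
    refine ⟨N, fun n hn => ?_⟩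
    rw [Real.dist_eq, sub_zero, qnorm_lorentz, abs_of_nonneg ENNReal.toReal_nonneg]
    have := ENNReal.toReal_mono ENNReal.ofReal_ne_top (hN n hn)
    rw [ENNReal.toReal_ofReal (by positivity)] at this
    linarith

theorem IsQuasiconcave.isSymmetricQuasiBanach {ω : ℝ → ℝ} (h : IsQuasiconcave ω) :
    IsSymmetricQuasiBanach (lorentz ω h.toIsWeight) :=
  ⟨⟨_, isQuasiNormed_lorentz h (K := 2) fun f g hf hg => by simpa using h.lnorm_add_le hf hg⟩,
    isComplete_lorentz h, isSymmetric_lorentz h.toIsWeight⟩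

/-! ### Concave weights and the triangle inequality -/

theorem setLIntegral_leb {b : ℝ} (hb : b ≤ 1) (F : ℝ → ENNReal) :
    ∫⁻ s in Ioo 0 b, F s ∂leb = ∫⁻ s in Ioo 0 b, F s := by
  rw [leb, Measure.restrict_restrict measurableSet_Ioo,
    inter_eq_left.2 (Ioo_subset_Ioo_right hb)]

theorem nullSingletonClass_withDensity (μ : Measure ℝ) [NullSingletonClass μ] (F : ℝ → ENNReal) :
    NullSingletonClass (μ.withDensity F) :=
  ⟨fun _ => withDensity_absolutelyContinuous μ F (measure_singleton _)⟩

theorem leb_withDensity_Ioo {b : ℝ} (hb : b ≤ 1) (F : ℝ → ENNReal) :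
    leb.withDensity F (Ioo 0 b) = ∫⁻ s in Ioo 0 b, F s := by
  rw [withDensity_apply _ measurableSet_Ioo, setLIntegral_leb hb]

theorem restrict_leb_withDensity (F : ℝ → ENNReal) :
    (leb.withDensity F).restrict (Ioo 0 1) = leb.withDensity F := by
  rw [restrict_withDensity measurableSet_Ioo, leb, Measure.restrict_restrict measurableSet_Ioo,
    inter_self]

/-- The density is the right derivative, which decreases by concavity. The fundamental theorem of
calculus needs continuity up to `0`, supplied by `ω(0+) = ω(0) = 0`. -/
theorem IsQuasiconcave.exists_density {ω : ℝ → ℝ} (h : IsQuasiconcave ω)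
    (hc : ConcaveOn ℝ (Ico 0 1) ω) :
    ∃ γ : ℝ → ℝ, AntitoneOn γ (Ioo 0 1) ∧ (∀ t ∈ Ioo (0 : ℝ) 1, 0 ≤ γ t) ∧
      ∀ b ∈ Ioo (0 : ℝ) 1, ∫⁻ s in Ioo 0 b, ENNReal.ofReal (γ s) = ENNReal.ofReal (ω b) := by
  have hcv := hc.neg
  set γ : ℝ → ℝ := fun t => -derivWithin (-ω) (Ioi t) t with hγ
  have hderiv : ∀ t ∈ Ioo (0 : ℝ) 1, HasDerivWithinAt ω (γ t) (Ioi t) t := fun t ht => by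
    have := (hcv.hasDerivWithinAt_rightDeriv_of_mem_interior (by rwa [interior_Ico])).neg
    simpa using this
  have hnn : ∀ t ∈ Ioo (0 : ℝ) 1, 0 ≤ γ t := fun t ht => by
    have h1 : (t + 1) / 2 ∈ Ico (0 : ℝ) 1 := ⟨by linarith [ht.1], by linarith [ht.2]⟩
    have h2 : t < (t + 1) / 2 := by linarith [ht.2]
    refine le_trans ?_ (hc.slope_le_of_hasDerivWithinAt_Ioi ⟨ht.1.le, ht.2⟩ h1 h2 (hderiv t ht))
    rw [slope_def_field]
    exact div_nonneg (sub_nonneg.2 (h.mono ⟨ht.1.le, ht.2⟩ h1 h2.le)) (sub_nonneg.2 h2.le)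
  have hanti : AntitoneOn γ (Ioo 0 1) := by
    have := hcv.monotoneOn_rightDeriv
    rw [interior_Ico] at this
    exact this.neg
  refine ⟨γ, hanti, hnn, fun b hb => ?_⟩
  have hcont : ContinuousOn ω (Icc 0 b) := by
    intro t ht
    rcases ht.1.eq_or_lt with rfl | ht0
    · have h1 : ContinuousWithinAt ω (Ioi 0) 0 := by
        rw [ContinuousWithinAt, h.zero]
        exact h.tendsto_zero
      have h2 := continuousWithinAt_Ioi_iff_Ici.1 h1
      exact h2.mono Icc_subset_Ici_self
    · exact (h.continuousAt ⟨ht0, ht.2.trans_lt hb.2⟩).continuousWithinAt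
  have hsub : Ioo 0 b ⊆ Ioo (0 : ℝ) 1 := Ioo_subset_Ioo_right hb.2.le
  have hd' : ∀ t ∈ Ioo 0 b, HasDerivWithinAt ω (γ t) (Ioi t) t := fun t ht => hderiv t (hsub ht)
  have hint : IntegrableOn γ (Ioc 0 b) :=
    intervalIntegral.integrableOn_deriv_right_of_nonneg hcont hd' fun t ht => hnn t (hsub ht)
  have hI := intervalIntegral.integral_eq_sub_of_hasDeriv_right_of_le hb.1.le hcont hd'
    ((intervalIntegrable_iff_integrableOn_Ioc_of_le hb.1.le).2 hint)
  rw [intervalIntegral.integral_of_le hb.1.le, integral_Ioc_eq_integral_Ioo, h.zero, sub_zero]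
    at hI
  rw [← hI, ofReal_integral_eq_lintegral_ofReal (hint.mono_set Ioo_subset_Ioc_self)
    ((ae_restrict_iff' measurableSet_Ioo).2 (Eventually.of_forall fun t ht => hnn t (hsub ht)))]

/-- The two measures agree on every `(0,b)`, so the comparison principle applies in both directions.
-/
theorem IsQuasiconcave.lintegral_eq_of_density {ω γ : ℝ → ℝ} (h : IsQuasiconcave ω)
    (hγ : AntitoneOn γ (Ioo 0 1))
    (hγω : ∀ b ∈ Ioo (0 : ℝ) 1, ∫⁻ s in Ioo 0 b, ENNReal.ofReal (γ s) = ENNReal.ofReal (ω b))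
    {f : ℝ → ℝ} (hf : AntitoneOn f (Ioo 0 1)) (hf0 : ∀ t ∈ Ioo (0 : ℝ) 1, 0 ≤ f t) :
    ∫⁻ t, ENNReal.ofReal (f t) ∂h.toIsWeight.measure =
      ∫⁻ t, ENNReal.ofReal (γ t) * ENNReal.ofReal (f t) ∂leb := by
  have := h.noAtoms
  set F : ℝ → ENNReal := fun t => ENNReal.ofReal (γ t)
  have := nullSingletonClass_withDensity leb F
  have hF : AEMeasurable F leb := (aemeasurable_of_antitoneOn_Ioo hγ _).ennreal_ofReal
  have heq : ∀ b ∈ Ioo (0 : ℝ) 1, h.toIsWeight.measure (Ioo 0 b) = leb.withDensity F (Ioo 0 b) :=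
    fun b hb => by rw [leb_withDensity_Ioo hb.2.le, h.measure_Ioo hb, hγω b hb]
  have h1 := lintegral_antitone_le (fun b hb => (heq b hb).le) hf hf0
  have h2 := lintegral_antitone_le (fun b hb => (heq b hb).ge) hf hf0
  rw [h.toIsWeight.measure_restrict, restrict_leb_withDensity] at h1 h2
  rw [le_antisymm h1 h2, lintegral_withDensity_eq_lintegral_mul₀ hF
    (aemeasurable_of_antitoneOn_Ioo hf _).ennreal_ofReal]
  rfl

/-- Both sides depend only on the distribution function at levels above `c`, where `|f|` and its
rearrangement agree. -/
theorem lintegral_rearrFun_sub {f : ℝ → ℝ} (hf : AEMeasurable f leb) {c : ℝ} (hc : 0 ≤ c) :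
    ∫⁻ s, ENNReal.ofReal (rearrFun f s - c) ∂leb = ∫⁻ s, ENNReal.ofReal (|f s| - c) ∂leb := by
  have key : ∀ g : ℝ → ℝ, AEMeasurable g leb → ∫⁻ s, ENNReal.ofReal (g s - c) ∂leb =
      ∫⁻ t in Ioi (0 : ℝ), leb {u | t + c < g u} := by
    intro g hg
    have h1 : ∀ s, ENNReal.ofReal (g s - c) = ENNReal.ofReal (max (g s - c) 0) := fun s => by
      rcases le_total (g s - c) 0 with h | h
      · rw [max_eq_right h, ENNReal.ofReal_of_nonpos h, ENNReal.ofReal_zero]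
      · rw [max_eq_left h]
    simp only [h1]
    rw [lintegral_eq_lintegral_meas_lt (f := fun s => max (g s - c) 0) _
      (Eventually.of_forall fun s => le_max_right _ _)
      ((hg.sub_const c).max aemeasurable_const)]
    refine setLIntegral_congr_fun measurableSet_Ioi fun t ht => ?_
    have h0 : ¬ t < 0 := not_lt.2 (le_of_lt ht)
    simp only [lt_max_iff, h0, or_false, lt_sub_iff_add_lt]
  rw [key _ (rearrFun_aemeasurable hf), key (fun s => |f s|) hf.abs]
  refine setLIntegral_congr_fun measurableSet_Ioi fun t ht => ?_
  exact leb_lt_rearrFun hf (add_nonneg (le_of_lt ht) hc)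

/-- Integrals of decreasing rearrangements over initial intervals are subadditive. -/
theorem lintegral_rearrFun_add_le {f g : ℝ → ℝ} (hf : AEMeasurable f leb)
    (hg : AEMeasurable g leb) {b : ℝ} (hb : b ∈ Ioo (0 : ℝ) 1) :
    ∫⁻ s in Ioo 0 b, ENNReal.ofReal (rearrFun (f + g) s) ≤
      (∫⁻ s in Ioo 0 b, ENNReal.ofReal (rearrFun f s)) +
        ∫⁻ s in Ioo 0 b, ENNReal.ofReal (rearrFun g s) := by
  -- The integral of the rearrangement over `(0,b)` is the minimum over `c ≥ 0` of `∫ (|φ| - c)₊ +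
  -- cb`. Here it is bounded by the expression for every `c`.
  have upper : ∀ {φ : ℝ → ℝ} {c : ℝ}, AEMeasurable φ leb → 0 ≤ c →
      ∫⁻ s in Ioo 0 b, ENNReal.ofReal (rearrFun φ s) ≤
        ∫⁻ s, ENNReal.ofReal (|φ s| - c) ∂leb + ENNReal.ofReal c * ENNReal.ofReal b := by
    intro φ c hφ hc
    rw [← lintegral_rearrFun_sub hφ hc, ← setLIntegral_leb hb.2.le]
    calc ∫⁻ s in Ioo 0 b, ENNReal.ofReal (rearrFun φ s) ∂leb
        ≤ ∫⁻ s in Ioo 0 b, (ENNReal.ofReal (rearrFun φ s - c) + ENNReal.ofReal c) ∂leb := by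
          refine lintegral_mono fun s => ?_
          refine le_trans (ENNReal.ofReal_le_ofReal ?_) ENNReal.ofReal_add_le
          linarith
      _ = ∫⁻ s in Ioo 0 b, ENNReal.ofReal (rearrFun φ s - c) ∂leb +
            ∫⁻ s in Ioo 0 b, ENNReal.ofReal c ∂leb := lintegral_add_right _ measurable_const
      _ ≤ _ := by
          refine add_le_add (setLIntegral_le_lintegral _ _) ?_
          rw [setLIntegral_leb hb.2.le, setLIntegral_const, Real.volume_Ioo, sub_zero]
  -- The minimum is attained at `c = rearrFun φ b`.
  have lower : ∀ {φ : ℝ → ℝ}, AEMeasurable φ leb →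
      ∫⁻ s, ENNReal.ofReal (|φ s| - rearrFun φ b) ∂leb +
          ENNReal.ofReal (rearrFun φ b) * ENNReal.ofReal b ≤
        ∫⁻ s in Ioo 0 b, ENNReal.ofReal (rearrFun φ s) := by
    intro φ hφ
    have hc := rearrFun_nonneg φ b
    have h1 : ∫⁻ s, ENNReal.ofReal (rearrFun φ s - rearrFun φ b) ∂leb ≤
        ∫⁻ s in Ioo 0 b, ENNReal.ofReal (rearrFun φ s - rearrFun φ b) := by
      rw [← setLIntegral_leb hb.2.le, ← lintegral_indicator (μ := leb) (s := Ioo 0 b)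
        measurableSet_Ioo]
      refine setLIntegral_mono' measurableSet_Ioo fun (s : ℝ) hs => ?_
      rcases lt_or_ge s b with hsb | hbs
      · rw [indicator_of_mem (show s ∈ Ioo 0 b from ⟨hs.1, hsb⟩)]
      · have := rearrFun_antitoneOn hφ hb.1 hs.1 hbs
        rw [ENNReal.ofReal_of_nonpos (by linarith)]
        exact bot_le
    rw [← lintegral_rearrFun_sub hφ hc]
    refine (add_le_add_left h1 _).trans ?_
    have h2 : ENNReal.ofReal (rearrFun φ b) * ENNReal.ofReal b =
        ∫⁻ s in Ioo 0 b, ENNReal.ofReal (rearrFun φ b) := by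
      rw [setLIntegral_const, Real.volume_Ioo, sub_zero]
    rw [h2, ← lintegral_add_right _ measurable_const]
    refine setLIntegral_mono' measurableSet_Ioo fun s hs => ?_
    have h3 := rearrFun_antitoneOn hφ hs.1 hb.1 hs.2.le
    rw [← ENNReal.ofReal_add (sub_nonneg.2 h3) hc, sub_add_cancel]
  have hc := rearrFun_nonneg f b
  have hd := rearrFun_nonneg g b
  calc ∫⁻ s in Ioo 0 b, ENNReal.ofReal (rearrFun (f + g) s)
      ≤ ∫⁻ s, ENNReal.ofReal (|(f + g) s| - (rearrFun f b + rearrFun g b)) ∂leb +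
          ENNReal.ofReal (rearrFun f b + rearrFun g b) * ENNReal.ofReal b :=
        upper (hf.add hg) (add_nonneg hc hd)
    _ ≤ (∫⁻ s, ENNReal.ofReal (|f s| - rearrFun f b) ∂leb +
          ∫⁻ s, ENNReal.ofReal (|g s| - rearrFun g b) ∂leb) +
          (ENNReal.ofReal (rearrFun f b) * ENNReal.ofReal b +
            ENNReal.ofReal (rearrFun g b) * ENNReal.ofReal b) := by
        rw [ENNReal.ofReal_add hc hd, add_mul,
          ← lintegral_add_left' (hf.abs.sub_const _).ennreal_ofReal]
        refine add_le_add (lintegral_mono fun s => ?_) le_rfl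
        refine le_trans (ENNReal.ofReal_le_ofReal ?_) ENNReal.ofReal_add_le
        have := abs_add_le (f s) (g s)
        simp only [Pi.add_apply]
        linarith
    _ = (∫⁻ s, ENNReal.ofReal (|f s| - rearrFun f b) ∂leb +
          ENNReal.ofReal (rearrFun f b) * ENNReal.ofReal b) +
          (∫⁻ s, ENNReal.ofReal (|g s| - rearrFun g b) ∂leb +
            ENNReal.ofReal (rearrFun g b) * ENNReal.ofReal b) := add_add_add_comm _ _ _ _
    _ ≤ _ := add_le_add (lower hf) (lower hg)

/-- The roles are exchanged: the rearrangements become densities of measures and the decreasing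
density `γ` of `ω` becomes the test function. Subadditivity over `(0,b)` is then exactly what the
comparison principle needs. -/
theorem IsQuasiconcave.lnorm_add_le_of_concave {ω : ℝ → ℝ} (h : IsQuasiconcave ω)
    (hc : ConcaveOn ℝ (Ico 0 1) ω) {f g : ℝ → ℝ} (hf : AEMeasurable f leb)
    (hg : AEMeasurable g leb) :
    lnorm h.toIsWeight.measure (f + g) ≤
      lnorm h.toIsWeight.measure f + lnorm h.toIsWeight.measure g := by
  obtain ⟨γ, hγ, hγ0, hγω⟩ := h.exists_density hc
  have hγm : AEMeasurable (fun t => ENNReal.ofReal (γ t)) leb :=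
    (aemeasurable_of_antitoneOn_Ioo hγ _).ennreal_ofReal
  have hm : ∀ {φ : ℝ → ℝ}, AEMeasurable φ leb →
      AEMeasurable (fun t => ENNReal.ofReal (rearrFun φ t)) leb := fun hφ =>
    (rearrFun_aemeasurable hφ).ennreal_ofReal
  have key : ∀ {φ : ℝ → ℝ}, AEMeasurable φ leb → lnorm h.toIsWeight.measure φ =
      ∫⁻ t, ENNReal.ofReal (rearrFun φ t) * ENNReal.ofReal (γ t) ∂leb := fun hφ => by
    rw [lnorm, h.lintegral_eq_of_density hγ hγω (rearrFun_antitoneOn_Ioo hφ)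
      fun t _ => rearrFun_nonneg _ _]
    simp only [mul_comm]
  rw [key (hf.add hg), key hf, key hg, ← lintegral_add_left' (f := fun t =>
    ENNReal.ofReal (rearrFun f t) * ENNReal.ofReal (γ t)) ((hm hf).mul hγm)]
  have := nullSingletonClass_withDensity leb (fun t => ENNReal.ofReal (rearrFun (f + g) t))
  have h1 := lintegral_antitone_le
    (ν₁ := leb.withDensity fun t => ENNReal.ofReal (rearrFun (f + g) t))
    (ν₂ := leb.withDensity fun t => ENNReal.ofReal (rearrFun f t) + ENNReal.ofReal (rearrFun g t))
    (fun b hb => by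
      rw [leb_withDensity_Ioo hb.2.le, leb_withDensity_Ioo hb.2.le, ← setLIntegral_leb hb.2.le
        (fun t => ENNReal.ofReal (rearrFun f t) + ENNReal.ofReal (rearrFun g t)),
        lintegral_add_left' (hm hf).restrict, setLIntegral_leb hb.2.le, setLIntegral_leb hb.2.le]
      exact lintegral_rearrFun_add_le hf hg hb) hγ hγ0
  rw [restrict_leb_withDensity, restrict_leb_withDensity,
    lintegral_withDensity_eq_lintegral_mul₀ (hm (hf.add hg)) hγm,
    lintegral_withDensity_eq_lintegral_mul₀ (f := fun t => ENNReal.ofReal (rearrFun f t) +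
      ENNReal.ofReal (rearrFun g t)) ((hm hf).add (hm hg)) hγm] at h1
  simpa only [Pi.mul_apply, add_mul] using h1

theorem IsQuasiconcave.isSymmetricBanach {ω : ℝ → ℝ} (h : IsQuasiconcave ω)
    (hc : ConcaveOn ℝ (Ico 0 1) ω) : IsSymmetricBanach (lorentz ω h.toIsWeight) := by
  have h1 := isQuasiNormed_lorentz h (K := 1) fun f g hf hg => by
    simpa using h.lnorm_add_le_of_concave hc hf hg
  exact ⟨by simpa using h1, isComplete_lorentz h, isSymmetric_lorentz h.toIsWeight⟩

theorem IsLorentzFunction.isQuasiconcave {φ : ℝ → ℝ} (h : IsLorentzFunction φ) :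
    IsQuasiconcave φ := by
  have h0 : φ 0 = 0 := by
    refine le_antisymm (ge_of_tendsto h.tendsto_zero ?_) (h.mapsTo ⟨le_rfl, one_pos⟩).1
    filter_upwards [Ioo_mem_nhdsGT one_pos] with t ht
    exact h.mono ⟨le_rfl, one_pos⟩ ⟨ht.1.le, ht.2⟩ ht.1.le
  have hmul : ∀ u v : ℝ, 0 < u → u ≤ v → v < 1 → u * φ v ≤ v * φ u := by
    intro u v hu huv hv
    have hv0 := hu.trans_le huv
    -- The point `u` is a convex combination of `0`, where `φ` vanishes, and `v`.
    have h1 := h.concave.2 (⟨le_rfl, one_pos⟩ : (0 : ℝ) ∈ Ico (0 : ℝ) 1)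
      (⟨hv0.le, hv⟩ : v ∈ Ico (0 : ℝ) 1) (sub_nonneg.2 ((div_le_one hv0).2 huv))
      (by positivity : 0 ≤ u / v) (by ring)
    simp only [smul_eq_mul, mul_zero, zero_add, h0, div_mul_cancel₀ u hv0.ne'] at h1
    rw [div_mul_eq_mul_div, div_le_iff₀ hv0] at h1
    linarith
  refine ⟨h.toIsWeight, h0, h.tendsto_zero, fun u hu => ?_, hmul⟩
  obtain ⟨t, ht, htne⟩ := h.ne_zero
  have htpos : 0 < φ t := lt_of_le_of_ne (h.mapsTo ht).1 htne.symm
  rcases le_total t u with htu | hut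
  · exact htpos.trans_le (h.mono ht ⟨hu.1.le, hu.2⟩ htu)
  · have := hmul u t hu.1 hut ht.2
    have h2 : 0 < u * φ t := mul_pos hu.1 htpos
    exact pos_of_mul_pos_right (h2.trans_le this) ht.1

/-! ### The function `ψ` -/

theorem psi_le {φ : ℝ → ℝ} (h : IsWeight φ) {u s : ℝ} (hu : 0 < u) (hus : u < s) (hs : s < 1) :
    psi φ u ≤ φ s / (1 + Real.log (s / u)) := by
  refine csInf_le ⟨0, ?_⟩ ⟨s / u, (one_lt_div hu).2 hus, ?_, ?_⟩
  · rintro _ ⟨w, hw, huw, rfl⟩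
    have h1 := (h.mapsTo ⟨mul_nonneg hu.le (by linarith), huw⟩).1
    have h2 := Real.log_pos hw
    positivity
  · rwa [mul_div_cancel₀ _ hu.ne']
  · rw [mul_div_cancel₀ _ hu.ne']

/-- The substitution `s = uw` makes the numerator independent of `u`, so that one `s` can be
compared at different points. -/
theorem psi_eq_sInf {φ : ℝ → ℝ} {u : ℝ} (hu : 0 < u) :
    psi φ u = sInf ((fun s => φ s / (1 + Real.log (s / u))) '' Ioo u 1) := by
  rw [psi]
  congr 1
  ext r
  constructor
  · rintro ⟨w, hw, huw, rfl⟩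
    refine ⟨u * w, ⟨by nlinarith, huw⟩, ?_⟩
    simp only [mul_div_cancel_left₀ w hu.ne']
  · rintro ⟨s, hs, rfl⟩
    refine ⟨s / u, (one_lt_div hu).2 hs.1, ?_, ?_⟩
    · rw [mul_div_cancel₀ _ hu.ne']; exact hs.2
    · rw [mul_div_cancel₀ _ hu.ne']

theorem le_psi {φ : ℝ → ℝ} {u B : ℝ} (hu : u ∈ Ioo (0 : ℝ) 1)
    (hB : ∀ s ∈ Ioo u 1, B ≤ φ s / (1 + Real.log (s / u))) : B ≤ psi φ u := by
  rw [psi_eq_sInf hu.1]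
  refine le_csInf ((nonempty_Ioo.2 hu.2).image _) ?_
  rintro _ ⟨s, hs, rfl⟩
  exact hB s hs

theorem exists_lt_of_psi_lt {φ : ℝ → ℝ} {u B : ℝ} (hu : u ∈ Ioo (0 : ℝ) 1) (hB : psi φ u < B) :
    ∃ s ∈ Ioo u 1, φ s / (1 + Real.log (s / u)) < B := by
  rw [psi_eq_sInf hu.1] at hB
  obtain ⟨_, ⟨s, hs, rfl⟩, h⟩ := exists_lt_of_csInf_lt ((nonempty_Ioo.2 hu.2).image _) hB
  exact ⟨s, hs, h⟩

/-- The value `w = 1` is excluded from the infimum, so the bound comes from letting `s` decrease to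
`u` and using continuity of `φ`. -/
theorem IsQuasiconcave.psi_le_self {φ : ℝ → ℝ} (h : IsQuasiconcave φ) {u : ℝ}
    (hu : u ∈ Ioo (0 : ℝ) 1) : psi φ u ≤ φ u := by
  have h1 : Tendsto φ (𝓝[>] u) (𝓝 (φ u)) := (h.continuousAt hu).mono_left nhdsWithin_le_nhds
  refine ge_of_tendsto h1 ?_
  filter_upwards [Ioo_mem_nhdsGT hu.2] with s hs
  refine (psi_le h.toIsWeight hu.1 hs.1 hs.2).trans (div_le_self ?_ ?_)
  · exact (h.pos s ⟨hu.1.trans hs.1, hs.2⟩).le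
  · linarith [Real.log_pos ((one_lt_div hu.1).2 hs.1)]

/-- The substantial point is that `ψ(u)/u` decreases. For a competitor `s ≤ v` at `u`, use `ψ(v) ≤
φ(v) ≤ (v/s) φ(s)` and `u(1 + log(s/u)) ≤ s`. For `s > v` the same `s` competes at `v`, and `u(1 +
log(s/u)) ≤ v(1 + log(s/v))`. Both rest on `log r ≤ r - 1`. -/
theorem IsQuasiconcave.psi {φ : ℝ → ℝ} (h : IsQuasiconcave φ) : IsQuasiconcave (psi φ) := by
  have hw := h.toIsWeight.psi
  have hlim : Tendsto (HaarRange.psi φ) (𝓝[>] 0) (𝓝 0) := by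
    refine squeeze_zero' ?_ ?_ h.tendsto_zero
    · filter_upwards [Ioo_mem_nhdsGT one_pos] with u hu
      exact (hw.mapsTo ⟨hu.1.le, hu.2⟩).1
    · filter_upwards [Ioo_mem_nhdsGT one_pos] with u hu
      exact h.psi_le_self hu
  refine ⟨hw, ?_, hlim, ?_, ?_⟩
  · refine le_antisymm (ge_of_tendsto hlim ?_) (hw.mapsTo ⟨le_rfl, one_pos⟩).1
    filter_upwards [Ioo_mem_nhdsGT one_pos] with t ht
    exact hw.mono ⟨le_rfl, one_pos⟩ ⟨ht.1.le, ht.2⟩ ht.1.le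
  · intro u hu
    have h1 : 0 < Real.log (1 / u) := Real.log_pos ((one_lt_div hu.1).2 hu.2)
    have h2 := h.pos u hu
    refine lt_of_lt_of_le (by positivity : 0 < φ u / (1 + Real.log (1 / u)))
      (le_psi hu fun s hs => ?_)
    have h3 : 0 < Real.log (s / u) := Real.log_pos ((one_lt_div hu.1).2 hs.1)
    have h4 : φ u ≤ φ s := h.mono ⟨hu.1.le, hu.2⟩ ⟨(hu.1.trans hs.1).le, hs.2⟩ hs.1.le
    have h5 : Real.log (s / u) ≤ Real.log (1 / u) :=
      Real.log_le_log (div_pos (hu.1.trans hs.1) hu.1)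
        (div_le_div_of_nonneg_right hs.2.le hu.1.le)
    exact div_le_div₀ (h2.le.trans h4) h4 (by linarith) (by linarith)
  · intro u v hu huv hv
    have hv0 := hu.trans_le huv
    have hψv := h.psi_le_self ⟨hv0, hv⟩
    rw [← div_le_iff₀' hv0]
    refine le_psi ⟨hu, huv.trans_lt hv⟩ fun s hs => ?_
    have hs0 := hu.trans hs.1
    have hL : 0 < Real.log (s / u) := Real.log_pos ((one_lt_div hu).2 hs.1)
    have hφs := h.pos s ⟨hs0, hs.2⟩
    rw [div_le_div_iff₀ hv0 (by linarith)]
    rcases le_or_gt s v with hsv | hvs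
    · have h1 := h.mul_le_mul s v hs0 hsv hv
      have h2 : u * (1 + Real.log (s / u)) ≤ s := by
        have := Real.log_le_sub_one_of_pos (div_pos hs0 hu)
        calc u * (1 + Real.log (s / u)) ≤ u * (s / u) := by gcongr; linarith
          _ = s := mul_div_cancel₀ _ hu.ne'
      calc u * HaarRange.psi φ v * (1 + Real.log (s / u))
          = u * (1 + Real.log (s / u)) * HaarRange.psi φ v := by ring
        _ ≤ s * φ v := _root_.mul_le_mul h2 hψv (hw.mapsTo ⟨hv0.le, hv⟩).1 hs0.le
        _ ≤ φ s * v := by linarith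
    · have h1 := psi_le h.toIsWeight hv0 hvs hs.2
      have hL' : 0 < Real.log (s / v) := Real.log_pos ((one_lt_div hv0).2 hvs)
      rw [le_div_iff₀ (by linarith)] at h1
      have h2 : Real.log (s / u) = Real.log (s / v) + Real.log (v / u) := by
        rw [← Real.log_mul (by positivity) (by positivity)]
        congr 1
        field_simp
      have h3 : u * Real.log (v / u) ≤ v - u := by
        have := Real.log_le_sub_one_of_pos (div_pos hv0 hu)
        calc u * Real.log (v / u) ≤ u * (v / u - 1) := by gcongr
          _ = v - u := by rw [mul_sub, mul_div_cancel₀ _ hu.ne', mul_one]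
      have h4 : u * (1 + Real.log (s / u)) ≤ v * (1 + Real.log (s / v)) := by
        rw [h2]
        nlinarith
      calc u * HaarRange.psi φ v * (1 + Real.log (s / u))
          = HaarRange.psi φ v * (u * (1 + Real.log (s / u))) := by ring
        _ ≤ HaarRange.psi φ v * (v * (1 + Real.log (s / v))) :=
            mul_le_mul_of_nonneg_left h4 (hw.mapsTo ⟨hv0.le, hv⟩).1
        _ = v * (HaarRange.psi φ v * (1 + Real.log (s / v))) := by ring
        _ ≤ φ s * v := by nlinarith

/-! ### Concave weights equivalent to quasi-concave ones -/

/-- A concave function equivalent to a given quasi-concave one. -/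
def concaveHull (ω : ℝ → ℝ) (u : ℝ) : ℝ := sInf ((fun s => (1 + u / s) * ω s / 2) '' Ioo 0 1)

theorem concaveHull_le_of {ω : ℝ → ℝ} (h : IsQuasiconcave ω) {u s : ℝ} (hu : 0 ≤ u)
    (hs : s ∈ Ioo (0 : ℝ) 1) :
    concaveHull ω u ≤ (1 + u / s) * ω s / 2 := by
  refine csInf_le ⟨0, ?_⟩ ⟨s, hs, rfl⟩
  rintro _ ⟨s, hs, rfl⟩
  have := h.pos s hs
  have := hs.1
  positivity

theorem le_concaveHull {ω : ℝ → ℝ} {u B : ℝ} (hB : ∀ s ∈ Ioo (0 : ℝ) 1, B ≤ (1 + u / s) * ω s / 2) :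
    B ≤ concaveHull ω u := by
  refine le_csInf ((nonempty_Ioo.2 one_pos).image _) ?_
  rintro _ ⟨s, hs, rfl⟩
  exact hB s hs

/-- The choice `s = u` gives `ω(u)` itself. The factor `1/2` serves this purpose and keeps the
values below `1`. -/
theorem concaveHull_le {ω : ℝ → ℝ} (h : IsQuasiconcave ω) {u : ℝ} (hu : u ∈ Ioo (0 : ℝ) 1) :
    concaveHull ω u ≤ ω u := by
  refine (concaveHull_le_of h hu.1.le hu).trans (le_of_eq ?_)
  rw [div_self hu.1.ne']
  ring

/-- For `u ≤ s` the bound is monotonicity of `ω`; for `s ≤ u` it is the decrease of `ω(u)/u`. -/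
theorem le_two_mul_concaveHull {ω : ℝ → ℝ} (h : IsQuasiconcave ω) {u : ℝ} (hu : u ∈ Ioo (0 : ℝ) 1) :
    ω u ≤ 2 * concaveHull ω u := by
  have : ω u / 2 ≤ concaveHull ω u := by
    refine le_concaveHull fun s hs => ?_
    have h0 := h.pos s hs
    have hu0 := hu.1
    have hs0 := hs.1
    have h1 : ω u ≤ (1 + u / s) * ω s := by
      rcases le_total u s with hus | hsu
      · have := h.mono ⟨hu.1.le, hu.2⟩ ⟨hs.1.le, hs.2⟩ hus
        have h2 : 0 ≤ u / s * ω s := by positivity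
        linarith
      · have h2 := h.mul_le_mul s u hs.1 hsu hu.2
        have h3 : ω u ≤ u / s * ω s := by
          rw [div_mul_eq_mul_div, le_div_iff₀ hs.1]
          linarith
        linarith
    linarith
  linarith

theorem concaveOn_concaveHull {ω : ℝ → ℝ} (h : IsQuasiconcave ω) :
    ConcaveOn ℝ (Ico 0 1) (concaveHull ω) := by
  refine ⟨convex_Ico 0 1, fun u hu v hv a b ha hb hab => le_concaveHull fun s hs => ?_⟩
  have h1 := mul_le_mul_of_nonneg_left (concaveHull_le_of h hu.1 hs) ha
  have h2 := mul_le_mul_of_nonneg_left (concaveHull_le_of h hv.1 hs) hb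
  simp only [smul_eq_mul]
  refine (add_le_add h1 h2).trans (le_of_eq ?_)
  rw [show b = 1 - a by linarith]
  ring

theorem isLorentzFunction_concaveHull {ω : ℝ → ℝ} (h : IsQuasiconcave ω) :
    IsLorentzFunction (concaveHull ω) := by
  have hnn : ∀ u : ℝ, 0 ≤ u → 0 ≤ concaveHull ω u := fun u hu => le_concaveHull fun s hs => by
    have := h.pos s hs
    have := hs.1
    positivity
  have hmono : MonotoneOn (concaveHull ω) (Ico 0 1) := by
    intro u hu v hv huv
    refine le_concaveHull fun s hs => (concaveHull_le_of h hu.1 hs).trans ?_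
    have := h.pos s hs
    have := hs.1
    gcongr
  refine ⟨⟨fun u hu => ⟨hnn u hu.1, ?_⟩, hmono⟩, concaveOn_concaveHull h, ?_, 1 / 2, by norm_num,
    ?_⟩
  -- The case `u = 0` is not covered by `concaveHull_le`, hence the passage to a larger point of
  -- `(0,1)`.
  · have hu' : (u + 1) / 2 ∈ Ioo (0 : ℝ) 1 := ⟨by linarith [hu.1], by linarith [hu.2]⟩
    refine (hmono hu ⟨hu'.1.le, hu'.2⟩ (by linarith [hu.2])).trans_lt ?_
    exact (concaveHull_le h hu').trans_lt (h.mapsTo ⟨hu'.1.le, hu'.2⟩).2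
  · refine squeeze_zero' ?_ ?_ h.tendsto_zero
    · filter_upwards [Ioo_mem_nhdsGT one_pos] with u hu
      exact hnn u hu.1.le
    · filter_upwards [Ioo_mem_nhdsGT one_pos] with u hu
      exact concaveHull_le h hu
  · have h1 : (1 / 2 : ℝ) ∈ Ioo (0 : ℝ) 1 := by norm_num
    have h2 := le_two_mul_concaveHull h h1
    have h3 := h.pos _ h1
    intro h4
    rw [h4] at h2
    linarith

/-! ### Embeddings of Lorentz spaces -/

theorem lnorm_le_of_le {ω₁ ω₂ : ℝ → ℝ} (h₁ : IsQuasiconcave ω₁) (h₂ : IsQuasiconcave ω₂) {C : ℝ}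
    (hC : 0 ≤ C) (hle : ∀ u ∈ Ioo (0 : ℝ) 1, ω₁ u ≤ C * ω₂ u) {f : ℝ → ℝ}
    (hf : AEMeasurable f leb) :
    lnorm h₁.toIsWeight.measure f ≤ ENNReal.ofReal C * lnorm h₂.toIsWeight.measure f := by
  have := h₁.noAtoms
  have h := lintegral_antitone_le (ν₁ := h₁.toIsWeight.measure)
    (ν₂ := ENNReal.ofReal C • h₂.toIsWeight.measure) (fun b hb => by
      rw [Measure.smul_apply, h₁.measure_Ioo hb, h₂.measure_Ioo hb, smul_eq_mul,
        ← ENNReal.ofReal_mul hC]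
      exact ENNReal.ofReal_le_ofReal (hle b hb)) (rearrFun_antitoneOn_Ioo hf)
    fun t _ => rearrFun_nonneg _ _
  rwa [Measure.restrict_smul, lintegral_smul_measure, h₁.toIsWeight.measure_restrict,
    h₂.toIsWeight.measure_restrict, smul_eq_mul] at h

theorem embeds_lorentz {E : FunctionSpace} {ω : ℝ → ℝ} {h : IsWeight ω} {C : ENNReal}
    (hC : C ≠ ⊤) {N : S01 → ENNReal} (hE : ∀ x ∈ E.carrier, N x < ⊤ ∧ E.qnorm x = (N x).toReal)
    (hle : ∀ x ∈ E.carrier, lnorm h.measure x ≤ C * N x) : Embeds E (lorentz ω h) := by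
  refine ⟨fun x hx => (hle x hx).trans_lt (ENNReal.mul_lt_top hC.lt_top (hE x hx).1), C.toReal,
    fun x hx => ?_⟩
  rw [(hE x hx).2, qnorm_lorentz, ← ENNReal.toReal_mul]
  exact ENNReal.toReal_mono (ENNReal.mul_ne_top hC (hE x hx).1.ne) (hle x hx)

theorem embeds_lorentz_lorentz {ω₁ ω₂ : ℝ → ℝ} (h₁ : IsQuasiconcave ω₁) (h₂ : IsQuasiconcave ω₂)
    {C : ℝ} (hC : 0 ≤ C) (hle : ∀ u ∈ Ioo (0 : ℝ) 1, ω₁ u ≤ C * ω₂ u) :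
    Embeds (lorentz ω₂ h₂.toIsWeight) (lorentz ω₁ h₁.toIsWeight) :=
  embeds_lorentz ENNReal.ofReal_ne_top (fun _ hx => ⟨hx, rfl⟩)
    fun x _ => lnorm_le_of_le h₁ h₂ hC hle x.aestronglyMeasurable.aemeasurable

theorem Embeds.trans {E F G : FunctionSpace} (h₁ : Embeds E F) (h₂ : Embeds F G)
    (hE : ∀ x ∈ F.carrier, 0 ≤ F.qnorm x) : Embeds E G := by
  obtain ⟨h₁, C₁, hC₁⟩ := h₁
  obtain ⟨h₂, C₂, hC₂⟩ := h₂
  refine ⟨h₁.trans h₂, max C₂ 0 * C₁, fun x hx => (hC₂ x (h₁ hx)).trans ?_⟩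
  rw [mul_assoc]
  exact (mul_le_mul_of_nonneg_right (le_max_left _ _) (hE x (h₁ hx))).trans
    (mul_le_mul_of_nonneg_left (hC₁ x hx) (le_max_right _ _))

theorem sameSpace_concaveHull {ω : ℝ → ℝ} (h : IsQuasiconcave ω) :
    SameSpace (lorentz (concaveHull ω)
      (isLorentzFunction_concaveHull h).isQuasiconcave.toIsWeight) (lorentz ω h.toIsWeight) :=
  ⟨embeds_lorentz_lorentz h (isLorentzFunction_concaveHull h).isQuasiconcave zero_le_two
      fun _ hu => le_two_mul_concaveHull h hu,
    embeds_lorentz_lorentz (isLorentzFunction_concaveHull h).isQuasiconcave h zero_le_one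
      fun u hu => by simpa using concaveHull_le h hu⟩

/-! ### The Calderón operator -/

/-- The Calderón operator with values in `[0,∞]`. -/
def cal (z : ℝ → ℝ) (t : ℝ) : ENNReal :=
  ∫⁻ s, ENNReal.ofReal (z s) * ENNReal.ofReal (1 / max s t) ∂leb

/-- The two integrals merge into one with kernel `1/max(s,t)`. Integrability of `z` ensures that the
Bochner integrals do not take their default value `0`. -/
theorem ofReal_calderon {z : ℝ → ℝ} (hz : AEMeasurable z leb)
    (hz0 : ∀ s ∈ Ioo (0 : ℝ) 1, 0 ≤ z s) (hint : ∫⁻ s, ENNReal.ofReal (z s) ∂leb < ⊤) {t : ℝ}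
    (ht : t ∈ Ioo (0 : ℝ) 1) : ENNReal.ofReal (calderon z t) = cal z t := by
  have hzi : IntegrableOn z (Ioo 0 1) := by
    refine ⟨hz.aestronglyMeasurable, ?_⟩
    rw [hasFiniteIntegral_iff_ofReal
      ((ae_restrict_iff' measurableSet_Ioo).2 (Eventually.of_forall hz0))]
    exact hint
  have hmi : IntegrableOn (fun s => z s * (1 / max s t)) (Ioo 0 1) := by
    refine Integrable.mul_bdd (c := 1 / t) hzi (Measurable.aestronglyMeasurable (by fun_prop))
      ((ae_restrict_iff' measurableSet_Ioo).2 (Eventually.of_forall fun s hs => ?_))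
    rw [Real.norm_eq_abs, abs_of_nonneg (by have := ht.1; positivity)]
    exact one_div_le_one_div_of_le ht.1 (le_max_right _ _)
  have hsplit : Ioo (0 : ℝ) 1 = Ioo 0 t ∪ Ico t 1 := (Ioo_union_Ico_eq_Ioo ht.1 ht.2.le).symm
  have h1 : calderon z t = ∫ s in Ioo 0 1, z s * (1 / max s t) := by
    rw [hsplit] at hmi ⊢
    rw [setIntegral_union (disjoint_left.2 fun s hs hs' => not_lt.2 hs'.1 hs.2) measurableSet_Ico
      (hmi.mono_set subset_union_left) (hmi.mono_set subset_union_right), calderon,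
      integral_Ico_eq_integral_Ioo]
    congr 1
    · rw [← integral_const_mul]
      refine setIntegral_congr_fun measurableSet_Ioo fun s hs => ?_
      simp only [max_eq_right hs.2.le, mul_comm]
    · refine setIntegral_congr_fun measurableSet_Ioo fun s hs => ?_
      simp only [max_eq_left hs.1.le, mul_one_div]
  have hpos : ∀ s, 0 ≤ 1 / max s t := fun s => by have := ht.1; positivity
  rw [h1, ofReal_integral_eq_lintegral_ofReal hmi ((ae_restrict_iff' measurableSet_Ioo).2
    (Eventually.of_forall fun s hs => mul_nonneg (hz0 s hs) (hpos s))), cal]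
  refine lintegral_congr fun s => ?_
  rw [ENNReal.ofReal_mul' (hpos s)]

theorem lintegral_Ioi_one_div_sq {a : ℝ} (ha : 0 < a) :
    ∫⁻ r in Ioi a, ENNReal.ofReal (1 / r ^ 2) = ENNReal.ofReal (1 / a) := by
  have h1 : ∀ r ∈ Ioi a, (1 : ℝ) / r ^ 2 = r ^ (-2 : ℝ) := fun r hr => by
    have : (0 : ℝ) < r := ha.trans hr
    rw [Real.rpow_neg this.le, one_div]
    norm_cast
  rw [setLIntegral_congr_fun measurableSet_Ioi fun r hr => by rw [h1 r hr],
    ← ofReal_integral_eq_lintegral_ofReal (integrableOn_Ioi_rpow_of_lt (by norm_num) ha)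
      ((ae_restrict_iff' measurableSet_Ioi).2 (Eventually.of_forall fun r hr =>
        Real.rpow_nonneg (ha.le.trans (le_of_lt hr)) _)),
    integral_Ioi_rpow_of_lt (by norm_num) ha]
  congr 1
  norm_num
  rw [Real.rpow_neg_one]

/-- The kernel of the Calderón operator integrated against a measure. -/
def calKernel (ν : Measure ℝ) (s : ℝ) : ENNReal := ∫⁻ t, ENNReal.ofReal (1 / max s t) ∂ν

theorem measurable_calKernel (ν : Measure ℝ) [SFinite ν] : Measurable (calKernel ν) :=
  Measurable.lintegral_prod_right' (f := fun p : ℝ × ℝ => ENNReal.ofReal (1 / max p.1 p.2))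
    (by fun_prop)

/-- The kernel is symmetric, so Tonelli moves the operator from the function onto the measure. -/
theorem lintegral_cal {ν : Measure ℝ} [SFinite ν] {z : ℝ → ℝ} (hz : AEMeasurable z leb) :
    ∫⁻ t, cal z t ∂ν = ∫⁻ s, ENNReal.ofReal (z s) * calKernel ν s ∂leb := by
  simp only [cal]
  rw [lintegral_lintegral_swap]
  · refine lintegral_congr fun s => ?_
    rw [calKernel, lintegral_const_mul' _ _ ENNReal.ofReal_ne_top]
  · exact AEMeasurable.mul hz.ennreal_ofReal.comp_snd (Measurable.aemeasurable
      (by fun_prop : Measurable fun p : ℝ × ℝ => ENNReal.ofReal (1 / max p.2 p.1)))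

/-- Writing `1/max(s,t)` as the integral of `1/r²` over `r > max(s,t)` and exchanging integrals
brings out the distribution function of `ν`. -/
theorem calKernel_eq {ν : Measure ℝ} [SFinite ν] {s : ℝ} (hs : 0 < s) :
    calKernel ν s = ∫⁻ r in Ioi s, ENNReal.ofReal (1 / r ^ 2) * ν (Iio r) := by
  have h1 : ∀ t, ENNReal.ofReal (1 / max s t) =
      ∫⁻ r in Ioi s, {p : ℝ × ℝ | p.1 < p.2}.indicator
        (fun p => ENNReal.ofReal (1 / p.2 ^ 2)) (t, r) := fun t => by
    rw [← lintegral_Ioi_one_div_sq (lt_max_of_lt_left hs)]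
    have : Ioi (max s t) = Ioi t ∩ Ioi s := by rw [Ioi_inter_Ioi, max_comm]
    rw [this, ← Measure.restrict_restrict measurableSet_Ioi, ← lintegral_indicator
      measurableSet_Ioi]
    rfl
  simp only [calKernel, h1]
  have hm : MeasurableSet {p : ℝ × ℝ | p.1 < p.2} := measurableSet_lt measurable_fst measurable_snd
  rw [lintegral_lintegral_swap (f := fun t r => {p : ℝ × ℝ | p.1 < p.2}.indicator
    (fun p => ENNReal.ofReal (1 / p.2 ^ 2)) (t, r))
    (((by fun_prop : Measurable fun p : ℝ × ℝ => ENNReal.ofReal (1 / p.2 ^ 2)).indicator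
      hm).aemeasurable)]
  refine lintegral_congr fun r => ?_
  have : ∀ t, {p : ℝ × ℝ | p.1 < p.2}.indicator (fun p => ENNReal.ofReal (1 / p.2 ^ 2)) (t, r) =
      (Iio r).indicator (fun _ => ENNReal.ofReal (1 / r ^ 2)) t := fun t => rfl
  simp only [this]
  rw [lintegral_indicator_const measurableSet_Iio]

theorem setLIntegral_lintegral_Ioi {G : ℝ → ENNReal} (hG : Measurable G) {b : ℝ} :
    ∫⁻ s in Ioo 0 b, ∫⁻ r in Ioi s, G r = ∫⁻ r, G r * volume (Ioo 0 b ∩ Iio r) := by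
  have h1 : ∀ s, ∫⁻ r in Ioi s, G r =
      ∫⁻ r, {p : ℝ × ℝ | p.1 < p.2}.indicator (fun p => G p.2) (s, r) := fun s => by
    rw [← lintegral_indicator measurableSet_Ioi]
    rfl
  have hm : MeasurableSet {p : ℝ × ℝ | p.1 < p.2} := measurableSet_lt measurable_fst measurable_snd
  simp only [h1]
  rw [lintegral_lintegral_swap (f := fun s r => {p : ℝ × ℝ | p.1 < p.2}.indicator
    (fun p => G p.2) (s, r)) ((hG.comp measurable_snd).indicator hm).aemeasurable]
  refine lintegral_congr fun r => ?_
  have : ∀ s, {p : ℝ × ℝ | p.1 < p.2}.indicator (fun p => G p.2) (s, r) =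
      (Iio r).indicator (fun _ => G r) s := fun t => rfl
  simp only [this]
  rw [lintegral_indicator_const measurableSet_Iio, Measure.restrict_apply measurableSet_Iio,
    inter_comm]

theorem IsWeight.measure_Iio {ω : ℝ → ℝ} (h : IsWeight ω) (r : ℝ) :
    h.measure (Iio r) = h.measure (Ioo 0 r) := by
  rw [← h.measure_restrict, Measure.restrict_apply measurableSet_Iio,
    Measure.restrict_apply measurableSet_Ioo]
  congr 1
  ext t
  simp only [mem_inter_iff, mem_Iio, mem_Ioo]
  constructor <;> rintro ⟨h1, h2⟩
  · exact ⟨⟨h2.1, h1⟩, h2⟩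
  · exact ⟨h1.2, h2⟩

theorem IsQuasiconcave.measure_univ_le {ω : ℝ → ℝ} (h : IsQuasiconcave ω) :
    h.toIsWeight.measure univ ≤ 1 := by
  rw [← h.toIsWeight.measure_restrict, Measure.restrict_apply_univ]
  exact h.measure_Ioo_one_le

/-- The integral of the Calderón transform of `χ_(0,b)`. -/
theorem IsQuasiconcave.setLIntegral_calKernel_le {ω : ℝ → ℝ} (h : IsQuasiconcave ω) {b : ℝ}
    (hb : b ∈ Ioo (0 : ℝ) 1) :
    ∫⁻ s in Ioo 0 b, calKernel h.toIsWeight.measure s ≤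
      (∫⁻ t in Ioo 0 b, ENNReal.ofReal (ω t / t)) +
        ENNReal.ofReal b * (∫⁻ t in Ioo b 1, ENNReal.ofReal (ω t / t ^ 2)) +
        ENNReal.ofReal b := by
  have := h.isFiniteMeasure
  set ν := h.toIsWeight.measure with hν
  have hmono : Measurable fun r => ν (Iio r) :=
    Monotone.measurable fun r s hrs => measure_mono (Iio_subset_Iio hrs)
  have hG : Measurable fun r : ℝ => ENNReal.ofReal (1 / r ^ 2) * ν (Iio r) :=
    Measurable.mul (by fun_prop) hmono
  rw [setLIntegral_congr_fun measurableSet_Ioo fun s hs => calKernel_eq hs.1,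
    setLIntegral_lintegral_Ioi hG]
  set H : ℝ → ENNReal := fun r =>
    ENNReal.ofReal (1 / r ^ 2) * ν (Iio r) * volume (Ioo 0 b ∩ Iio r) with hH
  have hsupp : ∀ r, r ≤ 0 → H r = 0 := fun r hr => by
    have : Ioo 0 b ∩ Iio r = ∅ := by
      ext t
      simp only [mem_inter_iff, mem_Ioo, mem_Iio, mem_empty_iff_false, iff_false, not_and, not_lt]
      exact fun h1 => hr.trans h1.1.le
    simp only [hH, this, measure_empty, mul_zero]
  -- The line is split at `0`, `b` and `1`. The piece below `b` gives `ω(r)/r`, the piece up to `1`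
  -- gives `b ω(r)/r²`, and beyond `1` the total mass at most `1` leaves `b`.
  have hcover : (univ : Set ℝ) ⊆ Iic 0 ∪ (Ioc 0 b ∪ Ioc b 1 ∪ Ioi 1) := by
    intro t _
    rcases le_or_gt t 0 with h0 | h0
    · exact Or.inl h0
    rcases le_or_gt t b with h1 | h1
    · exact Or.inr (Or.inl (Or.inl ⟨h0, h1⟩))
    rcases le_or_gt t 1 with h2 | h2
    · exact Or.inr (Or.inl (Or.inr ⟨h1, h2⟩))
    · exact Or.inr (Or.inr h2)
  have hb0 : ∫⁻ r in Iic 0, H r = 0 := by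
    rw [setLIntegral_congr_fun measurableSet_Iic fun r hr => hsupp r hr, lintegral_zero]
  have h1 : ∫⁻ r in Ioc 0 b, H r ≤ ∫⁻ t in Ioo 0 b, ENNReal.ofReal (ω t / t) := by
    rw [setLIntegral_congr Ioo_ae_eq_Ioc.symm]
    refine setLIntegral_mono' measurableSet_Ioo fun r hr => ?_
    have hr1 : r ∈ Ioo (0 : ℝ) 1 := ⟨hr.1, hr.2.trans hb.2⟩
    have hω := h.pos r hr1
    have : Ioo 0 b ∩ Iio r = Ioo 0 r := by rw [Ioo_inter_Iio, min_eq_right hr.2.le]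
    simp only [hH]
    rw [hν, h.toIsWeight.measure_Iio, h.measure_Ioo hr1, this, Real.volume_Ioo, sub_zero,
      ← ENNReal.ofReal_mul (by positivity), ← ENNReal.ofReal_mul (by positivity)]
    refine ENNReal.ofReal_le_ofReal (le_of_eq ?_)
    have := hr.1.ne'
    field_simp
  have h2 : ∫⁻ r in Ioc b 1, H r ≤
      ENNReal.ofReal b * ∫⁻ t in Ioo b 1, ENNReal.ofReal (ω t / t ^ 2) := by
    rw [setLIntegral_congr Ioo_ae_eq_Ioc.symm, ← lintegral_const_mul' _ _ ENNReal.ofReal_ne_top]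
    refine setLIntegral_mono' measurableSet_Ioo fun r hr => ?_
    have hr1 : r ∈ Ioo (0 : ℝ) 1 := ⟨hb.1.trans hr.1, hr.2⟩
    have hω := h.pos r hr1
    have hr0 := hr1.1
    have hb0 := hb.1
    have : Ioo 0 b ∩ Iio r = Ioo 0 b := by rw [Ioo_inter_Iio, min_eq_left hr.1.le]
    simp only [hH]
    rw [hν, h.toIsWeight.measure_Iio, h.measure_Ioo hr1, this, Real.volume_Ioo, sub_zero,
      ← ENNReal.ofReal_mul (by positivity), ← ENNReal.ofReal_mul (by positivity),
      ← ENNReal.ofReal_mul (by positivity)]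
    refine ENNReal.ofReal_le_ofReal (le_of_eq ?_)
    field_simp
  have h3 : ∫⁻ r in Ioi 1, H r ≤ ENNReal.ofReal b := by
    calc ∫⁻ r in Ioi 1, H r ≤ ∫⁻ r in Ioi 1, ENNReal.ofReal (1 / r ^ 2) * ENNReal.ofReal b := by
          refine lintegral_mono fun r => ?_
          refine mul_le_mul' ?_ ?_
          · calc ENNReal.ofReal (1 / r ^ 2) * ν (Iio r) ≤ ENNReal.ofReal (1 / r ^ 2) * 1 :=
                  mul_le_mul_right ((measure_mono (subset_univ _)).trans h.measure_univ_le) _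
              _ = _ := mul_one _
          · refine (measure_mono inter_subset_left).trans ?_
            rw [Real.volume_Ioo, sub_zero]
      _ = ENNReal.ofReal b := by
          rw [lintegral_mul_const' _ _ ENNReal.ofReal_ne_top, lintegral_Ioi_one_div_sq one_pos]
          simp
  calc ∫⁻ r, H r = ∫⁻ r in univ, H r := by rw [setLIntegral_univ]
    _ ≤ ∫⁻ r in Iic 0 ∪ (Ioc 0 b ∪ Ioc b 1 ∪ Ioi 1), H r := lintegral_mono_set hcover
    _ ≤ (∫⁻ r in Iic 0, H r) + ∫⁻ r in (Ioc 0 b ∪ Ioc b 1 ∪ Ioi 1), H r := lintegral_union_le _ _ _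
    _ ≤ _ := by
        rw [hb0, zero_add]
        refine (lintegral_union_le _ _ _).trans (add_le_add ?_ h3)
        exact (lintegral_union_le _ _ _).trans (add_le_add h1 h2)

/-- A quasi-concave weight dominates a linear one. This absorbs the remainder `b` and puts the
Lorentz spaces inside `L₁` and weak `L₁`. -/
theorem IsQuasiconcave.mul_half_le {ω : ℝ → ℝ} (h : IsQuasiconcave ω) {b : ℝ}
    (hb : b ∈ Ioo (0 : ℝ) 1) : b * ω (1 / 2) ≤ ω b := by
  have h2 : (1 / 2 : ℝ) ∈ Ioo (0 : ℝ) 1 := by norm_num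
  have hφ2 := h.pos _ h2
  have hφb := h.pos b hb
  rcases le_total b (1 / 2) with hle | hle
  · have := h.mul_le_mul b (1 / 2) hb.1 hle h2.2
    linarith
  · have := h.mono ⟨h2.1.le, h2.2⟩ ⟨hb.1.le, hb.2⟩ hle
    nlinarith [hb.2]

/-- Boundedness of the Calderón operator on decreasing functions. -/
theorem exists_lintegral_cal_le {φ ω : ℝ → ℝ} (hφ : IsQuasiconcave φ) (hω : IsQuasiconcave ω)
    {c : ℝ} (hc : ∀ u ∈ Ioo (0 : ℝ) 1, (∫⁻ t in Ioo 0 u, ENNReal.ofReal (ω t / t)) +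
      ENNReal.ofReal u * (∫⁻ t in Ioo u 1, ENNReal.ofReal (ω t / t ^ 2)) ≤
        ENNReal.ofReal (c * φ u)) :
    ∃ C : ENNReal, C ≠ ⊤ ∧ ∀ z : ℝ → ℝ, AntitoneOn z (Ioo 0 1) →
      (∀ t ∈ Ioo (0 : ℝ) 1, 0 ≤ z t) →
      ∫⁻ t, cal z t ∂hω.toIsWeight.measure ≤
        C * ∫⁻ t, ENNReal.ofReal (z t) ∂hφ.toIsWeight.measure := by
  have := hω.isFiniteMeasure
  have h2 : (1 / 2 : ℝ) ∈ Ioo (0 : ℝ) 1 := by norm_num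
  have hφ2 := hφ.pos _ h2
  -- The first term comes from the assumed estimate, the second from the remainder `b`.
  set C : ℝ := max c 0 + 1 / φ (1 / 2) with hC
  have hlin : ∀ b ∈ Ioo (0 : ℝ) 1, b ≤ 1 / φ (1 / 2) * φ b := fun b hb => by
    rw [one_div, inv_mul_eq_div, le_div_iff₀ hφ2]
    exact hφ.mul_half_le hb
  refine ⟨ENNReal.ofReal C, ENNReal.ofReal_ne_top, fun z hz hz0 => ?_⟩
  have hzm : AEMeasurable z leb := aemeasurable_of_antitoneOn_Ioo hz _
  have hk := measurable_calKernel hω.toIsWeight.measure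
  have := nullSingletonClass_withDensity leb (calKernel hω.toIsWeight.measure)
  have key := lintegral_antitone_le (ν₁ := leb.withDensity (calKernel hω.toIsWeight.measure))
    (ν₂ := ENNReal.ofReal C • hφ.toIsWeight.measure) (fun b hb => by
      have hφb := hφ.pos b hb
      rw [leb_withDensity_Ioo hb.2.le, Measure.smul_apply, hφ.measure_Ioo hb, smul_eq_mul,
        ← ENNReal.ofReal_mul (by positivity)]
      refine (hω.setLIntegral_calKernel_le hb).trans ?_
      refine (add_le_add (hc b hb) (ENNReal.ofReal_le_ofReal (hlin b hb))).trans ?_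
      rw [hC, add_mul, ENNReal.ofReal_add (by positivity) (by positivity)]
      gcongr
      exact le_max_left _ _) hz hz0
  rw [restrict_leb_withDensity, Measure.restrict_smul, lintegral_smul_measure,
    hφ.toIsWeight.measure_restrict, smul_eq_mul,
    lintegral_withDensity_eq_lintegral_mul₀ hk.aemeasurable hzm.ennreal_ofReal] at key
  rw [lintegral_cal hzm]
  simpa only [Pi.mul_apply, mul_comm] using key

/-- Functions of a Lorentz space are integrable. -/
theorem IsQuasiconcave.exists_lintegral_le {φ : ℝ → ℝ} (hφ : IsQuasiconcave φ) :
    ∃ C : ENNReal, C ≠ ⊤ ∧ ∀ f : ℝ → ℝ, AEMeasurable f leb →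
      ∫⁻ t, ENNReal.ofReal (rearrFun f t) ∂leb ≤ C * lnorm hφ.toIsWeight.measure f := by
  have h2 : (1 / 2 : ℝ) ∈ Ioo (0 : ℝ) 1 := by norm_num
  have hφ2 := hφ.pos _ h2
  refine ⟨ENNReal.ofReal (1 / φ (1 / 2)), ENNReal.ofReal_ne_top, fun f hf => ?_⟩
  have key := lintegral_antitone_le (ν₁ := volume)
    (ν₂ := ENNReal.ofReal (1 / φ (1 / 2)) • hφ.toIsWeight.measure) (fun b hb => by
      have hφb := hφ.pos b hb
      rw [Real.volume_Ioo, sub_zero, Measure.smul_apply, hφ.measure_Ioo hb, smul_eq_mul,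
        ← ENNReal.ofReal_mul (by positivity)]
      refine ENNReal.ofReal_le_ofReal ?_
      rw [one_div, inv_mul_eq_div, le_div_iff₀ hφ2]
      exact hφ.mul_half_le hb) (rearrFun_antitoneOn_Ioo hf) fun t _ => rearrFun_nonneg _ _
  rwa [Measure.restrict_smul, lintegral_smul_measure, hφ.toIsWeight.measure_restrict,
    smul_eq_mul] at key

theorem lintegral_abs_eq_rearrFun {f : ℝ → ℝ} (hf : AEMeasurable f leb) :
    ∫⁻ t, ENNReal.ofReal |f t| ∂leb = ∫⁻ t, ENNReal.ofReal (rearrFun f t) ∂leb := by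
  simpa using (lintegral_rearrFun_sub hf le_rfl).symm

/-! ### Dyadic decomposition of a decreasing rearrangement -/

/-- The values of the rearrangement at the points `2⁻ᵏ`, `k ≥ 1`, preceded by `0`. -/
def rearrLevel (f : ℝ → ℝ) : ℕ → ℝ
  | 0 => 0
  | k + 1 => rearrFun f ((1 / 2) ^ (k + 1))

theorem rearrLevel_succ (f : ℝ → ℝ) (k : ℕ) :
    rearrLevel f (k + 1) = rearrFun f ((1 / 2) ^ (k + 1)) := rfl

theorem half_pow_mem_Ioi (n : ℕ) : ((1 / 2) ^ n : ℝ) ∈ Ioi (0 : ℝ) :=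
  mem_Ioi.2 (by positivity)

/-- The increments of the rearrangement along the points `2⁻ᵏ`. -/
def rearrIncr (f : ℝ → ℝ) (j : ℕ) : ℝ := rearrLevel f (j + 1) - rearrLevel f j

theorem rearrLevel_nonneg (f : ℝ → ℝ) (k : ℕ) : 0 ≤ rearrLevel f k := by
  cases k with
  | zero => exact le_rfl
  | succ k => exact rearrFun_nonneg _ _

theorem rearrIncr_nonneg {f : ℝ → ℝ} (hf : AEMeasurable f leb) (j : ℕ) : 0 ≤ rearrIncr f j := by
  refine sub_nonneg.2 ?_
  cases j with
  | zero => exact rearrLevel_nonneg f 1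
  | succ j =>
    exact rearrFun_antitoneOn hf (half_pow_mem_Ioi _) (half_pow_mem_Ioi _)
      (pow_le_pow_of_le_one (by norm_num) (by norm_num) (Nat.le_succ _))

theorem sum_rearrIncr (f : ℝ → ℝ) (J : ℕ) :
    ∑ j ∈ Finset.range J, rearrIncr f j = rearrLevel f J := by
  rw [show rearrIncr f = fun j => rearrLevel f (j + 1) - rearrLevel f j from rfl,
    Finset.sum_range_sub]
  exact sub_zero _

/-- Together with `exists_le_sum_rearrIncr` this traps the rearrangement between `∑ aⱼ χ_(0,2⁻ʲ⁻¹)`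
and `∑ aⱼ χ_(0,2⁻ʲ)`, where `aⱼ` are the increments. -/
theorem sum_rearrIncr_le {f : ℝ → ℝ} (hf : AEMeasurable f leb) {t : ℝ} (ht : 0 < t) (J : ℕ) :
    ∑ j ∈ Finset.range J, (if t < (1 / 2) ^ (j + 1) then rearrIncr f j else 0) ≤
      rearrFun f t := by
  -- The induction needs the stronger bound by the minimum: an increment is added only when the next
  -- level still lies below `rearrFun f t`.
  refine (?_ : _ ≤ min (rearrLevel f J) (rearrFun f t)).trans (min_le_right _ _)
  induction J with
  | zero => simp [rearrLevel_nonneg, rearrFun_nonneg]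
  | succ J ih =>
    rw [Finset.sum_range_succ]
    have hinc := rearrIncr_nonneg hf J
    have hstep : rearrLevel f (J + 1) = rearrLevel f J + rearrIncr f J := by
      rw [rearrIncr]; ring
    split_ifs with h
    · have h1 : rearrLevel f (J + 1) ≤ rearrFun f t :=
        rearrFun_antitoneOn hf ht (half_pow_mem_Ioi _) h.le
      rw [min_eq_left h1]
      linarith [ih.trans (min_le_left _ _)]
    · rw [add_zero]
      exact ih.trans (min_le_min_right _ (by linarith))

theorem exists_dyadic_lt {t : ℝ} (ht : t ∈ Ioo (0 : ℝ) 1) :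
    ∃ n : ℕ, (1 / 2) ^ (n + 1) ≤ t ∧ t < (1 / 2) ^ n := by
  obtain ⟨n, h1, h2⟩ := exists_nat_pow_near_of_lt_one ht.1 ht.2.le one_half_pos one_half_lt_one
  rcases h2.lt_or_eq with h | h
  · exact ⟨n, h1.le, h⟩
  · cases n with
    | zero => exact absurd h (by simpa using ht.2.ne)
    | succ n =>
      exact ⟨n, h.ge, h ▸ pow_lt_pow_right_of_lt_one₀ one_half_pos one_half_lt_one n.lt_succ_self⟩

theorem exists_le_sum_rearrIncr {f : ℝ → ℝ} (hf : AEMeasurable f leb) {t : ℝ}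
    (ht : t ∈ Ioo (0 : ℝ) 1) : ∃ J : ℕ, rearrFun f t ≤ ∑ j ∈ Finset.range J, rearrIncr f j ∧
      ∀ j < J, t < (1 / 2) ^ j := by
  obtain ⟨n, h1, h2⟩ := exists_dyadic_lt ht
  refine ⟨n + 1, ?_, fun j hj => h2.trans_le ?_⟩
  · rw [sum_rearrIncr]
    exact rearrFun_antitoneOn hf (half_pow_mem_Ioi _) ht.1 h1
  · exact pow_le_pow_of_le_one (by norm_num) (by norm_num) (Nat.lt_succ_iff.1 hj)

theorem tsum_rearrIncr_le {ω : ℝ → ℝ} (h : IsWeight ω) {f : ℝ → ℝ} (hf : AEMeasurable f leb) :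
    ∑' j : ℕ, ENNReal.ofReal (rearrIncr f j) * h.measure (Ioo 0 ((1 / 2) ^ (j + 1))) ≤
      lnorm h.measure f := by
  rw [ENNReal.tsum_eq_iSup_nat]
  refine iSup_le fun J => ?_
  calc ∑ j ∈ Finset.range J, ENNReal.ofReal (rearrIncr f j) *
        h.measure (Ioo 0 ((1 / 2) ^ (j + 1)))
      = ∑ j ∈ Finset.range J, ∫⁻ t, (Ioo (0 : ℝ) ((1 / 2) ^ (j + 1))).indicator
          (fun _ => ENNReal.ofReal (rearrIncr f j)) t ∂h.measure := by
        refine Finset.sum_congr rfl fun j _ => ?_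
        rw [lintegral_indicator_const measurableSet_Ioo]
    _ = ∫⁻ t, ∑ j ∈ Finset.range J, (Ioo (0 : ℝ) ((1 / 2) ^ (j + 1))).indicator
          (fun _ => ENNReal.ofReal (rearrIncr f j)) t ∂h.measure :=
        (lintegral_finsetSum _ fun j _ => measurable_const.indicator measurableSet_Ioo).symm
    _ ≤ lnorm h.measure f := by
        refine h.lintegral_mono fun t ht => ?_
        refine le_trans (le_of_eq ?_) (ENNReal.ofReal_le_ofReal (sum_rearrIncr_le hf ht.1 J))
        rw [ENNReal.ofReal_sum_of_nonneg fun j _ => by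
          split_ifs
          exacts [rearrIncr_nonneg hf j, le_rfl]]
        refine Finset.sum_congr rfl fun j _ => ?_
        by_cases hj : t < (1 / 2) ^ (j + 1)
        · rw [indicator_of_mem (show t ∈ Ioo _ _ from ⟨ht.1, hj⟩), if_pos hj]
        · rw [indicator_of_notMem (fun h' => hj h'.2), if_neg hj, ENNReal.ofReal_zero]

/-- With `u = 2⁻ʲ`, the function `w χ_(0,s)` has Hardy transform at least `1` on `(0,u)`. The scale
`s` is chosen so that its cost in `Λ_φ` is near the infimum `ψ(u)`. -/
theorem exists_scale {φ : ℝ → ℝ} (hφ : IsQuasiconcave φ) :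
    ∃ C : ENNReal, C ≠ ⊤ ∧ ∀ j : ℕ, ∃ s w : ℝ, (1 / 2) ^ j ≤ s ∧ s ≤ 1 ∧ 0 ≤ w ∧
      w * (1 + Real.log (s / (1 / 2) ^ j)) = 1 ∧
      ENNReal.ofReal w * hφ.toIsWeight.measure (Ioo 0 s) ≤
        C * hφ.psi.toIsWeight.measure (Ioo 0 ((1 / 2) ^ (j + 1))) := by
  have h2 : (1 / 2 : ℝ) ∈ Ioo (0 : ℝ) 1 := by norm_num
  have hψ2 := hφ.psi.pos _ h2
  refine ⟨ENNReal.ofReal (max 4 (1 / psi φ (1 / 2))), ENNReal.ofReal_ne_top, fun j => ?_⟩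
  rcases Nat.eq_zero_or_pos j with rfl | hj
  -- For `j = 0` one has `u = 1`, outside the domain of `ψ`; the total mass at most `1` is compared
  -- with `ψ(1/2)`.
  · refine ⟨1, 1, by norm_num, le_rfl, zero_le_one, by norm_num, ?_⟩
    rw [ENNReal.ofReal_one, one_mul, zero_add, pow_one, hφ.psi.measure_Ioo h2,
      ← ENNReal.ofReal_mul (by positivity)]
    refine hφ.measure_Ioo_one_le.trans (ENNReal.one_le_ofReal.2 ?_)
    calc (1 : ℝ) = 1 / psi φ (1 / 2) * psi φ (1 / 2) := by field_simp
      _ ≤ _ := by gcongr; exact le_max_right _ _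
  · set u : ℝ := (1 / 2) ^ j with hu
    have hu0 : 0 < u := by positivity
    have hu1 : u ∈ Ioo (0 : ℝ) 1 := ⟨hu0, pow_lt_one₀ (by norm_num) (by norm_num) hj.ne'⟩
    have hu2 : (1 / 2) ^ (j + 1) ∈ Ioo (0 : ℝ) 1 :=
      ⟨by positivity, pow_lt_one₀ (by norm_num) (by norm_num) (by omega)⟩
    have hψ := hφ.psi.pos u hu1
    have hψ' := hφ.psi.pos _ hu2
    obtain ⟨s, hs, hlt⟩ := exists_lt_of_psi_lt hu1 (show psi φ u < 2 * psi φ u by linarith)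
    have hL : 0 < Real.log (s / u) := Real.log_pos ((one_lt_div hu0).2 hs.1)
    refine ⟨s, 1 / (1 + Real.log (s / u)), hs.1.le, hs.2.le, by positivity,
      one_div_mul_cancel (by positivity), ?_⟩
    rw [hφ.measure_Ioo ⟨hu0.trans hs.1, hs.2⟩, hφ.psi.measure_Ioo hu2,
      ← ENNReal.ofReal_mul (by positivity), ← ENNReal.ofReal_mul (by positivity)]
    refine ENNReal.ofReal_le_ofReal ?_
    rw [one_div, inv_mul_eq_div]
    have h3 := hφ.psi.mul_le_mul _ u hu2.1 (by rw [pow_succ]; linarith) hu1.2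
    rw [pow_succ, ← hu] at h3
    have h4 : psi φ u ≤ 2 * psi φ ((1 / 2) ^ (j + 1)) := by
      rw [pow_succ, ← hu]
      nlinarith
    -- One factor `2` is the near-optimality of `s`, the other the passage from `ψ(2⁻ʲ)` to
    -- `ψ(2⁻ʲ⁻¹)`.
    calc φ s / (1 + Real.log (s / u)) ≤ 4 * psi φ ((1 / 2) ^ (j + 1)) := by linarith
      _ ≤ _ := by gcongr; exact le_max_left _ _

/-! ### Domination by Hardy transforms -/

/-- The Hardy-type operator `z(t) + ∫ₜ¹ z(r)/r dr`. -/
def hardy (z : ℝ → ℝ) (t : ℝ) : ENNReal :=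
  ENNReal.ofReal (z t) + ∫⁻ r in Ioo t 1, ENNReal.ofReal (z r / r)

/-- A decreasing function is at most its average over `(0,t)`. -/
theorem hardy_le_cal {z : ℝ → ℝ} (hz : AntitoneOn z (Ioo 0 1)) {t : ℝ}
    (ht : t ∈ Ioo (0 : ℝ) 1) : hardy z t ≤ cal z t := by
  have hm : ∀ s, 0 ≤ 1 / max s t := fun s => by have := ht.1; positivity
  have hsub : Ioo 0 t ∪ Ioo t 1 ⊆ Ioo (0 : ℝ) 1 :=
    union_subset (Ioo_subset_Ioo_right ht.2.le) (Ioo_subset_Ioo_left ht.1.le)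
  refine le_trans ?_ (lintegral_mono_set hsub)
  rw [lintegral_union measurableSet_Ioo (disjoint_left.2 fun s hs hs' => lt_asymm hs.2 hs'.1)]
  refine add_le_add ?_ ?_
  · calc ENNReal.ofReal (z t)
        = ∫⁻ s in Ioo 0 t, ENNReal.ofReal (z t) * ENNReal.ofReal (1 / t) := by
          rw [setLIntegral_const, Real.volume_Ioo, sub_zero, mul_assoc, ← ENNReal.ofReal_mul
            (by have := ht.1; positivity), one_div_mul_cancel ht.1.ne', ENNReal.ofReal_one,
            mul_one]
      _ ≤ _ := by
          refine setLIntegral_mono' measurableSet_Ioo fun s hs => ?_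
          rw [max_eq_right hs.2.le]
          exact mul_le_mul_left (ENNReal.ofReal_le_ofReal
            (hz ⟨hs.1, hs.2.trans ht.2⟩ ht hs.2.le)) _
  · refine setLIntegral_mono' measurableSet_Ioo fun s hs => ?_
    rw [← ENNReal.ofReal_mul' (hm s), max_eq_left hs.1.le, mul_one_div]

/-- Every function of `Λ_ψ` has a rearrangement dominated by the Hardy transform of a decreasing
function of `Λ_φ`. -/
theorem exists_le_hardy {φ : ℝ → ℝ} (hφ : IsQuasiconcave φ) :
    ∃ C : ENNReal, C ≠ ⊤ ∧ ∀ f : ℝ → ℝ, AEMeasurable f leb →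
      lnorm hφ.psi.toIsWeight.measure f < ⊤ →
      ∃ z : ℝ → ℝ, AntitoneOn z (Ioo 0 1) ∧ (∀ t ∈ Ioo (0 : ℝ) 1, 0 ≤ z t) ∧
        (∀ t ∈ Ioo (0 : ℝ) 1, ENNReal.ofReal (rearrFun f t) ≤ hardy z t) ∧
        ∫⁻ t, ENNReal.ofReal (z t) ∂hφ.toIsWeight.measure ≤
          C * lnorm hφ.psi.toIsWeight.measure f := by
  obtain ⟨C, hC, hsc⟩ := exists_scale hφ
  choose s w hus hs1 hw0 hw hsw using hsc
  refine ⟨C, hC, fun f hf hfin => ?_⟩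
  set a : ℕ → ℝ := rearrIncr f with ha
  have ha0 : ∀ j, 0 ≤ a j := rearrIncr_nonneg hf
  -- The near-optimal functions of all scales are superposed with the increments of the
  -- rearrangement as weights.
  set zE : ℝ → ENNReal := fun t =>
    ∑' j, (Iio (s j)).indicator (fun _ => ENNReal.ofReal (a j * w j)) t with hzE
  have hzm : ∀ j, Measurable ((Iio (s j)).indicator fun _ => ENNReal.ofReal (a j * w j)) :=
    fun j => measurable_const.indicator measurableSet_Iio
  have hzEm : Measurable zE := Measurable.tsum hzm
  have hanti : Antitone zE := by
    intro t v htv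
    refine ENNReal.tsum_le_tsum fun j => ?_
    by_cases hv : v ∈ Iio (s j)
    · rw [indicator_of_mem hv, indicator_of_mem (show t ∈ Iio (s j) from lt_of_le_of_lt htv hv)]
    · rw [indicator_of_notMem hv]
      exact bot_le
  have hint : ∫⁻ t, zE t ∂hφ.toIsWeight.measure ≤ C * lnorm hφ.psi.toIsWeight.measure f := by
    rw [lintegral_tsum fun j => (hzm j).aemeasurable]
    refine le_trans ?_ (mul_le_mul_right (tsum_rearrIncr_le hφ.psi.toIsWeight hf) C)
    rw [← ENNReal.tsum_mul_left]
    refine ENNReal.tsum_le_tsum fun j => ?_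
    rw [lintegral_indicator_const measurableSet_Iio, hφ.toIsWeight.measure_Iio,
      ENNReal.ofReal_mul (ha0 j), mul_assoc, mul_left_comm C]
    exact mul_le_mul_right (hsw j) _
  -- A decreasing function that is infinite at `t` is infinite on `(0,t)`, which has positive mass
  -- `φ(t)`.
  have hzfin : ∀ t ∈ Ioo (0 : ℝ) 1, zE t < ⊤ := by
    intro t ht
    have h1 : zE t * ENNReal.ofReal (φ t) ≤ C * lnorm hφ.psi.toIsWeight.measure f := by
      rw [← hφ.measure_Ioo ht, ← setLIntegral_const]
      refine le_trans (setLIntegral_mono' measurableSet_Ioo fun r hr => hanti hr.2.le)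
        ((setLIntegral_le_lintegral (Ioo 0 t) _).trans hint)
    by_contra! hcon
    rw [top_le_iff.1 hcon, ENNReal.top_mul (ENNReal.ofReal_pos.2 (hφ.pos t ht)).ne'] at h1
    exact absurd (ENNReal.mul_lt_top hC.lt_top hfin) (not_lt.2 h1)
  have hz : ∀ t ∈ Ioo (0 : ℝ) 1, ENNReal.ofReal (zE t).toReal = zE t := fun t ht =>
    ENNReal.ofReal_toReal (hzfin t ht).ne
  refine ⟨fun t => (zE t).toReal, fun t ht v _ htv =>
    ENNReal.toReal_mono (hzfin t ht).ne (hanti htv), fun t _ => ENNReal.toReal_nonneg, ?_, ?_⟩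
  · intro t ht
    obtain ⟨J, hJ, hlt⟩ := exists_le_sum_rearrIncr hf ht
    have hrw : hardy (fun t => (zE t).toReal) t =
        zE t + ∫⁻ r in Ioo t 1, zE r * ENNReal.ofReal (1 / r) := by
      rw [hardy, hz t ht]
      congr 1
      refine setLIntegral_congr_fun measurableSet_Ioo fun r hr => ?_
      have hr0 : 0 < r := ht.1.trans hr.1
      rw [div_eq_mul_one_div, ENNReal.ofReal_mul' (by positivity), hz r ⟨hr0, hr.2⟩]
    -- At every `t < 2⁻ʲ` the Hardy transform of the `j`-th summand is `aⱼ wⱼ (1 + log(sⱼ/t))`, at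
    -- least `aⱼ` by the choice of `wⱼ`.
    have hterm : ∀ j ∈ Finset.range J, ENNReal.ofReal (a j) ≤
        (Iio (s j)).indicator (fun _ => ENNReal.ofReal (a j * w j)) t +
        ∫⁻ r in Ioo t 1, (Iio (s j)).indicator (fun _ => ENNReal.ofReal (a j * w j)) r *
          ENNReal.ofReal (1 / r) := by
      intro j hj
      have htj := hlt j (Finset.mem_range.1 hj)
      have hts : t < s j := htj.trans_le (hus j)
      have hlog : ENNReal.ofReal (Real.log (s j / t)) ≤ ∫⁻ r in Ioo t (s j),
          ENNReal.ofReal (1 / r) := by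
        have h0 : (0 : ℝ) ∉ uIcc t (s j) := by
          rw [uIcc_of_le hts.le]
          exact fun h => not_lt.2 h.1 ht.1
        rw [← integral_one_div h0, intervalIntegral.integral_of_le hts.le,
          integral_Ioc_eq_integral_Ioo, ofReal_integral_eq_lintegral_ofReal]
        · exact ((intervalIntegral.intervalIntegrable_one_div (fun x hx hx0 => h0 (hx0 ▸ hx))
            continuousOn_id).1).mono_set Ioo_subset_Ioc_self
        · refine (ae_restrict_iff' measurableSet_Ioo).2 (Eventually.of_forall fun r hr => ?_)
          have : 0 < r := ht.1.trans hr.1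
          show 0 ≤ 1 / r
          positivity
      have hI : ENNReal.ofReal (a j * w j) * ENNReal.ofReal (Real.log (s j / t)) ≤
          ∫⁻ r in Ioo t 1, (Iio (s j)).indicator (fun _ => ENNReal.ofReal (a j * w j)) r *
            ENNReal.ofReal (1 / r) := by
        refine le_trans (mul_le_mul_right hlog _) ?_
        rw [← lintegral_const_mul' _ _ ENNReal.ofReal_ne_top]
        refine le_trans ?_ (lintegral_mono_set (Ioo_subset_Ioo_right (hs1 j)))
        refine setLIntegral_mono' measurableSet_Ioo fun r hr => ?_
        rw [indicator_of_mem (show r ∈ Iio (s j) from hr.2)]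
      refine le_trans ?_ (add_le_add_right hI _)
      rw [indicator_of_mem (show t ∈ Iio (s j) from hts)]
      have hlog0 : 0 ≤ Real.log (s j / t) := Real.log_nonneg ((one_le_div ht.1).2 hts.le)
      have haw : 0 ≤ a j * w j := mul_nonneg (ha0 j) (hw0 j)
      rw [← ENNReal.ofReal_mul haw, ← ENNReal.ofReal_add haw (mul_nonneg haw hlog0)]
      refine ENNReal.ofReal_le_ofReal ?_
      have hs0 : 0 < s j := ht.1.trans hts
      have hmono : Real.log (s j / (1 / 2) ^ j) ≤ Real.log (s j / t) :=
        Real.log_le_log (by positivity) (div_le_div_of_nonneg_left hs0.le ht.1 htj.le)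
      calc a j = a j * (w j * (1 + Real.log (s j / (1 / 2) ^ j))) := by rw [hw, mul_one]
        _ = a j * w j + a j * w j * Real.log (s j / (1 / 2) ^ j) := by ring
        _ ≤ _ := by gcongr
    calc ENNReal.ofReal (rearrFun f t)
        ≤ ENNReal.ofReal (∑ j ∈ Finset.range J, a j) := ENNReal.ofReal_le_ofReal hJ
      _ = ∑ j ∈ Finset.range J, ENNReal.ofReal (a j) :=
          ENNReal.ofReal_sum_of_nonneg fun j _ => ha0 j
      _ ≤ ∑ j ∈ Finset.range J,
            ((Iio (s j)).indicator (fun _ => ENNReal.ofReal (a j * w j)) t +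
            ∫⁻ r in Ioo t 1, (Iio (s j)).indicator (fun _ => ENNReal.ofReal (a j * w j)) r *
              ENNReal.ofReal (1 / r)) := Finset.sum_le_sum hterm
      _ ≤ ∑' j, ((Iio (s j)).indicator (fun _ => ENNReal.ofReal (a j * w j)) t +
            ∫⁻ r in Ioo t 1, (Iio (s j)).indicator (fun _ => ENNReal.ofReal (a j * w j)) r *
              ENNReal.ofReal (1 / r)) := ENNReal.sum_le_tsum _
      _ = hardy (fun t => (zE t).toReal) t := by
          rw [hrw, ENNReal.tsum_add, ← lintegral_tsum (f := fun j r =>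
            (Iio (s j)).indicator (fun _ => ENNReal.ofReal (a j * w j)) r *
              ENNReal.ofReal (1 / r)) fun j => ((hzm j).mul (by fun_prop)).aemeasurable]
          simp only [ENNReal.tsum_mul_right, hzE]
  · exact (hφ.toIsWeight.lintegral_mono fun t ht => (hz t ht).le).trans hint

/-! ### The range of the Calderón operator -/

/-- Decreasing functions are, up to a dilation, rearrangements. -/
theorem exists_rearr_between {z : ℝ → ℝ} (hz : AntitoneOn z (Ioo 0 1))
    (hz0 : ∀ t ∈ Ioo (0 : ℝ) 1, 0 ≤ z t) :
    ∃ y : S01, ∀ t ∈ Ioo (0 : ℝ) 1, z t ≤ rearr y t ∧ rearr y t ≤ z (t / 2) := by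
  have hh : ∀ t ∈ Ioo (0 : ℝ) 1, t / 2 ∈ Ioo (0 : ℝ) 1 := fun t ht =>
    ⟨by linarith [ht.1], by linarith [ht.1, ht.2]⟩
  have hz' : AntitoneOn (fun t => z (t / 2)) (Ioo 0 1) := fun s hs t ht hst =>
    hz (hh s hs) (hh t ht) (by linarith)
  refine ⟨AEEqFun.mk _ (aemeasurable_of_antitoneOn_Ioo hz' volume).aestronglyMeasurable,
    fun t ht => ?_⟩
  rw [rearr_mk]
  refine ⟨?_, rearrFun_le_of_antitoneOn hz' (fun t ht => hz0 _ (hh t ht)) ht⟩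
  -- The chosen point lies strictly between `t` and `1`, and half of it is at most `t`. The dilation
  -- by two thus replaces the missing right continuity of `z`.
  have h1 : t < min (2 * t) ((t + 1) / 2) := lt_min (by linarith [ht.1]) (by linarith [ht.2])
  have h2 : min (2 * t) ((t + 1) / 2) < 1 := (min_le_right _ _).trans_lt (by linarith [ht.2])
  refine le_trans ?_ (le_rearrFun_of_antitoneOn hz' ht.1 h1 h2)
  exact hz (hh _ ⟨ht.1.trans h1, h2⟩) ht (by linarith [min_le_left (2 * t) ((t + 1) / 2)])

theorem calderon_nonneg {z : ℝ → ℝ} (hz : ∀ t, 0 ≤ z t) {t : ℝ} (ht : t ∈ Ioo (0 : ℝ) 1) :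
    0 ≤ calderon z t := by
  refine add_nonneg (mul_nonneg (one_div_nonneg.2 ht.1.le) (integral_nonneg hz)) ?_
  exact setIntegral_nonneg measurableSet_Ioo fun s hs => div_nonneg (hz s) (ht.1.trans hs.1).le

/-- One inclusion is the boundedness of the Calderón operator on decreasing functions, the other the
domination by Hardy transforms. A dilation turns the dominating function into a rearrangement. -/
theorem sameSpace_calderonRange {φ : ℝ → ℝ} (hφ : IsQuasiconcave φ) {c : ℝ}
    (hc : ∀ u ∈ Ioo (0 : ℝ) 1, (∫⁻ t in Ioo 0 u, ENNReal.ofReal (psi φ t / t)) +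
      ENNReal.ofReal u * (∫⁻ t in Ioo u 1, ENNReal.ofReal (psi φ t / t ^ 2)) ≤
        ENNReal.ofReal (c * φ u)) :
    SameSpace (calderonRange (lorentz φ hφ.toIsWeight)) (lorentz (psi φ) hφ.toIsWeight.psi) := by
  obtain ⟨C₁, hC₁, hint⟩ := hφ.exists_lintegral_le
  have hm : ∀ y : S01, AEMeasurable y leb := fun y => y.aestronglyMeasurable.aemeasurable
  have hcal : ∀ y ∈ (lorentz φ hφ.toIsWeight).carrier, ∀ t ∈ Ioo (0 : ℝ) 1,
      ENNReal.ofReal (calderon (rearr y) t) = cal (rearr y) t := fun y hy t ht =>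
    ofReal_calderon (rearrFun_aemeasurable (hm y)) (fun s _ => rearrFun_nonneg _ _)
      ((hint y (hm y)).trans_lt (ENNReal.mul_lt_top hC₁.lt_top hy)) ht
  constructor
  · obtain ⟨C, hC, hle⟩ := exists_lintegral_cal_le hφ hφ.psi hc
    have key : ∀ x : S01, ∀ y ∈ (lorentz φ hφ.toIsWeight).carrier,
        (∀ t ∈ Ioo (0 : ℝ) 1, rearr x t ≤ calderon (rearr y) t) →
        lnorm hφ.psi.toIsWeight.measure x ≤ C * lnorm hφ.toIsWeight.measure y := by
      intro x y hy hxy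
      refine (hφ.psi.toIsWeight.lintegral_mono fun t ht => ?_).trans
        (hle (rearr y) (rearrFun_antitoneOn_Ioo (hm y)) fun t _ => rearrFun_nonneg _ _)
      exact (ENNReal.ofReal_le_ofReal (hxy t ht)).trans (hcal y hy t ht).le
    refine ⟨fun x hx => ?_, C.toReal, fun x hx => ?_⟩
    · obtain ⟨-, y, hy, hxy⟩ := hx
      exact (key x y hy hxy).trans_lt (ENNReal.mul_lt_top hC.lt_top hy)
    · obtain ⟨-, y₀, hy₀, hxy₀⟩ := hx
      -- The infimum is bounded from below after division by the constant, so a zero constant is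
      -- treated apart.
      rcases eq_or_ne C.toReal 0 with h0 | h0
      · have := ENNReal.toReal_mono (ENNReal.mul_lt_top hC.lt_top hy₀).ne (key x y₀ hy₀ hxy₀)
        rw [ENNReal.toReal_mul, h0, zero_mul] at this
        rw [h0, zero_mul]
        exact this
      · have hpos : 0 < C.toReal := lt_of_le_of_ne ENNReal.toReal_nonneg h0.symm
        rw [← div_le_iff₀' hpos]
        refine le_csInf ⟨_, y₀, hy₀, hxy₀, rfl⟩ ?_
        rintro _ ⟨y, hy, hxy, rfl⟩
        rw [div_le_iff₀' hpos, qnorm_lorentz, qnorm_lorentz, ← ENNReal.toReal_mul]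
        exact ENNReal.toReal_mono (ENNReal.mul_lt_top hC.lt_top hy).ne (key x y hy hxy)
  · obtain ⟨C, hC, hex⟩ := exists_le_hardy hφ
    have key : ∀ x ∈ (lorentz (psi φ) hφ.toIsWeight.psi).carrier,
        ∃ y ∈ (lorentz φ hφ.toIsWeight).carrier,
          (∀ t ∈ Ioo (0 : ℝ) 1, rearr x t ≤ calderon (rearr y) t) ∧
          lnorm hφ.toIsWeight.measure y ≤ 2 * C * lnorm hφ.psi.toIsWeight.measure x := by
      intro x hx
      obtain ⟨z, hz, hz0, hxz, hle⟩ := hex x (hm x) hx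
      obtain ⟨y, hy⟩ := exists_rearr_between hz hz0
      have hny : lnorm hφ.toIsWeight.measure y ≤ 2 * C * lnorm hφ.psi.toIsWeight.measure x := by
        rw [mul_assoc]
        refine le_trans ?_ ((hφ.lintegral_half_le hz hz0).trans (mul_le_mul_right hle 2))
        exact hφ.toIsWeight.lintegral_mono fun t ht => ENNReal.ofReal_le_ofReal (hy t ht).2
      have hym : y ∈ (lorentz φ hφ.toIsWeight).carrier :=
        hny.trans_lt (ENNReal.mul_lt_top (ENNReal.mul_lt_top ENNReal.ofNat_lt_top hC.lt_top) hx)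
      refine ⟨y, hym, fun t ht => ?_, hny⟩
      have h1 : ENNReal.ofReal (rearr x t) ≤ ENNReal.ofReal (calderon (rearr y) t) := by
        rw [hcal y hym t ht]
        refine (hxz t ht).trans ((hardy_le_cal hz ht).trans ?_)
        refine setLIntegral_mono' measurableSet_Ioo fun s hs => ?_
        exact mul_le_mul_left (ENNReal.ofReal_le_ofReal (hy s hs).1) _
      exact (ENNReal.ofReal_le_ofReal_iff (calderon_nonneg (rearrFun_nonneg _) ht)).1 h1
    refine ⟨fun x hx => ?_, (2 * C).toReal, fun x hx => ?_⟩
    · obtain ⟨y, hy, hxy, -⟩ := key x hx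
      refine ⟨⟨(lnorm hφ.psi.toIsWeight.measure x).toReal / psi φ (1 / 2), fun t ht => ?_⟩,
        y, hy, hxy⟩
      have h0 := hφ.psi.pos (1 / 2) (by norm_num)
      have h1 := ENNReal.toReal_mono (mem_lorentz.1 hx).ne (hφ.psi.mul_rearrFun_le (hm x) ht)
      rw [ENNReal.toReal_mul, ENNReal.toReal_ofReal (rearrFun_nonneg _ _),
        ENNReal.toReal_ofReal (hφ.psi.pos t ht).le] at h1
      rw [le_div_iff₀ h0]
      have h2 := mul_le_mul_of_nonneg_left (hφ.psi.mul_half_le ht) (rearrFun_nonneg x t)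
      rw [rearr_eq_rearrFun]
      linarith
    · obtain ⟨y, hy, hxy, hle⟩ := key x hx
      refine le_trans (b := (lorentz φ hφ.toIsWeight).qnorm y)
        (csInf_le ⟨0, ?_⟩ ⟨y, hy, hxy, rfl⟩) ?_
      · rintro _ ⟨y, -, -, rfl⟩
        exact ENNReal.toReal_nonneg
      · rw [qnorm_lorentz, qnorm_lorentz, ← ENNReal.toReal_mul]
        exact ENNReal.toReal_mono (ENNReal.mul_ne_top (ENNReal.mul_ne_top ENNReal.ofNat_ne_top hC)
          (mem_lorentz.1 hx).ne) hle

/-! ### Dyadic averages -/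

/-- The dyadic interval `[k 2⁻ⁿ, (k+1) 2⁻ⁿ)`. -/
def cell (n : ℕ) (k : ℤ) : Set ℝ := {t | ⌊(2 : ℝ) ^ n * t⌋ = k}

/-- The average of a function over the intersection of a dyadic interval with `(0,1)`. -/
def avg (x : ℝ → ℝ) (n : ℕ) (k : ℤ) : ℝ := 2 ^ n * ∫ s in cell n k, x s ∂leb

theorem mem_cell {n : ℕ} {k : ℤ} {t : ℝ} : t ∈ cell n k ↔ ⌊(2 : ℝ) ^ n * t⌋ = k := Iff.rfl

theorem cell_eq_Ico (n : ℕ) (k : ℤ) : cell n k = Ico ((k : ℝ) / 2 ^ n) ((k + 1) / 2 ^ n) := by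
  ext t
  have h : (0 : ℝ) < 2 ^ n := by positivity
  rw [mem_cell, Int.floor_eq_iff, mem_Ico, div_le_iff₀' h, lt_div_iff₀' h]

theorem measurableSet_cell (n : ℕ) (k : ℤ) : MeasurableSet (cell n k) := by
  rw [cell_eq_Ico]
  exact measurableSet_Ico

theorem measurable_floor_dyadic (n : ℕ) : Measurable fun t : ℝ => ⌊(2 : ℝ) ^ n * t⌋ :=
  (measurable_const.mul measurable_id).floor

theorem floor_mem_of_mem_Ioo (n : ℕ) {t : ℝ} (ht : t ∈ Ioo (0 : ℝ) 1) :
    0 ≤ ⌊(2 : ℝ) ^ n * t⌋ ∧ ⌊(2 : ℝ) ^ n * t⌋ < 2 ^ n := by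
  have h : (0 : ℝ) < 2 ^ n := by positivity
  refine ⟨Int.floor_nonneg.2 (mul_nonneg h.le ht.1.le), Int.floor_lt.2 ?_⟩
  push_cast
  nlinarith [ht.2]

theorem volume_cell (n : ℕ) (k : ℤ) : volume (cell n k) = ENNReal.ofReal (1 / 2 ^ n) := by
  rw [cell_eq_Ico, Real.volume_Ico]
  congr 1
  ring

theorem leb_cell {n : ℕ} {k : ℤ} (h0 : 0 ≤ k) (h1 : k < 2 ^ n) :
    leb (cell n k) = ENNReal.ofReal (1 / 2 ^ n) := by
  have h : (0 : ℝ) < 2 ^ n := by positivity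
  refine le_antisymm ((Measure.restrict_apply_le _ _).trans (volume_cell n k).le) ?_
  have h0' : (0 : ℝ) ≤ k := by exact_mod_cast h0
  have h1' : (k : ℝ) + 1 ≤ 2 ^ n := by exact_mod_cast h1
  have hsub : Ioo ((k : ℝ) / 2 ^ n) ((k + 1) / 2 ^ n) ⊆ cell n k ∩ Ioo 0 1 := by
    rw [cell_eq_Ico]
    refine subset_inter Ioo_subset_Ico_self (Ioo_subset_Ioo (by positivity) ?_)
    rwa [div_le_one h]
  rw [leb, Measure.restrict_apply' measurableSet_Ioo]
  refine le_trans (le_of_eq ?_) (measure_mono hsub)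
  rw [Real.volume_Ioo]
  congr 1
  ring

theorem leb_cell_eq_zero {n : ℕ} {k : ℤ} (h : ¬ (0 ≤ k ∧ k < 2 ^ n)) : leb (cell n k) = 0 := by
  rw [leb, Measure.restrict_apply' measurableSet_Ioo]
  have : cell n k ∩ Ioo 0 1 = ∅ := by
    rw [← disjoint_iff_inter_eq_empty, disjoint_left]
    intro t ht ht1
    rw [mem_cell] at ht
    exact h (ht ▸ floor_mem_of_mem_Ioo n ht1)
  rw [this, measure_empty]

/-- Conditional expectations with respect to dyadic `σ`-algebras are given by averages. -/
theorem condExp_dyadic {x : ℝ → ℝ} (hx : Integrable x leb) (n : ℕ) :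
    leb[x | dyadic n] =ᵐ[leb] fun t => avg x n ⌊(2 : ℝ) ^ n * t⌋ := by
  -- A function measurable for the dyadic `σ`-algebra factors through the floor map, hence is
  -- constant on each cell.
  obtain ⟨h, -, hh⟩ := (stronglyMeasurable_condExp (μ := leb) (m := dyadic n)
    (f := x)).exists_eq_measurable_comp
  refine (ae_restrict_iff' measurableSet_Ioo).2 (Eventually.of_forall fun t ht => ?_)
  obtain ⟨h0, h1⟩ := floor_mem_of_mem_Ioo n ht
  set k := ⌊(2 : ℝ) ^ n * t⌋ with hk
  have hcell : MeasurableSet[dyadic n] (cell n k) := ⟨{k}, trivial, rfl⟩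
  have hint := setIntegral_condExp (dyadic_le n) hx hcell
  rw [setIntegral_congr_fun (g := fun _ => h k) (measurableSet_cell n k) (fun s hs => by
    rw [hh]
    exact congrArg h hs), setIntegral_const, Measure.real, leb_cell h0 h1,
    ENNReal.toReal_ofReal (by positivity), smul_eq_mul] at hint
  rw [hh]
  simp only [Function.comp_apply, avg, ← hint, ← hk]
  field_simp

theorem floor_div_two (n : ℕ) (t : ℝ) :
    ⌊(2 : ℝ) ^ (n + 1) * t⌋ / 2 = ⌊(2 : ℝ) ^ n * t⌋ := by
  have := Int.floor_div_natCast ((2 : ℝ) ^ (n + 1) * t) 2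
  rw [show ((2 : ℕ) : ℤ) = 2 from rfl] at this
  rw [← this]
  congr 1
  push_cast
  ring

theorem avg_children {x : ℝ → ℝ} (hx : Integrable x leb) (n : ℕ) (k : ℤ) :
    avg x (n + 1) (2 * k) + avg x (n + 1) (2 * k + 1) = 2 * avg x n k := by
  have hU : cell n k = cell (n + 1) (2 * k) ∪ cell (n + 1) (2 * k + 1) := by
    ext t
    simp only [mem_union, mem_cell, ← floor_div_two n t]
    omega
  have hd : Disjoint (cell (n + 1) (2 * k)) (cell (n + 1) (2 * k + 1)) := by
    rw [disjoint_left]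
    intro t h1 h2
    rw [mem_cell] at h1 h2
    omega
  simp only [avg]
  rw [hU, setIntegral_union hd (measurableSet_cell _ _) hx.integrableOn hx.integrableOn]
  ring

theorem abs_avg_le {x : ℝ → ℝ} {a : ℝ} (ha : 0 ≤ a) (hx : ∀ᵐ t ∂leb, |x t| ≤ a) (n : ℕ) (k : ℤ) :
    |avg x n k| ≤ a := by
  have h := norm_setIntegral_le_of_norm_le_const_ae' (μ := leb) (s := cell n k) (f := x) (C := a)
    (measure_lt_top _ _) (by filter_upwards [hx] with t ht _ using ht)
  have h2 : leb.real (cell n k) ≤ 1 / 2 ^ n := by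
    refine ENNReal.toReal_le_of_le_ofReal (by positivity) ?_
    exact (Measure.restrict_apply_le _ _).trans (volume_cell n k).le
  rw [Real.norm_eq_abs] at h
  rw [avg, abs_mul, abs_of_pos (by positivity : (0 : ℝ) < 2 ^ n)]
  calc 2 ^ n * |∫ s in cell n k, x s ∂leb| ≤ 2 ^ n * (a * (1 / 2 ^ n)) := by
        gcongr
        exact h.trans (by gcongr)
    _ = a := by field_simp

theorem abs_avg_le_avg_abs (x : ℝ → ℝ) (n : ℕ) (k : ℤ) :
    |avg x n k| ≤ avg (fun t => |x t|) n k := by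
  rw [avg, avg, abs_mul, abs_of_pos (by positivity : (0 : ℝ) < 2 ^ n)]
  gcongr
  exact abs_integral_le_integral_abs

theorem avg_zero_zero (x : ℝ → ℝ) : avg x 0 0 = ∫ t, x t ∂leb := by
  rw [avg, pow_zero, one_mul]
  have h : (leb.restrict (cell 0 0)) = leb := by
    rw [leb, Measure.restrict_restrict (measurableSet_cell 0 0), cell_eq_Ico]
    congr 1
    ext t
    simp only [mem_inter_iff, mem_Ico, mem_Ioo]
    norm_num
    intro h0 h1
    exact ⟨h0.le, h1⟩
  rw [h]

theorem sum_range_two_mul (G : ℕ → ℝ) (m : ℕ) :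
    ∑ k ∈ Finset.range (2 * m), G k = ∑ k ∈ Finset.range m, (G (2 * k) + G (2 * k + 1)) := by
  induction m with
  | zero => simp
  | succ m ih =>
    rw [show 2 * (m + 1) = 2 * m + 1 + 1 by ring, Finset.sum_range_succ, Finset.sum_range_succ, ih,
      Finset.sum_range_succ]
    ring

theorem sum_avg {x : ℝ → ℝ} (hx : Integrable x leb) (n : ℕ) :
    ∑ k ∈ Finset.range (2 ^ n), avg x n k = 2 ^ n * ∫ t, x t ∂leb := by
  induction n with
  | zero => simp [avg_zero_zero]
  | succ n ih =>
    rw [pow_succ', sum_range_two_mul]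
    push_cast
    simp only [avg_children hx]
    rw [← Finset.mul_sum, ih]
    ring

theorem lintegral_floor (n : ℕ) (F : ℤ → ENNReal) :
    ∫⁻ t, F ⌊(2 : ℝ) ^ n * t⌋ ∂leb =
      ∑ k ∈ Finset.range (2 ^ n), F k * ENNReal.ofReal (1 / 2 ^ n) := by
  rw [← lintegral_map (f := F) (measurable_of_countable F) (measurable_floor_dyadic n),
    lintegral_countable', tsum_eq_sum (s := (Finset.range (2 ^ n)).map Nat.castEmbedding),
    Finset.sum_map]
  · refine Finset.sum_congr rfl fun k hk => ?_
    rw [Measure.map_apply (measurable_floor_dyadic n) (measurableSet_singleton _)]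
    congr 1
    exact leb_cell (Int.natCast_nonneg k) (by
      have := Finset.mem_range.1 hk
      show (k : ℤ) < 2 ^ n
      exact_mod_cast this)
  · intro k hk
    rw [Measure.map_apply (measurable_floor_dyadic n) (measurableSet_singleton _)]
    refine mul_eq_zero_of_right _ (leb_cell_eq_zero fun h => hk ?_)
    rw [Finset.mem_map]
    refine ⟨k.toNat, ?_, Int.toNat_of_nonneg h.1⟩
    rw [Finset.mem_range]
    zify
    rw [Int.toNat_of_nonneg h.1]
    exact h.2

theorem lintegral_floor_ofReal (n : ℕ) {F : ℤ → ℝ} (hF : ∀ k, 0 ≤ F k) :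
    ∫⁻ t, ENNReal.ofReal (F ⌊(2 : ℝ) ^ n * t⌋) ∂leb =
      ENNReal.ofReal ((∑ k ∈ Finset.range (2 ^ n), F k) / 2 ^ n) := by
  have h0 : 0 ≤ ∑ k ∈ Finset.range (2 ^ n), F k := Finset.sum_nonneg fun k _ => hF k
  rw [lintegral_floor n fun k => ENNReal.ofReal (F k), ← Finset.sum_mul,
    ← ENNReal.ofReal_sum_of_nonneg (f := fun k : ℕ => F k) fun k _ => hF k,
    ← ENNReal.ofReal_mul h0, mul_one_div]

/-! ### The martingale transform on the dyadic tree -/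

/-- The partial sums of the martingale transform as functions of dyadic intervals. -/
def tree (x : ℝ → ℝ) : ℕ → ℤ → ℝ
  | 0, k => avg x 0 k
  | n + 1, k => tree x n (k / 2) +
      (if Even (n + 1) then avg x (n + 1) k - avg x n (k / 2) else 0)

/-- The partial sums of the martingale transform as functions of a point. -/
def treeFun (x : ℝ → ℝ) (n : ℕ) (t : ℝ) : ℝ := tree x n ⌊(2 : ℝ) ^ n * t⌋

theorem measurable_treeFun (x : ℝ → ℝ) (n : ℕ) : Measurable (treeFun x n) :=
  (measurable_of_countable (tree x n)).comp (measurable_floor_dyadic n)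

theorem treeFun_add_two (x : ℝ → ℝ) (N : ℕ) (t : ℝ) : treeFun x (2 * (N + 1)) t =
    treeFun x (2 * N) t + (avg x (2 * N + 2) ⌊(2 : ℝ) ^ (2 * N + 2) * t⌋ -
      avg x (2 * N + 1) ⌊(2 : ℝ) ^ (2 * N + 1) * t⌋) := by
  have h1 : Even (2 * N + 1 + 1) := ⟨N + 1, by ring⟩
  have h2 : ¬ Even (2 * N + 1) := by simp
  rw [treeFun, show 2 * (N + 1) = 2 * N + 1 + 1 by ring, tree, tree, if_pos h1, if_neg h2,
    floor_div_two, floor_div_two, add_zero, treeFun]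

theorem sum_martDiff {x : S01} (hx : Integrable x leb) (N : ℕ) :
    ∑ m ∈ Finset.range (N + 1), martDiff x (2 * m) =ᵐ[leb] treeFun x (2 * N) := by
  induction N with
  | zero =>
    simp only [zero_add, Finset.sum_range_one, mul_zero]
    exact condExp_dyadic hx 0
  | succ N ih =>
    rw [Finset.sum_range_succ]
    filter_upwards [ih, condExp_dyadic hx (2 * N + 1), condExp_dyadic hx (2 * N + 2)]
      with t h1 h2 h3
    rw [Pi.add_apply, h1, treeFun_add_two]
    congr 1
    show (leb[x | dyadic (2 * N + 2)] - leb[x | dyadic (2 * N + 1)]) t = _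
    rw [Pi.sub_apply, h2, h3]

theorem avg_congr {x y : ℝ → ℝ} (h : x =ᵐ[leb] y) : avg x = avg y := by
  funext n k
  rw [avg, avg, integral_congr_ae (ae_restrict_of_ae h)]

theorem tree_congr {x y : ℝ → ℝ} (h : x =ᵐ[leb] y) : tree x = tree y := by
  funext n
  induction n with
  | zero => funext k; rw [tree, tree, avg_congr h]
  | succ n ih => funext k; rw [tree, tree, avg_congr h, ih]

theorem avg_add {x y : ℝ → ℝ} (hx : Integrable x leb) (hy : Integrable y leb) (n : ℕ) (k : ℤ) :
    avg (x + y) n k = avg x n k + avg y n k := by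
  simp only [avg, Pi.add_apply]
  rw [integral_add hx.integrableOn hy.integrableOn, mul_add]

theorem tree_add {x y : ℝ → ℝ} (hx : Integrable x leb) (hy : Integrable y leb) (n : ℕ) (k : ℤ) :
    tree (x + y) n k = tree x n k + tree y n k := by
  induction n generalizing k with
  | zero => exact avg_add hx hy 0 k
  | succ n ih =>
    simp only [tree, ih, avg_add hx hy]
    split_ifs <;> ring

theorem avg_const_mul (c : ℝ) (x : ℝ → ℝ) (n : ℕ) (k : ℤ) :
    avg (fun t => c * x t) n k = c * avg x n k := by
  simp only [avg]
  rw [integral_const_mul]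
  ring

theorem tree_const_mul (c : ℝ) (x : ℝ → ℝ) (n : ℕ) (k : ℤ) :
    tree (fun t => c * x t) n k = c * tree x n k := by
  induction n generalizing k with
  | zero => exact avg_const_mul c x 0 k
  | succ n ih =>
    simp only [tree, ih, avg_const_mul]
    split_ifs <;> ring

/-- The Bellman function argument: a function which is concave along the directions taken by the
pair of martingales decreases in mean. -/
theorem sum_tree_le {x : ℝ → ℝ} (hx : Integrable x leb) {Q : ℝ → Prop} {U : ℝ → ℝ → ℝ}
    (hQ : ∀ n k, Q (avg x n k))
    (hU : ∀ f g d ε : ℝ, ε = 0 ∨ ε = 1 → Q (f + d) → Q (f - d) →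
      U (f + d) (g + ε * d) + U (f - d) (g - ε * d) ≤ 2 * U f g) (n : ℕ) :
    ∑ k ∈ Finset.range (2 ^ n), U (avg x n k) (tree x n k) ≤
      2 ^ n * U (∫ t, x t ∂leb) (∫ t, x t ∂leb) := by
  induction n with
  | zero => simp [avg_zero_zero, tree]
  | succ n ih =>
    rw [pow_succ', sum_range_two_mul, pow_succ', mul_assoc]
    refine le_trans ?_ (mul_le_mul_of_nonneg_left ih zero_le_two)
    rw [Finset.mul_sum]
    refine Finset.sum_le_sum fun k _ => ?_
    push_cast
    have hc := avg_children hx n k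
    -- The transform moves with the martingale at even levels (`ε = 1`) and stands still at odd ones
    -- (`ε = 0`).
    obtain ⟨ε, hε, hif⟩ : ∃ ε : ℝ, (ε = 0 ∨ ε = 1) ∧ ∀ r : ℝ,
        (if Even (n + 1) then r else 0) = ε * r := by
      by_cases h : Even (n + 1)
      · exact ⟨1, Or.inr rfl, fun r => by rw [if_pos h, one_mul]⟩
      · exact ⟨0, Or.inl rfl, fun r => by rw [if_neg h, zero_mul]⟩
    have hd1 : (2 * (k : ℤ)) / 2 = k := by omega
    have hd2 : (2 * (k : ℤ) + 1) / 2 = k := by omega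
    have h1 := hQ (n + 1) (2 * k)
    have h2 := hQ (n + 1) (2 * k + 1)
    simp only [tree, hif, hd1, hd2]
    set p := avg x (n + 1) (2 * k)
    set q := avg x (n + 1) (2 * k + 1)
    have hp : p = avg x n k + (p - q) / 2 := by linarith
    have hq : q = avg x n k - (p - q) / 2 := by linarith
    have key := hU (avg x n k) (tree x n k) ((p - q) / 2) ε hε (hp ▸ h1) (hq ▸ h2)
    rw [← hp, ← hq] at key
    refine le_trans (le_of_eq ?_) key
    congr 2
    · rw [show p - avg x n k = (p - q) / 2 by linarith]
    · rw [show q - avg x n k = -((p - q) / 2) by linarith]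
      ring

theorem sum_abs_avg_le {x : ℝ → ℝ} (hx : Integrable x leb) (n : ℕ) :
    ∑ k ∈ Finset.range (2 ^ n), |avg x n k| ≤ 2 ^ n * ∫ t, |x t| ∂leb := by
  rw [← sum_avg hx.abs n]
  exact Finset.sum_le_sum fun k _ => abs_avg_le_avg_abs x n k

/-! ### Weak type and exponential estimates -/

/-- Burkholder's function for the weak type inequality. -/
def weakBellman (f g : ℝ) : ℝ := if |f| + |g| ≤ 1 then g ^ 2 - f ^ 2 else 1 - 2 * |f|

theorem weakBellman_le (f g : ℝ) : weakBellman f g ≤ 1 - 2 * |f| := by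
  rw [weakBellman]
  split_ifs with h
  · have h1 : g ^ 2 ≤ (1 - |f|) ^ 2 := by
      rw [← sq_abs g]
      exact pow_le_pow_left₀ (abs_nonneg g) (by linarith) 2
    nlinarith [sq_abs f]
  · exact le_rfl

theorem weakBellman_le_of_abs_le {f : ℝ} (hf : |f| ≤ 1) (g : ℝ) :
    weakBellman f g ≤ g ^ 2 - f ^ 2 := by
  rw [weakBellman]
  split_ifs with h
  · exact le_rfl
  · have h1 : (1 - |f|) ^ 2 ≤ g ^ 2 := by
      rw [← sq_abs g]
      exact pow_le_pow_left₀ (by linarith) (by linarith) 2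
    nlinarith [sq_abs f]

theorem weakBellman_self_nonpos (f : ℝ) : weakBellman f f ≤ 0 := by
  rw [weakBellman]
  split_ifs with h
  · linarith
  · linarith

/-- The majorization property: averages of this left-hand side are the tail of the transform minus
twice the `L₁` norm. -/
theorem indicator_sub_le_weakBellman (f g : ℝ) :
    (if 1 ≤ |g| then 1 else 0) - 2 * |f| ≤ weakBellman f g := by
  have hf := abs_nonneg f
  have hg := abs_nonneg g
  rw [weakBellman]
  split_ifs with h1 h2 h2
  · have h3 : |f| = 0 := by linarith
    have h4 : 1 ≤ |g| ^ 2 := one_le_pow₀ h1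
    rw [sq_abs] at h4
    rw [abs_eq_zero.1 h3, abs_zero]
    linarith
  · linarith
  · nlinarith [sq_nonneg g, sq_abs f]
  · linarith

theorem weakBellman_aux {f g d ε : ℝ} (hε : ε = 0 ∨ ε = 1) (h : |f| + |g| ≤ 1)
    (h1 : 1 < f + d) : (1 - 2 * (f + d)) + ((g - ε * d) ^ 2 - (f - d) ^ 2) ≤
      2 * (g ^ 2 - f ^ 2) := by
  have hf := le_abs_self f
  have hg := neg_abs_le g
  have hg' := abs_nonneg g
  rcases hε with rfl | rfl
  · have h2 : (d - (1 - f)) ^ 2 ≤ d ^ 2 := pow_le_pow_left₀ (by linarith) (by linarith) 2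
    nlinarith [sq_nonneg g, sq_nonneg d]
  -- For `ε = 1` the slack in the inequality equals `(g + d)² - (f + d - 1)²`.
  · have h2 : (f + d - 1) ^ 2 ≤ (g + d) ^ 2 := pow_le_pow_left₀ (by linarith) (by linarith) 2
    nlinarith

theorem weakBellman_aux' {f g d ε : ℝ} (hε : ε = 0 ∨ ε = 1) (h : |f| + |g| ≤ 1)
    (h1 : 1 < |f + d|) : (1 - 2 * |f + d|) + ((g - ε * d) ^ 2 - (f - d) ^ 2) ≤
      2 * (g ^ 2 - f ^ 2) := by
  rcases le_or_gt 0 (f + d) with h0 | h0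
  · rw [abs_of_nonneg h0] at h1 ⊢
    exact weakBellman_aux hε h h1
  · rw [abs_of_neg h0] at h1 ⊢
    have := weakBellman_aux (f := -f) (g := -g) (d := -d) hε (by rwa [abs_neg, abs_neg])
      (by linarith)
    nlinarith

/-- In the inner region each endpoint is bounded by `g² - f²` or by `1 - 2|f|`, according to whether
its first coordinate is at most `1` in modulus. The quadratic form is concave along directions `(d,
εd)` because `ε² ≤ 1`. In the outer region only convexity of `|f|` is used. -/
theorem weakBellman_midpoint {f g d ε : ℝ} (hε : ε = 0 ∨ ε = 1) :
    weakBellman (f + d) (g + ε * d) + weakBellman (f - d) (g - ε * d) ≤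
      2 * weakBellman f g := by
  by_cases h : |f| + |g| ≤ 1
  · have hval : weakBellman f g = g ^ 2 - f ^ 2 := if_pos h
    rw [hval]
    rcases le_or_gt |f + d| 1 with h1 | h1 <;> rcases le_or_gt |f - d| 1 with h2 | h2
    · have h3 := weakBellman_le_of_abs_le h1 (g + ε * d)
      have h4 := weakBellman_le_of_abs_le h2 (g - ε * d)
      rcases hε with rfl | rfl <;> nlinarith [sq_nonneg d]
    · have h3 := weakBellman_le_of_abs_le h1 (g + ε * d)
      have h4 := weakBellman_le (f - d) (g - ε * d)
      have h5 := weakBellman_aux' (d := -d) hε h (by rwa [← sub_eq_add_neg])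
      rw [← sub_eq_add_neg, sub_neg_eq_add, mul_neg, sub_neg_eq_add] at h5
      linarith
    · have h3 := weakBellman_le (f + d) (g + ε * d)
      have h4 := weakBellman_le_of_abs_le h2 (g - ε * d)
      have h5 := weakBellman_aux' hε h h1
      linarith
    · have h3 := weakBellman_le (f + d) (g + ε * d)
      have h4 := weakBellman_le (f - d) (g - ε * d)
      have h5 : f ^ 2 ≤ 1 := by
        rw [← sq_abs]
        exact pow_le_one₀ (abs_nonneg f) (by linarith [abs_nonneg g])
      nlinarith [sq_nonneg g]
  · have hval : weakBellman f g = 1 - 2 * |f| := if_neg h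
    have h3 := weakBellman_le (f + d) (g + ε * d)
    have h4 := weakBellman_le (f - d) (g - ε * d)
    have h5 := abs_add_le (f + d) (f - d)
    rw [show f + d + (f - d) = 2 * f by ring, abs_mul, abs_two] at h5
    linarith

/-- The weak type inequality for the partial sums of the martingale transform. -/
theorem leb_one_le_treeFun {x : ℝ → ℝ} (hx : Integrable x leb) (n : ℕ) :
    leb {t | 1 ≤ |treeFun x n t|} ≤ ENNReal.ofReal (2 * ∫ t, |x t| ∂leb) := by
  set F : ℤ → ℝ := fun k => if 1 ≤ |tree x n k| then 1 else 0 with hF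
  have hF0 : ∀ k, 0 ≤ F k := fun k => by
    simp only [hF]
    split_ifs <;> norm_num
  have h1 : leb {t | 1 ≤ |treeFun x n t|} =
      ∫⁻ t, ENNReal.ofReal (F ⌊(2 : ℝ) ^ n * t⌋) ∂leb := by
    rw [← lintegral_indicator_one (measurableSet_le measurable_const
      (measurable_treeFun x n).abs)]
    refine lintegral_congr fun t => ?_
    simp only [hF, indicator_apply, mem_ofPred_eq, treeFun, Pi.one_apply]
    split_ifs <;> simp
  rw [h1, lintegral_floor_ofReal n hF0]
  refine ENNReal.ofReal_le_ofReal ?_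
  rw [div_le_iff₀ (by positivity)]
  have h2 := sum_tree_le hx (Q := fun _ => True) (fun _ _ => trivial)
    (fun f g d ε hε _ _ => weakBellman_midpoint hε) n
  have h3 : ∑ k ∈ Finset.range (2 ^ n), (F k - 2 * |avg x n k|) ≤
      ∑ k ∈ Finset.range (2 ^ n), weakBellman (avg x n k) (tree x n k) :=
    Finset.sum_le_sum fun k _ => indicator_sub_le_weakBellman _ _
  rw [Finset.sum_sub_distrib, ← Finset.mul_sum] at h3
  have h4 := sum_abs_avg_le hx n
  have h5 : (2 : ℝ) ^ n * weakBellman (∫ t, x t ∂leb) (∫ t, x t ∂leb) ≤ 0 :=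
    mul_nonpos_of_nonneg_of_nonpos (by positivity) (weakBellman_self_nonpos _)
  linarith

theorem leb_le_treeFun {x : ℝ → ℝ} (hx : Integrable x leb) (n : ℕ) {s : ℝ} (hs : 0 < s) :
    leb {t | s ≤ |treeFun x n t|} ≤ ENNReal.ofReal (2 * (∫ t, |x t| ∂leb) / s) := by
  have h := leb_one_le_treeFun (hx.const_mul s⁻¹) n
  have h1 : ∀ t, treeFun (fun u => s⁻¹ * x u) n t = s⁻¹ * treeFun x n t := fun t =>
    tree_const_mul _ _ _ _
  simp only [h1, abs_mul, abs_of_pos (inv_pos.2 hs), integral_const_mul] at h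
  refine le_trans (measure_mono fun t ht => ?_) (h.trans (le_of_eq ?_))
  · simp only [mem_ofPred_eq] at ht ⊢
    rwa [inv_mul_eq_div, one_le_div hs]
  · congr 1
    field_simp

theorem cosh_le_one_add_sq {b : ℝ} (hb : |b| ≤ 1) : Real.cosh b ≤ 1 + b ^ 2 := by
  have h0 : b ^ 2 ≤ 1 := by
    rw [← sq_abs]
    exact pow_le_one₀ (abs_nonneg b) hb
  have h1 : |b ^ 2 / 2| ≤ 1 := by
    rw [abs_of_nonneg (by positivity)]
    linarith
  have h2 := (le_abs_self _).trans (Real.abs_exp_sub_one_le h1)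
  rw [abs_of_nonneg (by positivity : (0 : ℝ) ≤ b ^ 2 / 2)] at h2
  linarith [Real.cosh_le_exp_half_sq b]

theorem abs_sinh_le {b : ℝ} (hb : |b| ≤ 1) : |Real.sinh b| ≤ 2 * |b| := by
  have h1 := Real.abs_exp_sub_one_le hb
  have h2 := Real.abs_exp_sub_one_le (x := -b) (by rwa [abs_neg])
  rw [abs_neg] at h2
  rw [Real.sinh_eq]
  rw [abs_le] at h1 h2 ⊢
  constructor <;> linarith

theorem abs_sinh_le_cosh (a : ℝ) : |Real.sinh a| ≤ Real.cosh a :=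
  abs_le.2 ⟨by linarith [Real.exp_pos a, Real.cosh_add_sinh a],
    (Real.sinh_lt_cosh a).le⟩

/-! ### The exponential inequality for bounded functions -/

/-- The Bellman function for the exponential inequality. -/
def expBellman (f g : ℝ) : ℝ := Real.cosh (g / 8) * (2 - f ^ 2)

/-- Concavity of `2 - f²` gains `d² cosh a`, where `a = g/8`. For `ε = 1` this pays for the growth
of `cosh` and for the cross term with `sinh a sinh b`, `b = d/8`; each costs at most half of it,
which is why `g` is divided by `8`. -/
theorem expBellman_midpoint {f g d ε : ℝ} (hε : ε = 0 ∨ ε = 1) (h1 : |f + d| ≤ 1)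
    (h2 : |f - d| ≤ 1) :
    expBellman (f + d) (g + ε * d) + expBellman (f - d) (g - ε * d) ≤ 2 * expBellman f g := by
  have hd : |d| ≤ 1 := by
    rw [abs_le] at h1 h2 ⊢
    constructor <;> linarith
  have hf : |f| ≤ 1 := by
    rw [abs_le] at h1 h2 ⊢
    constructor <;> linarith
  have hfd : f ^ 2 + d ^ 2 ≤ 1 := by
    have h3 := pow_le_one₀ (n := 2) (abs_nonneg _) h1
    have h4 := pow_le_one₀ (n := 2) (abs_nonneg _) h2
    rw [sq_abs] at h3 h4
    nlinarith
  set a := g / 8 with ha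
  have hca : 0 < Real.cosh a := Real.cosh_pos a
  simp only [expBellman]
  rcases hε with rfl | rfl
  · simp only [zero_mul, add_zero, sub_zero, ← ha]
    nlinarith [sq_nonneg d]
  · set b := d / 8 with hb
    have hb1 : |b| ≤ 1 := by
      rw [hb, abs_div, abs_of_pos (by norm_num : (0 : ℝ) < 8)]
      linarith
    rw [one_mul, show (g + d) / 8 = a + b by rw [ha, hb]; ring,
      show (g - d) / 8 = a - b by rw [ha, hb]; ring, Real.cosh_add, Real.cosh_sub]
    have h3 : Real.cosh b * (2 - f ^ 2 - d ^ 2) ≤ (1 + b ^ 2) * (2 - f ^ 2 - d ^ 2) :=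
      mul_le_mul_of_nonneg_right (cosh_le_one_add_sq hb1) (by linarith)
    have h4 : (1 + b ^ 2) * (2 - f ^ 2 - d ^ 2) ≤ 2 - f ^ 2 - d ^ 2 + 2 * b ^ 2 := by
      nlinarith [sq_nonneg b, sq_nonneg f, sq_nonneg d]
    have h5 : -(Real.sinh a * Real.sinh b * (2 * f * d)) ≤ Real.cosh a * (d ^ 2 / 2) := by
      refine (neg_le_abs _).trans ?_
      rw [abs_mul, abs_mul]
      have h6 : |2 * f * d| ≤ 2 * |d| := by
        rw [abs_mul, abs_mul, abs_two]
        nlinarith [abs_nonneg d]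
      calc |Real.sinh a| * |Real.sinh b| * |2 * f * d|
          ≤ Real.cosh a * (2 * |b|) * (2 * |d|) := by
            gcongr
            exacts [abs_sinh_le_cosh a, abs_sinh_le hb1]
        _ = Real.cosh a * (d ^ 2 / 2) := by
            rw [hb, abs_div, abs_of_pos (by norm_num : (0 : ℝ) < 8), ← sq_abs d]
            ring
    have h7 : Real.cosh a * (Real.cosh b * (2 - f ^ 2 - d ^ 2)) ≤
        Real.cosh a * (2 - f ^ 2 - d ^ 2 + 2 * b ^ 2) :=
      mul_le_mul_of_nonneg_left (h3.trans h4) hca.le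
    have h8 : Real.cosh a * (2 * b ^ 2) ≤ Real.cosh a * (d ^ 2 / 2) := by
      refine mul_le_mul_of_nonneg_left ?_ hca.le
      rw [hb]
      nlinarith [sq_nonneg d]
    nlinarith

/-- The exponential inequality for the partial sums of the martingale transform. -/
theorem leb_mul_cosh_le {x : ℝ → ℝ} (hx : Integrable x leb) (hx1 : ∀ᵐ t ∂leb, |x t| ≤ 1) (n : ℕ)
    {s : ℝ} (hs : 0 ≤ s) :
    leb {t | s < |treeFun x n t|} * ENNReal.ofReal (Real.cosh (s / 8) - 1) ≤
      ENNReal.ofReal (∫ t, |x t| ∂leb) := by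
  set F : ℤ → ℝ := fun k => Real.cosh (tree x n k / 8) - 1 with hF
  have hF0 : ∀ k, 0 ≤ F k := fun k => sub_nonneg.2 (Real.one_le_cosh _)
  have hQ : ∀ n k, |avg x n k| ≤ 1 := abs_avg_le zero_le_one hx1
  have h1 : leb {t | s < |treeFun x n t|} * ENNReal.ofReal (Real.cosh (s / 8) - 1) ≤
      ∫⁻ t, ENNReal.ofReal (F ⌊(2 : ℝ) ^ n * t⌋) ∂leb := by
    rw [mul_comm, ← lintegral_indicator_const (measurableSet_lt measurable_const
      (measurable_treeFun x n).abs)]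
    refine lintegral_mono fun t => ?_
    by_cases ht : s < |treeFun x n t|
    · rw [indicator_of_mem (show t ∈ {t | s < |treeFun x n t|} from ht)]
      refine ENNReal.ofReal_le_ofReal (sub_le_sub_right (Real.cosh_le_cosh.2 ?_) 1)
      rw [abs_div, abs_div, abs_of_nonneg hs]
      exact div_le_div_of_nonneg_right ht.le (abs_nonneg _)
    · rw [indicator_of_notMem (show t ∉ {t | s < |treeFun x n t|} from ht)]
      exact bot_le
  refine h1.trans ?_
  rw [lintegral_floor_ofReal n hF0]
  refine ENNReal.ofReal_le_ofReal ?_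
  rw [div_le_iff₀ (by positivity)]
  have h2 := sum_tree_le hx (Q := fun r => |r| ≤ 1) hQ
    (fun f g d ε hε h h' => expBellman_midpoint (g := g) hε h h') n
  -- Since `f² ≤ |f| ≤ 1`, one has `(F + 1)(2 - f²) ≥ F + 2 - |f|`.
  have h3 : ∑ k ∈ Finset.range (2 ^ n), (F k + 2 - |avg x n k|) ≤
      ∑ k ∈ Finset.range (2 ^ n), expBellman (avg x n k) (tree x n k) := by
    refine Finset.sum_le_sum fun k _ => ?_
    have h4 := hF0 k
    have h5 := hQ n k
    have h6 : avg x n k ^ 2 ≤ |avg x n k| := by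
      rw [← sq_abs]
      nlinarith [abs_nonneg (avg x n k)]
    have h7 : expBellman (avg x n k) (tree x n k) = (F k + 1) * (2 - avg x n k ^ 2) := by
      rw [expBellman, hF, sub_add_cancel]
    rw [h7]
    nlinarith
  rw [Finset.sum_sub_distrib, Finset.sum_add_distrib, Finset.sum_const, Finset.card_range,
    nsmul_eq_mul] at h3
  push_cast at h3
  have h4 := sum_abs_avg_le hx n
  -- The initial value at most `2` cancels the constant `2` in the minorant. Only `∫ |x|` remains,
  -- so the tail bound is proportional to it.
  have h5 : expBellman (∫ t, x t ∂leb) (∫ t, x t ∂leb) ≤ 2 := by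
    set I := ∫ t, x t ∂leb with hI
    have hI1 : |I| ≤ 1 := by
      have := hQ 0 0
      rwa [avg_zero_zero] at this
    have hI2 : I ^ 2 ≤ 1 := by
      rw [← sq_abs]
      exact pow_le_one₀ (abs_nonneg _) hI1
    have h6 : Real.cosh (I / 8) ≤ 1 + (I / 8) ^ 2 := by
      refine cosh_le_one_add_sq ?_
      rw [abs_div, abs_of_pos (by norm_num : (0 : ℝ) < 8)]
      linarith
    rw [expBellman]
    have h7 := mul_le_mul_of_nonneg_right h6 (by linarith : 0 ≤ 2 - I ^ 2)
    nlinarith [sq_nonneg I, mul_nonneg (sq_nonneg I) (sq_nonneg I)]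
  have h6 : (2 : ℝ) ^ n * expBellman (∫ t, x t ∂leb) (∫ t, x t ∂leb) ≤ 2 ^ n * 2 := by gcongr
  have h8 : (∫ t, |x t| ∂leb) * 2 ^ n = 2 ^ n * ∫ t, |x t| ∂leb := mul_comm _ _
  linarith

/-! ### The transform of a bounded function -/

/-- It is used with `L = 1 + log(b/t)`, for which `exp(L - 1) = b/t`. -/
theorem one_add_le_cosh {r L : ℝ} (hL : 1 ≤ L) (hr : r ≤ Real.exp (L - 1)) :
    r ≤ Real.cosh (2 * L) - 1 := by
  have h1 : Real.exp (2 * L) = Real.exp (L - 1) * (Real.exp L * Real.exp 1) := by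
    rw [← Real.exp_add, ← Real.exp_add]
    congr 1
    ring
  have h2 := Real.add_one_le_exp L
  have h3 := Real.add_one_le_exp (1 : ℝ)
  have h4 := Real.add_one_le_exp (L - 1)
  have h5 : 2 * 2 ≤ Real.exp L * Real.exp 1 :=
    mul_le_mul (by linarith) (by linarith) (by norm_num) (by positivity)
  have h6 := Real.exp_pos (-(2 * L))
  rw [Real.cosh_eq]
  nlinarith [Real.exp_pos (L - 1)]

/-- After rescaling to `a = 1`, the exponential inequality at height `16L`, with `L = 1 + log(b/t)`,
bounds the tail times `cosh(2L) - 1 ≥ b/t` by `b`. -/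
theorem rearrFun_treeFun_le_log {x : ℝ → ℝ} (hx : Integrable x leb) {a b : ℝ} (ha : 0 < a)
    (hxa : ∀ᵐ t ∂leb, |x t| ≤ a) (hb : ∫ t, |x t| ∂leb ≤ a * b) (n : ℕ) {t : ℝ} (ht : 0 < t)
    (htb : t ≤ b) :
    rearrFun (treeFun x n) t ≤ 16 * a * (1 + Real.log (b / t)) := by
  have hbt : 1 ≤ b / t := (one_le_div ht).2 htb
  set L := 1 + Real.log (b / t) with hL
  have hL1 : 1 ≤ L := by linarith [Real.log_nonneg hbt]
  rw [rearrFun_le_iff (measurable_treeFun x n).aemeasurable ht (by positivity)]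
  have h := leb_mul_cosh_le (hx.const_mul a⁻¹) (by
    filter_upwards [hxa] with s hs
    rw [abs_mul, abs_of_pos (inv_pos.2 ha), inv_mul_eq_div]
    exact (div_le_one ha).2 hs) n (s := 16 * L) (by positivity)
  have h1 : ∀ t, treeFun (fun u => a⁻¹ * x u) n t = a⁻¹ * treeFun x n t := fun t =>
    tree_const_mul _ _ _ _
  simp only [h1, abs_mul, abs_of_pos (inv_pos.2 ha), integral_const_mul] at h
  have h2 : {t | 16 * L < a⁻¹ * |treeFun x n t|} = {t | 16 * a * L < |treeFun x n t|} := by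
    ext s
    rw [mem_ofPred_eq, mem_ofPred_eq, inv_mul_eq_div, lt_div_iff₀ ha,
      show 16 * L * a = 16 * a * L by ring]
  rw [h2, show 16 * L / 8 = 2 * L by ring] at h
  have h3 : a⁻¹ * ∫ t, |x t| ∂leb ≤ t * (b / t) := by
    rw [inv_mul_eq_div, div_le_iff₀ ha, mul_div_cancel₀ _ ht.ne']
    linarith
  have h4 : b / t ≤ Real.cosh (2 * L) - 1 := by
    refine one_add_le_cosh hL1 (le_of_eq ?_)
    rw [hL, add_sub_cancel_left, Real.exp_log (by linarith)]
  have h5 := (mul_le_mul_right (ENNReal.ofReal_le_ofReal h4) _).trans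
    (h.trans (ENNReal.ofReal_le_ofReal h3))
  rw [ENNReal.ofReal_mul ht.le] at h5
  exact (ENNReal.mul_le_mul_iff_left (ENNReal.ofReal_pos.2 (by linarith)).ne'
    ENNReal.ofReal_ne_top).1 h5

theorem rearrFun_treeFun_le_div {x : ℝ → ℝ} (hx : Integrable x leb) {a b : ℝ} (ha : 0 < a)
    (hb0 : 0 < b) (hb : ∫ t, |x t| ∂leb ≤ a * b) (n : ℕ) {t : ℝ} (ht : 0 < t) :
    rearrFun (treeFun x n) t ≤ 2 * a * b / t := by
  rw [rearrFun_le_iff (measurable_treeFun x n).aemeasurable ht (by positivity)]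
  have h := leb_le_treeFun hx n (s := 2 * a * b / t) (by positivity)
  refine (measure_mono fun s hs => ?_).trans (h.trans (ENNReal.ofReal_le_ofReal ?_))
  · exact le_of_lt (mem_ofPred_eq ▸ hs)
  · rw [div_le_iff₀ (by positivity), mul_div_cancel₀ _ ht.ne']
    linarith

theorem antitone_indicator_Iio (b : ℝ) : Antitone ((Iio b).indicator fun _ => (1 : ℝ)) := by
  intro s t hst
  simp only [indicator_apply, mem_Iio]
  split_ifs with h1 h2
  · exact le_rfl
  · exact absurd (hst.trans_lt h1) h2
  · exact zero_le_one
  · exact le_rfl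

theorem indicator_Iio_nonneg (b t : ℝ) : 0 ≤ (Iio b).indicator (fun _ => (1 : ℝ)) t :=
  indicator_nonneg (fun _ _ => zero_le_one) t

/-- With `div_le_cal_indicator` this bounds the Calderón transform of `χ_(0,b)` from below by `1 +
log(b/t)` inside `(0,b)` and `b/t` beyond. -/
theorem log_le_cal_indicator {b t : ℝ} (hb : b ≤ 1) (ht : 0 < t) (htb : t < b) :
    ENNReal.ofReal (1 + Real.log (b / t)) ≤ cal ((Iio b).indicator fun _ => 1) t := by
  refine le_trans ?_ (hardy_le_cal ((antitone_indicator_Iio b).antitoneOn _)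
    ⟨ht, htb.trans_le hb⟩)
  rw [ENNReal.ofReal_add zero_le_one (Real.log_nonneg ((one_le_div ht).2 htb.le)), hardy,
    indicator_of_mem (mem_Iio.2 htb)]
  refine add_le_add_right ?_ _
  refine le_trans (le_of_eq ?_) (lintegral_mono_set (Ioo_subset_Ioo_right hb))
  have h1 : ∫⁻ r in Ioo t b, ENNReal.ofReal ((Iio b).indicator (fun _ => 1) r / r) =
      ∫⁻ r in Ioo t b, ENNReal.ofReal (1 / r) :=
    setLIntegral_congr_fun measurableSet_Ioo fun r hr => by
      simp only [indicator_of_mem (mem_Iio.2 hr.2)]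
  have hint : IntervalIntegrable (fun r : ℝ => 1 / r) volume t b :=
    intervalIntegral.intervalIntegrable_one_div (fun r hr => by
      rw [uIcc_of_le htb.le] at hr
      exact (ht.trans_le hr.1).ne') continuousOn_id
  rw [h1, ← ofReal_integral_eq_lintegral_ofReal
    ((intervalIntegrable_iff_integrableOn_Ioo_of_le htb.le).1 hint)
    ((ae_restrict_iff' measurableSet_Ioo).2 (Eventually.of_forall fun r hr => by
      have := ht.trans hr.1
      exact one_div_nonneg.2 this.le)), ← integral_Ioc_eq_integral_Ioo,
    ← intervalIntegral.integral_of_le htb.le, integral_one_div_of_pos ht (ht.trans htb)]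

theorem div_le_cal_indicator {b t : ℝ} (hb : b ≤ 1) (ht : 0 < t) (htb : b ≤ t) :
    ENNReal.ofReal (b / t) ≤ cal ((Iio b).indicator fun _ => 1) t := by
  rw [cal]
  refine le_trans ?_ (lintegral_mono_set (Ioo_subset_Ioo_right hb))
  have h1 : ∫⁻ s in Ioo 0 b, ENNReal.ofReal ((Iio b).indicator (fun _ => 1) s) *
      ENNReal.ofReal (1 / max s t) = ∫⁻ _ in Ioo 0 b, ENNReal.ofReal (1 / t) :=
    setLIntegral_congr_fun measurableSet_Ioo fun s hs => by
      simp only [indicator_of_mem (mem_Iio.2 hs.2), max_eq_right (hs.2.le.trans htb),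
        ENNReal.ofReal_one, one_mul]
  rw [h1, setLIntegral_const, Real.volume_Ioo, sub_zero, ← ENNReal.ofReal_mul (by positivity)]
  refine ENNReal.ofReal_le_ofReal (le_of_eq ?_)
  ring

/-- The exponential estimate serves for `t < b`, the weak type estimate for `t ≥ b`. -/
theorem rearrFun_treeFun_le_cal {x : ℝ → ℝ} (hx : Integrable x leb) {a b : ℝ} (ha : 0 < a)
    (hxa : ∀ᵐ t ∂leb, |x t| ≤ a) (hb0 : 0 < b) (hb1 : b ≤ 1)
    (hb : ∫ t, |x t| ∂leb ≤ a * b) (n : ℕ) {t : ℝ} (ht : 0 < t) :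
    ENNReal.ofReal (rearrFun (treeFun x n) t) ≤
      ENNReal.ofReal (16 * a) * cal ((Iio b).indicator fun _ => 1) t := by
  rcases lt_or_ge t b with h | h
  · refine (ENNReal.ofReal_le_ofReal (rearrFun_treeFun_le_log hx ha hxa hb n ht h.le)).trans ?_
    rw [ENNReal.ofReal_mul (by positivity)]
    exact mul_le_mul_right (log_le_cal_indicator hb1 ht h) _
  · refine (ENNReal.ofReal_le_ofReal (rearrFun_treeFun_le_div hx ha hb0 hb n ht)).trans ?_
    refine le_trans ?_ (mul_le_mul_right (div_le_cal_indicator hb1 ht h) _)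
    rw [← ENNReal.ofReal_mul (by positivity)]
    refine ENNReal.ofReal_le_ofReal ?_
    rw [← mul_div_assoc]
    gcongr
    norm_num

theorem lnorm_treeFun_le {φ ω : ℝ → ℝ} (hφ : IsQuasiconcave φ) (hω : IsQuasiconcave ω)
    {C : ENNReal} (hC : ∀ z : ℝ → ℝ, AntitoneOn z (Ioo 0 1) →
      (∀ t ∈ Ioo (0 : ℝ) 1, 0 ≤ z t) → ∫⁻ t, cal z t ∂hω.toIsWeight.measure ≤
        C * ∫⁻ t, ENNReal.ofReal (z t) ∂hφ.toIsWeight.measure) {x : ℝ → ℝ}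
    (hx : Integrable x leb) {a b : ℝ} (ha : 0 ≤ a)
    (hxa : ∀ᵐ t ∂leb, |x t| ≤ a) (hb0 : 0 < b) (hb1 : b ≤ 1)
    (hb : ∫ t, |x t| ∂leb ≤ a * b) (n : ℕ) :
    lnorm hω.toIsWeight.measure (treeFun x n) ≤
      16 * C * (ENNReal.ofReal a * hφ.toIsWeight.measure (Ioo 0 b)) := by
  -- The pointwise estimates divide by `a`; for `a = 0` the function vanishes almost everywhere.
  rcases ha.eq_or_lt with rfl | ha
  · have h1 : x =ᵐ[leb] fun t => 0 * x t := by
      filter_upwards [hxa] with t ht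
      rw [zero_mul, ← abs_nonpos_iff]
      exact ht
    have h2 : treeFun x n = fun t => 0 * treeFun x n t := by
      conv_lhs => unfold treeFun
      rw [tree_congr h1]
      funext t
      exact tree_const_mul _ _ _ _
    rw [h2, lnorm_const_mul _ _ (measurable_treeFun x n).aemeasurable]
    simp
  calc lnorm hω.toIsWeight.measure (treeFun x n)
      ≤ ∫⁻ t, ENNReal.ofReal (16 * a) * cal ((Iio b).indicator fun _ => 1) t
          ∂hω.toIsWeight.measure :=
        hω.toIsWeight.lintegral_mono fun t ht =>
          rearrFun_treeFun_le_cal hx ha hxa hb0 hb1 hb n ht.1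
    _ = ENNReal.ofReal (16 * a) *
          ∫⁻ t, cal ((Iio b).indicator fun _ => 1) t ∂hω.toIsWeight.measure :=
        lintegral_const_mul' _ _ ENNReal.ofReal_ne_top
    _ ≤ ENNReal.ofReal (16 * a) * (C * hφ.toIsWeight.measure (Ioo 0 b)) := by
        refine mul_le_mul_right ((hC _ ((antitone_indicator_Iio b).antitoneOn _)
          fun t _ => indicator_Iio_nonneg b t).trans (le_of_eq ?_)) _
        have h3 : ∀ t, ENNReal.ofReal ((Iio b).indicator (fun _ => (1 : ℝ)) t) =
            (Iio b).indicator 1 t := fun t => by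
          simp only [indicator_apply, Pi.one_apply]
          split_ifs <;> simp
        rw [lintegral_congr h3, lintegral_indicator_one measurableSet_Iio,
          hφ.toIsWeight.measure_Iio b]
    _ = _ := by
        rw [ENNReal.ofReal_mul (by norm_num), ENNReal.ofReal_ofNat]
        ring

/-! ### Truncations -/

/-- The truncation of a function at levels `±c`. -/
def truncate (c : ℝ) (x : ℝ → ℝ) (t : ℝ) : ℝ := max (-c) (min (x t) c)

theorem truncate_of_abs_le {c : ℝ} {x : ℝ → ℝ} {t : ℝ} (h : |x t| ≤ c) : truncate c x t = x t := by
  rw [abs_le] at h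
  rw [truncate, min_eq_left h.2, max_eq_right h.1]

theorem abs_sub_truncate_le {c : ℝ} (hc : 0 ≤ c) (x : ℝ → ℝ) (t : ℝ) :
    |(x - truncate c x) t| ≤ |x t| := by
  rw [Pi.sub_apply, truncate]
  rcases le_total (x t) c with h1 | h1
  · rw [min_eq_left h1]
    rcases le_total (-c) (x t) with h2 | h2
    · rw [max_eq_right h2, sub_self, abs_zero]
      exact abs_nonneg _
    · rw [max_eq_left h2, abs_of_nonpos (by linarith), abs_of_nonpos (by linarith)]
      linarith
  · rw [min_eq_right h1, max_eq_right (by linarith), abs_of_nonneg (by linarith),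
      abs_of_nonneg (by linarith)]
    linarith

theorem abs_truncate_sub_le {c d : ℝ} (hc : 0 ≤ c) (hcd : c ≤ d) (x : ℝ → ℝ) (t : ℝ) :
    |(truncate d x - truncate c x) t| ≤ d - c := by
  rw [Pi.sub_apply, truncate, truncate, abs_le]
  rcases le_total (x t) c with h1 | h1
  · rw [min_eq_left h1, min_eq_left (h1.trans hcd)]
    rcases le_total (-c) (x t) with h2 | h2
    · rw [max_eq_right h2, max_eq_right (by linarith)]
      constructor <;> linarith
    · rw [max_eq_left h2]
      constructor
      · linarith [le_max_left (-d) (x t)]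
      · linarith [max_le (by linarith : -d ≤ -c) h2]
  · rw [min_eq_right h1, max_eq_right (by linarith : -c ≤ c)]
    rcases le_total (x t) d with h2 | h2
    · rw [min_eq_left h2, max_eq_right (by linarith)]
      constructor <;> linarith
    · rw [min_eq_right h2, max_eq_right (by linarith)]
      constructor <;> linarith

theorem integrable_truncate {x : ℝ → ℝ} (hx : AEMeasurable x leb) {c : ℝ} (hc : 0 ≤ c) :
    Integrable (truncate c x) leb := by
  refine Integrable.of_bound (C := c)
    (aemeasurable_const.max (hx.min aemeasurable_const)).aestronglyMeasurable
    (Eventually.of_forall fun t => ?_)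
  rw [Real.norm_eq_abs, abs_le, truncate]
  exact ⟨le_max_left _ _, max_le (by linarith) (min_le_right _ _)⟩

theorem leb_rearrLevel_le {f : ℝ → ℝ} (hf : AEMeasurable f leb) (j : ℕ) :
    leb {t | rearrLevel f j < |f t|} ≤ ENNReal.ofReal ((1 / 2) ^ j) := by
  cases j with
  | zero => simpa using prob_le_one (μ := leb)
  | succ j =>
    rw [rearrLevel_succ, ← rearrFun_le_iff hf (half_pow_mem_Ioi _) (rearrFun_nonneg _ _)]

/-- The layer is bounded by the increment and lives where `|x|` exceeds its `j`-th level, a set of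
measure at most `2⁻ʲ`. -/
theorem integral_abs_truncate_sub_le {x : ℝ → ℝ} (hx : AEMeasurable x leb) (j : ℕ) :
    ∫ t, |(truncate (rearrLevel x (j + 1)) x - truncate (rearrLevel x j) x) t| ∂leb ≤
      rearrIncr x j * (1 / 2) ^ j := by
  have ha := rearrIncr_nonneg hx j
  have h0 := rearrLevel_nonneg x j
  have hle : rearrLevel x j ≤ rearrLevel x (j + 1) := sub_nonneg.1 ha
  rw [integral_eq_lintegral_of_nonneg_ae (Eventually.of_forall fun _ => abs_nonneg _)
    ((integrable_truncate hx (rearrLevel_nonneg _ _)).sub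
      (integrable_truncate hx h0)).abs.aestronglyMeasurable]
  refine ENNReal.toReal_le_of_le_ofReal (by positivity) ?_
  calc ∫⁻ t, ENNReal.ofReal |(truncate (rearrLevel x (j + 1)) x - truncate (rearrLevel x j) x) t|
        ∂leb
      ≤ ∫⁻ t, {t | rearrLevel x j < |x t|}.indicator (fun _ => ENNReal.ofReal (rearrIncr x j)) t
        ∂leb := by
        refine lintegral_mono fun t => ?_
        by_cases ht : rearrLevel x j < |x t|
        · rw [indicator_of_mem (show t ∈ {t | rearrLevel x j < |x t|} from ht)]
          exact ENNReal.ofReal_le_ofReal (abs_truncate_sub_le h0 hle x t)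
        · rw [not_lt] at ht
          rw [Pi.sub_apply, truncate_of_abs_le ht, truncate_of_abs_le (ht.trans hle)]
          simp
    _ ≤ ENNReal.ofReal (rearrIncr x j) * leb {t | rearrLevel x j < |x t|} :=
        lintegral_indicator_const_le _ _
    _ ≤ ENNReal.ofReal (rearrIncr x j * (1 / 2) ^ j) := by
        rw [ENNReal.ofReal_mul ha]
        exact mul_le_mul_right (leb_rearrLevel_le hx j) _

theorem treeFun_add {x y : ℝ → ℝ} (hx : Integrable x leb) (hy : Integrable y leb) (n : ℕ) :
    treeFun (x + y) n = treeFun x n + treeFun y n := funext fun _ => tree_add hx hy _ _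

theorem treeFun_sub {x y : ℝ → ℝ} (hx : Integrable x leb) (hy : Integrable y leb) (n : ℕ) :
    treeFun (x - y) n = treeFun x n - treeFun y n := by
  rw [eq_sub_iff_add_eq, ← treeFun_add (hx.sub hy) hy, sub_add_cancel]

/-- Layers are added one at a time with the genuine triangle inequality; a quasi-triangle constant
would compound with `J`. -/
theorem lnorm_treeFun_truncate_le {φ ω : ℝ → ℝ} (hφ : IsQuasiconcave φ) (hω : IsQuasiconcave ω)
    (hc : ConcaveOn ℝ (Ico 0 1) ω) {C : ENNReal} (hC : ∀ z : ℝ → ℝ, AntitoneOn z (Ioo 0 1) →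
      (∀ t ∈ Ioo (0 : ℝ) 1, 0 ≤ z t) → ∫⁻ t, cal z t ∂hω.toIsWeight.measure ≤
        C * ∫⁻ t, ENNReal.ofReal (z t) ∂hφ.toIsWeight.measure) {x : ℝ → ℝ}
    (hx : AEMeasurable x leb) (n J : ℕ) :
    lnorm hω.toIsWeight.measure (treeFun (truncate (rearrLevel x J) x) n) ≤
      ∑ j ∈ Finset.range J, 16 * C *
        (ENNReal.ofReal (rearrIncr x j) * hφ.toIsWeight.measure (Ioo 0 ((1 / 2) ^ j))) := by
  have hint := fun j => integrable_truncate hx (rearrLevel_nonneg x j)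
  induction J with
  | zero =>
    have h := lnorm_treeFun_le hφ hω hC (hint 0) le_rfl (Eventually.of_forall fun t => ?_)
      one_pos le_rfl (le_of_eq ?_) n
    · simpa using h
    · simp [truncate, rearrLevel]
    · simp [truncate, rearrLevel]
  | succ J ih =>
    rw [Finset.sum_range_succ, ← add_sub_cancel (truncate (rearrLevel x J) x)
      (truncate (rearrLevel x (J + 1)) x), treeFun_add (hint J) ((hint (J + 1)).sub (hint J))]
    refine (hω.lnorm_add_le_of_concave hc (measurable_treeFun _ n).aemeasurable
      (measurable_treeFun _ n).aemeasurable).trans (add_le_add ih ?_)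
    exact lnorm_treeFun_le hφ hω hC ((hint (J + 1)).sub (hint J)) (rearrIncr_nonneg hx J)
      (Eventually.of_forall fun t => abs_truncate_sub_le (rearrLevel_nonneg x J)
        (sub_nonneg.1 (rearrIncr_nonneg hx J)) x t) (by positivity)
      (pow_le_one₀ (by norm_num) (by norm_num)) (integral_abs_truncate_sub_le hx J) n

/-- The layers cost `φ(2⁻ʲ)` while the norm controls `φ(2⁻ʲ⁻¹)`; quasi-concavity bridges the gap
with the factor `2`. -/
theorem sum_rearrIncr_mul_le {φ : ℝ → ℝ} (hφ : IsQuasiconcave φ) {x : ℝ → ℝ}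
    (hx : AEMeasurable x leb) (J : ℕ) :
    ∑ j ∈ Finset.range J, ENNReal.ofReal (rearrIncr x j) *
      hφ.toIsWeight.measure (Ioo 0 ((1 / 2) ^ j)) ≤ 2 * lnorm hφ.toIsWeight.measure x := by
  refine le_trans ?_ (mul_le_mul_right ((ENNReal.sum_le_tsum (Finset.range J)).trans
    (tsum_rearrIncr_le hφ.toIsWeight hx)) 2)
  rw [Finset.mul_sum]
  refine Finset.sum_le_sum fun j _ => ?_
  have hb : ((1 / 2) ^ (j + 1) : ℝ) ∈ Ioo (0 : ℝ) 1 :=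
    ⟨by positivity, pow_lt_one₀ (by norm_num) (by norm_num) (by simp)⟩
  have h := hφ.measure_Ioo_le hb (v := (1 / 2) ^ j)
    (pow_le_pow_of_le_one (by norm_num) (by norm_num) (Nat.le_succ j))
  rw [← hφ.measure_Ioo hb, show ((1 / 2) ^ j / (1 / 2) ^ (j + 1) : ℝ) = 2 by
    rw [pow_succ]; field_simp, ENNReal.ofReal_ofNat] at h
  refine (mul_le_mul_right h _).trans (le_of_eq ?_)
  ring

/-- The partial sums of the martingale transform are close in measure for functions which are
close in `L₁`. -/
theorem tendstoInMeasure_treeFun {x : ℝ → ℝ} (hx : Integrable x leb) {y : ℕ → ℝ → ℝ}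
    (hy : ∀ j, Integrable (y j) leb)
    (h : Tendsto (fun j => ∫ t, |(x - y j) t| ∂leb) atTop (𝓝 0)) (n : ℕ) :
    TendstoInMeasure leb (fun j => treeFun (y j) n) atTop (treeFun x n) := by
  rw [tendstoInMeasure_iff_norm]
  intro ε hε
  have h0 : Tendsto (fun j => ENNReal.ofReal (2 * (∫ t, |(x - y j) t| ∂leb) / ε)) atTop (𝓝 0) := by
    have := ENNReal.tendsto_ofReal ((h.const_mul 2).div_const ε)
    simpa using this
  refine tendsto_of_tendsto_of_tendsto_of_le_of_le tendsto_const_nhds h0 (fun _ => bot_le)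
    fun j => (le_of_eq ?_).trans (leb_le_treeFun (hx.sub (hy j)) n hε)
  congr 1
  ext t
  rw [mem_ofPred_eq, mem_ofPred_eq, treeFun_sub hx (hy j), Pi.sub_apply, Real.norm_eq_abs,
    abs_sub_comm]

/-- The difference is at most `|x|` and lives on sets of measure at most `2⁻ʲ`; absolute continuity
of the integral concludes. -/
theorem tendsto_integral_sub_truncate {x : ℝ → ℝ} (hx : Integrable x leb) :
    Tendsto (fun j => ∫ t, |(x - truncate (rearrLevel x j) x) t| ∂leb) atTop (𝓝 0) := by
  have hm := hx.aestronglyMeasurable.aemeasurable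
  have hlim : Tendsto (fun j : ℕ => leb {t | rearrLevel x j < |x t|}) atTop (𝓝 0) := by
    have h1 : Tendsto (fun j : ℕ => ENNReal.ofReal ((1 / 2) ^ j)) atTop (𝓝 0) := by
      have := ENNReal.tendsto_ofReal
        (tendsto_pow_atTop_nhds_zero_of_lt_one (r := (1 / 2 : ℝ)) (by norm_num) (by norm_num))
      simpa using this
    exact tendsto_of_tendsto_of_tendsto_of_le_of_le tendsto_const_nhds h1 (fun _ => bot_le)
      fun j => leb_rearrLevel_le hm j
  have hset := tendsto_setLIntegral_zero (f := fun t => ENNReal.ofReal |x t|)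
    (ne_of_lt hx.abs.lintegral_lt_top) hlim
  have hle : ∀ j, ∫ t, |(x - truncate (rearrLevel x j) x) t| ∂leb ≤
      (∫⁻ t in {t | rearrLevel x j < |x t|}, ENNReal.ofReal |x t| ∂leb).toReal := by
    intro j
    rw [integral_eq_lintegral_of_nonneg_ae (Eventually.of_forall fun _ => abs_nonneg _)
      (hx.sub (integrable_truncate hm (rearrLevel_nonneg x j))).abs.aestronglyMeasurable]
    refine ENNReal.toReal_mono (ne_of_lt ((setLIntegral_le_lintegral _ _).trans_lt
      hx.abs.lintegral_lt_top)) ?_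
    rw [← lintegral_indicator₀ (nullMeasurableSet_lt_abs hm _)]
    refine lintegral_mono fun t => ?_
    by_cases ht : rearrLevel x j < |x t|
    · rw [indicator_of_mem (show t ∈ {t | rearrLevel x j < |x t|} from ht)]
      exact ENNReal.ofReal_le_ofReal (abs_sub_truncate_le (rearrLevel_nonneg x j) x t)
    · rw [Pi.sub_apply, truncate_of_abs_le (not_lt.1 ht)]
      simp
  refine squeeze_zero (fun j => integral_nonneg fun _ => abs_nonneg _) hle ?_
  have h := (ENNReal.tendsto_toReal ENNReal.zero_ne_top).comp hset
  rwa [ENNReal.toReal_zero] at h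

/-- The partial sums of the martingale transform are uniformly bounded. -/
theorem exists_lnorm_treeFun_le {φ ω : ℝ → ℝ} (hφ : IsQuasiconcave φ) (hω : IsQuasiconcave ω)
    (hconc : ConcaveOn ℝ (Ico 0 1) ω) {c : ℝ}
    (hc : ∀ u ∈ Ioo (0 : ℝ) 1, (∫⁻ t in Ioo 0 u, ENNReal.ofReal (ω t / t)) +
      ENNReal.ofReal u * (∫⁻ t in Ioo u 1, ENNReal.ofReal (ω t / t ^ 2)) ≤
        ENNReal.ofReal (c * φ u)) :
    ∃ C : ENNReal, C ≠ ⊤ ∧ ∀ x : ℝ → ℝ, Integrable x leb → ∀ n,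
      lnorm hω.toIsWeight.measure (treeFun x n) ≤ C * lnorm hφ.toIsWeight.measure x := by
  obtain ⟨C, hC, hcal⟩ := exists_lintegral_cal_le hφ hω hc
  -- The factor `16` belongs to the estimate of one layer, the factor `2` to the sum over the
  -- layers.
  refine ⟨32 * C, ENNReal.mul_ne_top (by norm_num) hC, fun x hx n => ?_⟩
  have hm := hx.aestronglyMeasurable.aemeasurable
  refine lnorm_le_of_tendstoInMeasure hω.toIsWeight
    (fun j => (measurable_treeFun (truncate (rearrLevel x j) x) n).aemeasurable)
    (measurable_treeFun x n).aemeasurable (tendstoInMeasure_treeFun hx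
      (fun j => integrable_truncate hm (rearrLevel_nonneg x j))
      (tendsto_integral_sub_truncate hx) n) (Eventually.of_forall fun J => ?_)
  refine (lnorm_treeFun_truncate_le hφ hω hconc hcal hm n J).trans ?_
  rw [← Finset.mul_sum]
  refine (mul_le_mul_right (sum_rearrIncr_mul_le hφ hm J) _).trans (le_of_eq ?_)
  rw [← mul_assoc, show (16 * C * 2 : ENNReal) = 16 * 2 * C by ring]
  norm_num

/-! ### Convergence of the martingale transform -/

/-- The partial sum with `N + 1` terms is the tree function at level `2N`; a shift of the index does
not affect the limit. -/
theorem isTransform_iff {x z : S01} (hx : Integrable x leb) :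
    IsTransform x z ↔ TendstoInMeasure leb (fun N => treeFun x (2 * N)) atTop z := by
  have h : TendstoInMeasure leb (fun N : ℕ => ∑ m ∈ Finset.range (N + 1), martDiff x (2 * m))
      atTop z ↔ TendstoInMeasure leb (fun N => treeFun x (2 * N)) atTop z :=
    ⟨fun h => h.congr_left fun N => sum_martDiff hx N,
      fun h => h.congr_left fun N => (sum_martDiff hx N).symm⟩
  rw [← h, IsTransform, TendstoInMeasure, TendstoInMeasure]
  refine forall₂_congr fun ε _ => ?_
  exact (tendsto_add_atTop_iff_nat (f := fun N : ℕ => leb {t | ε ≤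
    edist ((∑ m ∈ Finset.range N, martDiff x (2 * m)) t) (z t)}) 1).symm

theorem dyadic_le_succ (n : ℕ) : dyadic n ≤ dyadic (n + 1) := by
  rintro _ ⟨s, -, rfl⟩
  refine ⟨(fun k : ℤ => k / 2) ⁻¹' s, trivial, ?_⟩
  ext t
  simp only [mem_preimage, floor_div_two]

/-- The dyadic filtration. -/
def dyadicFiltration : Filtration ℕ (inferInstance : MeasurableSpace ℝ) where
  seq := dyadic
  mono' := monotone_nat_of_le_succ dyadic_le_succ
  le' := dyadic_le

/-- A point `t < a` is separated from `a` by the grid of level `n` as soon as `2ⁿ(a - t) > 1`, so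
half-lines are countable unions of dyadic sets. -/
theorem iSup_dyadic : ⨆ n, dyadic n = (inferInstance : MeasurableSpace ℝ) := by
  refine le_antisymm (iSup_le dyadic_le) ?_
  rw [BorelSpace.measurable_eq (α := ℝ), borel_eq_generateFrom_Iio]
  refine MeasurableSpace.generateFrom_le ?_
  rintro _ ⟨a, rfl⟩
  have h : Iio a = ⋃ n : ℕ, (fun t : ℝ => ⌊(2 : ℝ) ^ n * t⌋) ⁻¹' Iio ⌊(2 : ℝ) ^ n * a⌋ := by
    ext t
    simp only [mem_Iio, mem_iUnion, mem_preimage]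
    refine ⟨fun h => ?_, fun ⟨n, hn⟩ => ?_⟩
    · obtain ⟨n, hn⟩ := pow_unbounded_of_one_lt (1 / (a - t)) one_lt_two
      refine ⟨n, Int.lt_iff_add_one_le.2 (Int.le_floor.2 ?_)⟩
      rw [div_lt_iff₀ (sub_pos.2 h)] at hn
      push_cast
      linarith [Int.floor_le ((2 : ℝ) ^ n * t)]
    · by_contra! hcon
      exact absurd (Int.floor_le_floor (mul_le_mul_of_nonneg_left hcon
        (by positivity : (0 : ℝ) ≤ 2 ^ n))) (not_le.2 hn)
  rw [h]
  exact MeasurableSet.iUnion fun n => le_iSup dyadic n _ ⟨_, trivial, rfl⟩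

/-- The dyadic step function of averages. -/
def avgFun (x : ℝ → ℝ) (k : ℕ) (t : ℝ) : ℝ := avg x k ⌊(2 : ℝ) ^ k * t⌋

theorem integrable_avgFun {x : ℝ → ℝ} (hx : Integrable x leb) (k : ℕ) :
    Integrable (avgFun x k) leb :=
  integrable_condExp.congr (condExp_dyadic hx k)

theorem exists_integral_sub_avgFun_le {x : ℝ → ℝ} (hx : Integrable x leb) {δ : ℝ} (hδ : 0 < δ) :
    ∃ k, ∫ t, |(x - avgFun x k) t| ∂leb ≤ δ := by
  have h := tendsto_eLpNorm_condExp (ℱ := dyadicFiltration) (μ := leb) x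
  have hsup : ⨆ n, dyadicFiltration n = (inferInstance : MeasurableSpace ℝ) := iSup_dyadic
  obtain ⟨k, hk⟩ := (h.eventually (gt_mem_nhds (ENNReal.ofReal_pos.2 hδ))).exists
  refine ⟨k, ?_⟩
  rw [hsup, eLpNorm_one_eq_lintegral_enorm] at hk
  rw [integral_eq_lintegral_of_nonneg_ae (Eventually.of_forall fun _ => abs_nonneg _)
    (hx.sub (integrable_avgFun hx k)).abs.aestronglyMeasurable]
  refine ENNReal.toReal_le_of_le_ofReal hδ.le (le_trans (le_of_eq ?_) hk.le)
  refine lintegral_congr_ae ?_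
  have h2 : leb[x | (inferInstance : MeasurableSpace ℝ)] =ᵐ[leb] x :=
    condExp_of_aestronglyMeasurable' le_rfl hx.aestronglyMeasurable hx
  filter_upwards [condExp_dyadic hx k, h2] with t h1 h2
  rw [Pi.sub_apply, Pi.sub_apply, h2, show dyadicFiltration k = dyadic k from rfl, h1,
    Real.enorm_eq_ofReal_abs, abs_sub_comm, avgFun]

theorem floor_eq_of_le {k n : ℕ} (hkn : k ≤ n) {s t : ℝ}
    (h : ⌊(2 : ℝ) ^ n * s⌋ = ⌊(2 : ℝ) ^ n * t⌋) : ⌊(2 : ℝ) ^ k * s⌋ = ⌊(2 : ℝ) ^ k * t⌋ := by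
  induction n, hkn using Nat.le_induction with
  | base => exact h
  | succ n _ ih => exact ih (by rw [← floor_div_two n s, ← floor_div_two n t, h])

theorem avg_eq_of_eqOn {x : ℝ → ℝ} {n : ℕ} {t c : ℝ} (ht : t ∈ Ioo (0 : ℝ) 1)
    (h : EqOn x (fun _ => c) (cell n ⌊(2 : ℝ) ^ n * t⌋ ∩ Ioo 0 1)) :
    avg x n ⌊(2 : ℝ) ^ n * t⌋ = c := by
  obtain ⟨h0, h1⟩ := floor_mem_of_mem_Ioo n ht
  rw [avg, leb, Measure.restrict_restrict (measurableSet_cell _ _),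
    setIntegral_congr_fun ((measurableSet_cell _ _).inter measurableSet_Ioo) h,
    ← Measure.restrict_restrict (measurableSet_cell _ _), setIntegral_const, Measure.real,
    leb_cell h0 h1, ENNReal.toReal_ofReal (by positivity), smul_eq_mul]
  field_simp

theorem avg_avgFun {x : ℝ → ℝ} {k n : ℕ} (hkn : k ≤ n) {t : ℝ} (ht : t ∈ Ioo (0 : ℝ) 1) :
    avg (avgFun x k) n ⌊(2 : ℝ) ^ n * t⌋ = avgFun x k t :=
  avg_eq_of_eqOn ht fun s hs => by
    rw [avgFun, floor_eq_of_le hkn (mem_cell.1 hs.1), avgFun]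

theorem treeFun_avgFun (x : ℝ → ℝ) {k n : ℕ} (hkn : k ≤ n) {t : ℝ} (ht : t ∈ Ioo (0 : ℝ) 1) :
    treeFun (avgFun x k) n t = treeFun (avgFun x k) k t := by
  induction n, hkn using Nat.le_induction with
  | base => rfl
  | succ n hn ih =>
    rw [← ih, treeFun, tree, floor_div_two, avg_avgFun (hn.trans n.le_succ) ht, avg_avgFun hn ht,
      sub_self, ite_self, add_zero, treeFun]

/-- For a dyadic step function the partial sums become stationary. The weak type inequality, uniform
in the level, transfers the Cauchy property in measure to `L₁` limits. -/
theorem exists_isTransform {x : S01} (hx : Integrable x leb) : ∃ z : S01, IsTransform x z := by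
  simp only [isTransform_iff hx]
  refine exists_tendstoInMeasure_of_cauchy (fun N => (measurable_treeFun x _).aemeasurable)
    fun ε hε δ hδ => ?_
  -- The weak type inequality at height `ε/2` turns `εδ/8` into `δ/2` for each of the two levels
  -- compared.
  obtain ⟨k, hk⟩ := exists_integral_sub_avgFun_le hx (δ := ε * δ / 8) (by positivity)
  have hyi := integrable_avgFun hx k
  have hdist : ∀ n, leb {t | ε / 2 ≤ |treeFun x n t - treeFun (avgFun x k) n t|} ≤
      ENNReal.ofReal (δ / 2) := fun n => by
    have h := leb_le_treeFun (hx.sub hyi) n (half_pos hε)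
    rw [treeFun_sub hx hyi] at h
    refine h.trans (ENNReal.ofReal_le_ofReal ?_)
    rw [div_le_iff₀ (by positivity)]
    linarith
  refine ⟨k, fun m hm n hn => ?_⟩
  have hsub : ∀ᵐ t ∂leb, t ∈ {t | ε < |treeFun x (2 * m) t - treeFun x (2 * n) t|} →
      t ∈ {t | ε / 2 ≤ |treeFun x (2 * m) t - treeFun (avgFun x k) (2 * m) t|} ∪
        {t | ε / 2 ≤ |treeFun x (2 * n) t - treeFun (avgFun x k) (2 * n) t|} := by
    refine (ae_restrict_iff' measurableSet_Ioo).2 (Eventually.of_forall fun t ht h => ?_)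
    by_contra hcon
    simp only [mem_union, mem_ofPred_eq, not_or, not_le] at hcon h
    rw [treeFun_avgFun _ (by omega : k ≤ 2 * m) ht, treeFun_avgFun _ (by omega : k ≤ 2 * n) ht]
      at hcon
    have h1 := abs_sub_le (treeFun x (2 * m) t) (treeFun (avgFun x k) k t) (treeFun x (2 * n) t)
    rw [abs_sub_comm (treeFun (avgFun x k) k t)] at h1
    linarith [hcon.1, hcon.2]
  refine (measure_mono_ae hsub).trans ((measure_union_le _ _).trans
    ((add_le_add (hdist _) (hdist _)).trans (le_of_eq ?_)))
  rw [← ENNReal.ofReal_add (by positivity) (by positivity), add_halves]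

theorem IsQuasiconcave.integrable {φ : ℝ → ℝ} (hφ : IsQuasiconcave φ) {x : S01}
    (hx : x ∈ (lorentz φ hφ.toIsWeight).carrier) : Integrable x leb := by
  obtain ⟨C, hC, h⟩ := hφ.exists_lintegral_le
  have hm := x.aestronglyMeasurable.aemeasurable (μ := leb)
  refine ⟨x.aestronglyMeasurable, ?_⟩
  rw [hasFiniteIntegral_iff_norm]
  simp only [Real.norm_eq_abs]
  rw [lintegral_abs_eq_rearrFun hm]
  exact (h x hm).trans_lt (ENNReal.mul_lt_top hC.lt_top (mem_lorentz.1 hx))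

theorem transformBounded_lorentz {φ ω : ℝ → ℝ} (hφ : IsQuasiconcave φ) (hω : IsQuasiconcave ω)
    {C : ENNReal} (hC : C ≠ ⊤) (h : ∀ x : ℝ → ℝ, Integrable x leb → ∀ n,
      lnorm hω.toIsWeight.measure (treeFun x n) ≤ C * lnorm hφ.toIsWeight.measure x) :
    TransformBounded (lorentz φ hφ.toIsWeight) (lorentz ω hω.toIsWeight) := by
  refine ⟨C.toReal, fun x hx => ?_⟩
  have hxi := hφ.integrable hx
  obtain ⟨z, hz⟩ := exists_isTransform hxi
  have hle : lnorm hω.toIsWeight.measure z ≤ C * lnorm hφ.toIsWeight.measure x :=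
    lnorm_le_of_tendstoInMeasure hω.toIsWeight (fun N => (measurable_treeFun x _).aemeasurable)
      z.aestronglyMeasurable.aemeasurable ((isTransform_iff hxi).1 hz)
      (Eventually.of_forall fun N => h x hxi _)
  have hfin : C * lnorm hφ.toIsWeight.measure x < ⊤ :=
    ENNReal.mul_lt_top hC.lt_top (mem_lorentz.1 hx)
  refine ⟨z, hle.trans_lt hfin, hz, ?_⟩
  rw [qnorm_lorentz, qnorm_lorentz, ← ENNReal.toReal_mul]
  exact ENNReal.toReal_mono hfin.ne hle

theorem TransformBounded.trans_embeds {E F G : FunctionSpace} (h : TransformBounded E F)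
    (hFG : Embeds F G) (hF : ∀ x ∈ F.carrier, 0 ≤ F.qnorm x) : TransformBounded E G := by
  obtain ⟨C, hC⟩ := h
  obtain ⟨hsub, D, hD⟩ := hFG
  refine ⟨max D 0 * C, fun x hx => ?_⟩
  obtain ⟨z, hz, hxz, hle⟩ := hC x hx
  refine ⟨z, hsub hz, hxz, (hD z hz).trans ?_⟩
  rw [mul_assoc]
  exact (mul_le_mul_of_nonneg_right (le_max_left _ _) (hF z hz)).trans
    (mul_le_mul_of_nonneg_left hle (le_max_right _ _))

/-! ### The extremal functions -/

/-- The dyadic step function with the value `z(2ⁿ⁻¹)` on `[2ⁿ, 2ⁿ⁺¹)`. -/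
def dyadicStep (z : ℝ → ℝ) (t : ℝ) : ℝ := z (2 ^ (Int.log 2 t - 1))

/-- The union of the intervals `[4⁻ᵐ/2, 4⁻ᵐ)`. -/
def upperHalves : Set ℝ := ⋃ m : ℕ, cell (2 * m + 1) 1

/-- The restriction of a dyadic step function to the union of the intervals `[4⁻ᵐ/2, 4⁻ᵐ)`. -/
def extremal (z : ℝ → ℝ) : ℝ → ℝ := upperHalves.indicator (dyadicStep z)

theorem dyadicStep_arg_mem {t : ℝ} (ht : t ∈ Ioo (0 : ℝ) 1) :
    (2 : ℝ) ^ (Int.log 2 t - 1) ∈ Ioo (0 : ℝ) 1 ∧ t / 4 ≤ 2 ^ (Int.log 2 t - 1) := by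
  have h1 := Int.zpow_log_le_self (b := 2) one_lt_two ht.1
  have h2 := Int.lt_zpow_succ_log_self (b := 2) one_lt_two t
  push_cast at h1 h2
  rw [zpow_add_one₀ two_ne_zero] at h2
  rw [zpow_sub_one₀ two_ne_zero]
  refine ⟨⟨by positivity, ?_⟩, ?_⟩
  · linarith [ht.2, ht.1]
  · linarith

theorem antitoneOn_dyadicStep {z : ℝ → ℝ} (hz : AntitoneOn z (Ioo 0 1)) :
    AntitoneOn (dyadicStep z) (Ioo 0 1) := fun _ hs _ ht hst =>
  hz (dyadicStep_arg_mem hs).1 (dyadicStep_arg_mem ht).1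
    (zpow_le_zpow_right₀ one_le_two (sub_le_sub_right (Int.log_mono_right hs.1 hst) 1))

theorem measurableSet_upperHalves : MeasurableSet upperHalves :=
  MeasurableSet.iUnion fun _ => measurableSet_cell _ _

theorem aemeasurable_extremal {z : ℝ → ℝ} (hz : AntitoneOn z (Ioo 0 1)) :
    AEMeasurable (extremal z) leb :=
  (aemeasurable_of_antitoneOn_Ioo (antitoneOn_dyadicStep hz) volume).indicator
    measurableSet_upperHalves

theorem quarter_mem {t : ℝ} (ht : t ∈ Ioo (0 : ℝ) 1) : t / 4 ∈ Ioo (0 : ℝ) 1 :=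
  ⟨by linarith [ht.1], by linarith [ht.1, ht.2]⟩

theorem extremal_nonneg {z : ℝ → ℝ} (hz0 : ∀ t ∈ Ioo (0 : ℝ) 1, 0 ≤ z t) {t : ℝ}
    (ht : t ∈ Ioo (0 : ℝ) 1) : 0 ≤ extremal z t :=
  indicator_apply_nonneg fun _ => hz0 _ (dyadicStep_arg_mem ht).1

theorem extremal_le {z : ℝ → ℝ} (hz : AntitoneOn z (Ioo 0 1))
    (hz0 : ∀ t ∈ Ioo (0 : ℝ) 1, 0 ≤ z t) {t : ℝ} (ht : t ∈ Ioo (0 : ℝ) 1) :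
    extremal z t ≤ z (t / 4) := by
  obtain ⟨h1, h2⟩ := dyadicStep_arg_mem ht
  exact indicator_apply_le' (fun _ => hz (quarter_mem ht) h1 h2) fun _ => hz0 _ (quarter_mem ht)

/-- The extremal function is at most `z(t/4)`, and two dilations by `2` cost a factor `2` each. -/
theorem lnorm_extremal_le {φ : ℝ → ℝ} (hφ : IsQuasiconcave φ) {z : ℝ → ℝ}
    (hz : AntitoneOn z (Ioo 0 1)) (hz0 : ∀ t ∈ Ioo (0 : ℝ) 1, 0 ≤ z t) :
    lnorm hφ.toIsWeight.measure (extremal z) ≤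
      4 * ∫⁻ t, ENNReal.ofReal (z t) ∂hφ.toIsWeight.measure := by
  have hh : ∀ t ∈ Ioo (0 : ℝ) 1, t / 2 ∈ Ioo (0 : ℝ) 1 := fun t ht =>
    ⟨by linarith [ht.1], by linarith [ht.1, ht.2]⟩
  have hz2 : AntitoneOn (fun t => z (t / 2)) (Ioo 0 1) := fun s hs t ht hst =>
    hz (hh s hs) (hh t ht) (by linarith)
  have hz4 : AntitoneOn (fun t => z (t / 4)) (Ioo 0 1) := fun s hs t ht hst =>
    hz (quarter_mem hs) (quarter_mem ht) (by linarith)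
  have h1 := hφ.lintegral_half_le hz hz0
  have h2 := hφ.lintegral_half_le hz2 fun t ht => hz0 _ (hh t ht)
  calc lnorm hφ.toIsWeight.measure (extremal z)
      ≤ ∫⁻ t, ENNReal.ofReal (z (t / 2 / 2)) ∂hφ.toIsWeight.measure := by
        refine hφ.toIsWeight.lintegral_mono fun t ht => ENNReal.ofReal_le_ofReal ?_
        rw [div_div, show (2 : ℝ) * 2 = 4 by norm_num]
        refine (rearrFun_mono (aemeasurable_extremal hz) (aemeasurable_of_antitoneOn_Ioo hz4 volume)
          ((ae_restrict_iff' measurableSet_Ioo).2 (Eventually.of_forall fun s hs => ?_))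
          ht.1).trans (rearrFun_le_of_antitoneOn hz4 (fun s hs => hz0 _ (quarter_mem hs)) ht)
        rw [abs_of_nonneg (extremal_nonneg hz0 hs), abs_of_nonneg (hz0 _ (quarter_mem hs))]
        exact extremal_le hz hz0 hs
    _ ≤ 2 * (2 * ∫⁻ t, ENNReal.ofReal (z t) ∂hφ.toIsWeight.measure) :=
        h2.trans (mul_le_mul_right h1 2)
    _ = _ := by
        rw [← mul_assoc]
        norm_num

theorem log_of_mem_cell {n : ℕ} {t : ℝ} (h : t ∈ cell n 1) : Int.log 2 t = -(n : ℤ) := by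
  rw [cell_eq_Ico, mem_Ico] at h
  push_cast at h
  have hpos : 0 < t := lt_of_lt_of_le (by positivity) h.1
  refine le_antisymm ?_ ?_
  · rw [← Int.lt_add_one_iff, ← Int.lt_zpow_iff_log_lt one_lt_two hpos]
    push_cast
    rw [zpow_add_one₀ two_ne_zero, zpow_neg, zpow_natCast]
    refine h.2.trans_le (le_of_eq ?_)
    ring
  · rw [← Int.zpow_le_iff_le_log one_lt_two hpos]
    push_cast
    rw [zpow_neg, zpow_natCast]
    simpa using h.1

theorem extremal_of_mem_odd {z : ℝ → ℝ} {m : ℕ} {t : ℝ} (h : t ∈ cell (2 * m + 1) 1) :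
    extremal z t = z ((1 / 4) ^ (m + 1)) := by
  rw [extremal, indicator_of_mem (show t ∈ upperHalves from mem_iUnion.2 ⟨m, h⟩), dyadicStep,
    log_of_mem_cell h]
  congr 1
  rw [show (-((2 * m + 1 : ℕ) : ℤ) - 1) = -((2 * (m + 1) : ℕ) : ℤ) by push_cast; ring, zpow_neg,
    zpow_natCast, pow_mul, one_div, inv_pow]
  norm_num

theorem extremal_of_mem_even {z : ℝ → ℝ} {m : ℕ} {t : ℝ} (h : t ∈ cell (2 * m) 1) :
    extremal z t = 0 := by
  refine indicator_of_notMem (fun hmem => ?_) _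
  obtain ⟨k, hk⟩ := mem_iUnion.1 hmem
  have h1 := (log_of_mem_cell h).symm.trans (log_of_mem_cell hk)
  omega

theorem integrable_of_lnorm {φ : ℝ → ℝ} (hφ : IsQuasiconcave φ) {f : ℝ → ℝ}
    (hf : AEMeasurable f leb) (h : lnorm hφ.toIsWeight.measure f < ⊤) : Integrable f leb := by
  refine (hφ.integrable (x := AEEqFun.mk f hf.aestronglyMeasurable) ?_).congr
    (AEEqFun.coeFn_mk f _)
  rwa [mem_lorentz, lnorm_congr _ (AEEqFun.coeFn_mk f _)]

theorem avg_eq_of_eqOn_cell {x : ℝ → ℝ} {n : ℕ} {k : ℤ} {c : ℝ} (h0 : 0 ≤ k) (h1 : k < 2 ^ n)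
    (h : EqOn x (fun _ => c) (cell n k)) : avg x n k = c := by
  rw [avg, setIntegral_congr_fun (measurableSet_cell _ _) h, setIntegral_const, Measure.real,
    leb_cell h0 h1, ENNReal.toReal_ofReal (by positivity), smul_eq_mul]
  field_simp

theorem one_lt_two_pow_succ (n : ℕ) : (1 : ℤ) < 2 ^ (n + 1) :=
  one_lt_pow₀ one_lt_two n.succ_ne_zero

/-- The upper half of `[0, 4⁻ᵐ)` already carries the value `z(4⁻ᵐ⁻¹)`, and the lower half
contributes nonnegatively. -/
theorem le_avg_extremal {z : ℝ → ℝ} (hz0 : ∀ t ∈ Ioo (0 : ℝ) 1, 0 ≤ z t)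
    (hi : Integrable (extremal z) leb) (m : ℕ) :
    z ((1 / 4) ^ (m + 1)) / 2 ≤ avg (extremal z) (2 * m) 0 := by
  have h1 := avg_children hi (2 * m) 0
  have h2 : avg (extremal z) (2 * m + 1) (2 * 0 + 1) = z ((1 / 4) ^ (m + 1)) :=
    avg_eq_of_eqOn_cell zero_le_one (one_lt_two_pow_succ _) fun t ht => extremal_of_mem_odd ht
  have h3 : 0 ≤ avg (extremal z) (2 * m + 1) (2 * 0) :=
    mul_nonneg (by positivity) (integral_nonneg_of_ae (ae_restrict_of_ae
      ((ae_restrict_iff' measurableSet_Ioo).2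
        (Eventually.of_forall fun t ht => extremal_nonneg hz0 ht))))
  simp only [mul_zero, zero_add] at h1 h2 h3
  linarith

/-- The upper half of `[0, 4⁻ᴹ/2)` carries zero, so passing to its lower half doubles the average.
The even difference is therefore half the new average, at least a quarter of the corresponding value
of `z`. -/
theorem le_tree_extremal {z : ℝ → ℝ} (hz0 : ∀ t ∈ Ioo (0 : ℝ) 1, 0 ≤ z t)
    (hi : Integrable (extremal z) leb) (M : ℕ) :
    (∑ m ∈ Finset.range (M + 1), z ((1 / 4) ^ (m + 1))) / 4 ≤ tree (extremal z) (2 * M) 0 := by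
  induction M with
  | zero =>
    have h := le_avg_extremal hz0 hi 0
    have h0 : 0 ≤ z ((1 / 4) ^ (0 + 1)) := hz0 _ (by norm_num)
    simp only [zero_add, Finset.sum_range_one, mul_zero, tree] at h h0 ⊢
    linarith
  | succ M ih =>
    have h1 : Even (2 * M + 1 + 1) := ⟨M + 1, by ring⟩
    have h2 : ¬ Even (2 * M + 1) := by simp
    have h3 := avg_children hi (2 * M + 1) 0
    have h4 : avg (extremal z) (2 * M + 1 + 1) (2 * 0 + 1) = 0 :=
      avg_eq_of_eqOn_cell zero_le_one (one_lt_two_pow_succ _) fun t ht =>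
        extremal_of_mem_even (m := M + 1) ht
    have h5 := le_avg_extremal hz0 hi (M + 1)
    rw [show 2 * (M + 1) = 2 * M + 1 + 1 by ring] at h5 ⊢
    rw [Finset.sum_range_succ, tree, tree, if_pos h1, if_neg h2, Int.zero_ediv, Int.zero_ediv]
    simp only [mul_zero, zero_add, add_zero] at h3 h4 ⊢
    linarith

/-- The extremal function is constant on this cell, so all later differences vanish there. -/
theorem le_treeFun_extremal {z : ℝ → ℝ} (hz0 : ∀ t ∈ Ioo (0 : ℝ) 1, 0 ≤ z t)
    (hi : Integrable (extremal z) leb) {M N : ℕ} (hMN : M ≤ N) {t : ℝ} (ht : t ∈ Ioo (0 : ℝ) 1)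
    (htM : t ∈ cell (2 * M + 1) 1) :
    (∑ m ∈ Finset.range (M + 1), z ((1 / 4) ^ (m + 1))) / 4 ≤ treeFun (extremal z) (2 * N) t := by
  induction N, hMN using Nat.le_induction with
  | base =>
    rw [treeFun, ← floor_div_two, mem_cell.1 htM]
    exact le_tree_extremal hz0 hi M
  | succ N hN ih =>
    have h : ∀ n, 2 * M + 1 ≤ n →
        avg (extremal z) n ⌊(2 : ℝ) ^ n * t⌋ = z ((1 / 4) ^ (M + 1)) := fun n hn =>
      avg_eq_of_eqOn ht fun s hs => extremal_of_mem_odd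
        (mem_cell.2 ((floor_eq_of_le hn (mem_cell.1 hs.1)).trans (mem_cell.1 htM)))
    rw [treeFun_add_two, h _ (by omega), h _ (by omega), sub_self, add_zero]
    exact ih

theorem quarter_pow_mem (m : ℕ) : ((1 / 4) ^ (m + 1) : ℝ) ∈ Ioo (0 : ℝ) 1 :=
  ⟨by positivity, pow_lt_one₀ (by norm_num) (by norm_num) m.succ_ne_zero⟩

theorem setLIntegral_div_le {z : ℝ → ℝ} (hz : AntitoneOn z (Ioo 0 1))
    (hz0 : ∀ t ∈ Ioo (0 : ℝ) 1, 0 ≤ z t) (m : ℕ) :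
    ∫⁻ r in Ioo ((1 / 4) ^ (m + 1)) ((1 / 4) ^ m), ENNReal.ofReal (z r / r) ≤
      3 * ENNReal.ofReal (z ((1 / 4) ^ (m + 1))) := by
  set q : ℝ := (1 / 4) ^ (m + 1) with hq
  have hqm : q ∈ Ioo (0 : ℝ) 1 := quarter_pow_mem m
  have hpow : ((1 / 4) ^ m : ℝ) = 4 * q := by rw [hq, pow_succ]; ring
  have h1 : 4 * q ≤ 1 := hpow ▸ pow_le_one₀ (by norm_num) (by norm_num)
  have hq0 := hqm.1
  rw [hpow]
  calc ∫⁻ r in Ioo q (4 * q), ENNReal.ofReal (z r / r)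
      ≤ ∫⁻ _ in Ioo q (4 * q), ENNReal.ofReal (z q / q) := by
        refine setLIntegral_mono' measurableSet_Ioo fun r hr => ENNReal.ofReal_le_ofReal ?_
        have hr1 : r ∈ Ioo (0 : ℝ) 1 := ⟨hq0.trans hr.1, hr.2.trans_le h1⟩
        have := hr1.1
        exact div_le_div₀ (hz0 q hqm) (hz hqm hr1 hr.1.le) hq0 hr.1.le
    _ = 3 * ENNReal.ofReal (z q) := by
        rw [setLIntegral_const, Real.volume_Ioo,
          ← ENNReal.ofReal_mul (div_nonneg (hz0 q hqm) hq0.le),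
          show z q / q * (4 * q - q) = 3 * z q by field_simp; ring,
          ENNReal.ofReal_mul (by norm_num), ENNReal.ofReal_ofNat]

theorem setLIntegral_div_le_sum {z : ℝ → ℝ} (hz : AntitoneOn z (Ioo 0 1))
    (hz0 : ∀ t ∈ Ioo (0 : ℝ) 1, 0 ≤ z t) (M : ℕ) :
    ∫⁻ r in Ioo ((1 / 4) ^ M) 1, ENNReal.ofReal (z r / r) ≤
      3 * ENNReal.ofReal (∑ m ∈ Finset.range M, z ((1 / 4) ^ (m + 1))) := by
  induction M with
  | zero => simp
  | succ M ih =>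
    have hsub : Ioo ((1 / 4 : ℝ) ^ (M + 1)) 1 ⊆
        Ioo ((1 / 4) ^ (M + 1)) ((1 / 4) ^ M) ∪ {(1 / 4) ^ M} ∪ Ioo ((1 / 4) ^ M) 1 := by
      intro r hr
      rcases lt_trichotomy r ((1 / 4) ^ M) with h | h | h
      · exact Or.inl (Or.inl ⟨hr.1, h⟩)
      · exact Or.inl (Or.inr h)
      · exact Or.inr ⟨h, hr.2⟩
    refine (lintegral_mono_set hsub).trans ((lintegral_union_le _ _ _).trans ?_)
    refine (add_le_add (lintegral_union_le _ _ _) le_rfl).trans ?_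
    rw [setLIntegral_measure_zero _ _ (measure_singleton _), add_zero, Finset.sum_range_succ,
      ENNReal.ofReal_add (Finset.sum_nonneg fun m _ => hz0 _ (quarter_pow_mem m))
        (hz0 _ (quarter_pow_mem M)), mul_add, add_comm]
    exact add_le_add ih (setLIntegral_div_le hz hz0 M)

/-- The value `z(s)` is at most the sum, and the integral of `z(r)/r` over each block `(q, 4q)` is
at most `3 z(q)`; hence the constant `4`. -/
theorem hardy_le_sum {z : ℝ → ℝ} (hz : AntitoneOn z (Ioo 0 1))
    (hz0 : ∀ t ∈ Ioo (0 : ℝ) 1, 0 ≤ z t) {M : ℕ} {s : ℝ} (hs : s ∈ Ioo (0 : ℝ) 1)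
    (hsM : (1 / 4) ^ (M + 1) ≤ s) :
    hardy z s ≤ ENNReal.ofReal (4 * ∑ m ∈ Finset.range (M + 1), z ((1 / 4) ^ (m + 1))) := by
  have h1 : z s ≤ ∑ m ∈ Finset.range (M + 1), z ((1 / 4) ^ (m + 1)) :=
    (hz (quarter_pow_mem M) hs hsM).trans (Finset.single_le_sum
      (f := fun m : ℕ => z ((1 / 4) ^ (m + 1))) (fun m _ => hz0 _ (quarter_pow_mem m))
      (Finset.self_mem_range_succ M))
  have h2 : ∫⁻ r in Ioo s 1, ENNReal.ofReal (z r / r) ≤ _ :=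
    (lintegral_mono_set (Ioo_subset_Ioo_left hsM)).trans (setLIntegral_div_le_sum hz hz0 (M + 1))
  refine (add_le_add (ENNReal.ofReal_le_ofReal h1) h2).trans (le_of_eq ?_)
  rw [ENNReal.ofReal_mul (by norm_num), ENNReal.ofReal_ofNat]
  ring

theorem exists_quarter_pow {s : ℝ} (hs : s ∈ Ioo (0 : ℝ) 1) :
    ∃ M : ℕ, (1 / 4) ^ (M + 1) ≤ s ∧ s < (1 / 4) ^ M := by
  obtain ⟨n, h1, h2⟩ := exists_dyadic_lt hs
  have h4 : (1 / 4 : ℝ) = (1 / 2) ^ 2 := by norm_num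
  refine ⟨n / 2, ?_, ?_⟩
  · rw [h4, ← pow_mul]
    exact (pow_le_pow_of_le_one (by norm_num) (by norm_num) (by omega)).trans h1
  · rw [h4, ← pow_mul]
    exact h2.trans_le (pow_le_pow_of_le_one (by norm_num) (by norm_num) (by omega))

/-- The martingale transform of the extremal function dominates the Hardy operator. -/
theorem hardy_le_rearrFun {z : ℝ → ℝ} (hz : AntitoneOn z (Ioo 0 1))
    (hz0 : ∀ t ∈ Ioo (0 : ℝ) 1, 0 ≤ z t) (hi : Integrable (extremal z) leb) {w : ℝ → ℝ}
    (hw : AEMeasurable w leb)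
    (h : TendstoInMeasure leb (fun N => treeFun (extremal z) (2 * N)) atTop w) {s : ℝ}
    (hs : s ∈ Ioo (0 : ℝ) 1) :
    hardy z s ≤ ENNReal.ofReal (16 * rearrFun w (s / 2)) := by
  obtain ⟨M, h1, h2⟩ := exists_quarter_pow hs
  refine (hardy_le_sum hz hz0 hs h1).trans (ENNReal.ofReal_le_ofReal ?_)
  set S := ∑ m ∈ Finset.range (M + 1), z ((1 / 4) ^ (m + 1)) with hS
  obtain ⟨ns, hns, hae⟩ := h.exists_seq_tendsto_ae
  have hcell : ∀ᵐ t ∂leb, t ∈ cell (2 * M + 1) 1 → t ∈ {t | S / 4 ≤ w t} := by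
    filter_upwards [hae, ae_restrict_mem measurableSet_Ioo] with t ht ht1 htM
    refine ge_of_tendsto ht ?_
    filter_upwards [hns.tendsto_atTop.eventually_ge_atTop M] with i hi'
    exact le_treeFun_extremal hz0 hi hi' ht1 htM
  -- The cell has measure `4⁻ᴹ/2`, and `s < 4⁻ᴹ`. Hence the rearrangement at `s/2` sees the lower
  -- bound on this cell.
  have hlt : ENNReal.ofReal (s / 2) < leb {t | S / 4 ≤ w t} := by
    refine lt_of_lt_of_le (b := leb (cell (2 * M + 1) 1)) ?_ (measure_mono_ae hcell)
    rw [leb_cell zero_le_one (one_lt_two_pow_succ _)]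
    refine (ENNReal.ofReal_lt_ofReal_iff (by positivity)).2 ?_
    rw [pow_succ, pow_mul, ← div_div, ← one_div_pow]
    norm_num at h2 ⊢
    linarith
  have key : S / 4 ≤ rearrFun w (s / 2) := by
    refine le_of_forall_lt fun r hr => ?_
    rcases lt_or_ge r 0 with h0 | h0
    · exact h0.trans_le (rearrFun_nonneg _ _)
    · rw [lt_rearrFun_iff hw (half_pos hs.1) h0]
      refine hlt.trans_le (measure_mono fun t ht => ?_)
      exact (hr.trans_le ht).trans_le (le_abs_self _)
  linarith

/-! ### Dilations in symmetric spaces -/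

theorem measurePreserving_one_sub : MeasurePreserving (fun t : ℝ => 1 - t) leb leb := by
  have h := (Measure.measurePreserving_sub_left (volume : Measure ℝ) 1).restrict_preimage
    (measurableSet_Ioo (a := (0 : ℝ)) (b := 1))
  have h2 : (fun t : ℝ => 1 - t) ⁻¹' Ioo 0 1 = Ioo 0 1 := by
    ext t
    simp only [mem_preimage, mem_Ioo]
    constructor <;> rintro ⟨h1, h2⟩ <;> constructor <;> linarith
  rwa [h2] at h

theorem rearrFun_one_sub {f : ℝ → ℝ} (hf : AEMeasurable f leb) :
    rearrFun (fun t => f (1 - t)) = rearrFun f := by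
  funext t
  have h : ∀ s, leb {u | s < |f (1 - u)|} = leb {u | s < |f u|} := fun s =>
    measurePreserving_one_sub.measure_preimage (nullMeasurableSet_lt_abs hf s)
  simp only [rearrFun, h]

theorem rearrFun_half_le {f : ℝ → ℝ} (hf : AEMeasurable f leb) {t : ℝ} (ht : t ∈ Ioo (0 : ℝ) 1) :
    rearrFun f (t / 2) ≤ rearrFun (rearrFun f + fun s => rearrFun f (1 - s)) t := by
  have hfm := rearrFun_aemeasurable hf
  have hm : AEMeasurable (rearrFun f + fun s => rearrFun f (1 - s)) leb :=
    hfm.add (hfm.comp_quasiMeasurePreserving measurePreserving_one_sub.quasiMeasurePreserving)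
  refine le_of_forall_lt fun r hr => ?_
  rcases lt_or_ge r 0 with h0 | h0
  · exact h0.trans_le (rearrFun_nonneg _ _)
  have ht0 := ht.1
  rw [lt_rearrFun_iff hf (half_pos ht.1) h0] at hr
  -- The condition `v < 1/2` makes `(0,v)` and `(1-v,1)` disjoint; their total length `2v` exceeds
  -- `t`.
  obtain ⟨v, hv1, hv2, hv⟩ : ∃ v : ℝ, t / 2 < v ∧ v < 1 / 2 ∧ r < rearrFun f v := by
    obtain ⟨q, hq0, hq1, hq2⟩ := ENNReal.lt_iff_exists_real_btwn.1
      (lt_min hr ((ENNReal.ofReal_lt_ofReal_iff (by norm_num)).2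
        (by linarith [ht.2] : t / 2 < 1 / 2)))
    have hq : t / 2 < q := lt_of_not_ge fun h => not_le.2 hq1 (ENNReal.ofReal_le_ofReal h)
    refine ⟨q, hq, ?_, ?_⟩
    · exact lt_of_not_ge fun h =>
        not_le.2 (hq2.trans_le (min_le_right _ _)) (ENNReal.ofReal_le_ofReal h)
    · rw [lt_rearrFun_iff hf (by linarith) h0]
      exact hq2.trans_le (min_le_left _ _)
  rw [lt_rearrFun_iff hm ht.1 h0]
  have hsub : Ioo 0 v ∪ Ioo (1 - v) 1 ⊆
      {u | r < |(rearrFun f + fun s => rearrFun f (1 - s)) u|} ∩ Ioo 0 1 := by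
    have hanti := rearrFun_antitoneOn hf
    rintro u (hu | hu)
    · refine ⟨?_, hu.1, by linarith [hu.2]⟩
      have h1 := hanti (mem_Ioi.2 hu.1) (mem_Ioi.2 (hu.1.trans hu.2)) hu.2.le
      have h2 := rearrFun_nonneg f (1 - u)
      exact (hv.trans_le (by rw [Pi.add_apply]; linarith)).trans_le (le_abs_self _)
    · refine ⟨?_, by linarith [hu.1], hu.2⟩
      have h1 := hanti (mem_Ioi.2 (by linarith [hu.2] : 0 < 1 - u))
        (mem_Ioi.2 (by linarith : 0 < v)) (by linarith [hu.1])
      have h2 := rearrFun_nonneg f u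
      exact (hv.trans_le (by rw [Pi.add_apply]; linarith)).trans_le (le_abs_self _)
  rw [leb, Measure.restrict_apply' measurableSet_Ioo]
  refine lt_of_lt_of_le ?_ (measure_mono hsub)
  rw [measure_union (disjoint_left.2 fun u h1 h2 => by linarith [h1.2, h2.1]) measurableSet_Ioo,
    Real.volume_Ioo, Real.volume_Ioo, ← ENNReal.ofReal_add (by linarith) (by linarith)]
  exact (ENNReal.ofReal_lt_ofReal_iff (by linarith)).2 (by linarith)

/-- Both functions are replaced by their rearrangements as elements of the space; for these the
inequality is pointwise and the ideal property applies. -/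
theorem IsSymmetric.mem_of_rearr_le {G : FunctionSpace} (hG : IsSymmetric G) {x y : S01}
    (hy : y ∈ G.carrier) (h : ∀ t ∈ Ioo (0 : ℝ) 1, rearr x t ≤ rearr y t) :
    x ∈ G.carrier ∧ G.qnorm x ≤ G.qnorm y := by
  have hm : ∀ x : S01, AEMeasurable x leb := fun x => x.aestronglyMeasurable.aemeasurable
  have hmk : ∀ x : S01, ∃ X : S01, X =ᵐ[leb] rearrFun x ∧ ∀ t, rearr X t = rearr x t := fun x => by
    refine ⟨AEEqFun.mk (rearrFun x) (rearrFun_aemeasurable (hm x)).aestronglyMeasurable,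
      AEEqFun.coeFn_mk _ _, fun t => ?_⟩
    rw [rearr_mk, rearrFun_rearrFun (hm x)]
    rfl
  obtain ⟨X, hX, hXr⟩ := hmk x
  obtain ⟨Y, hY, hYr⟩ := hmk y
  obtain ⟨hYG, hYn⟩ := hG.rearr_inv y hy Y fun t _ => hYr t
  obtain ⟨hXG, hXn⟩ := hG.ideal Y hYG X (by
    filter_upwards [hX, hY, ae_restrict_mem measurableSet_Ioo] with t h1 h2 ht
    rw [h1, h2, abs_of_nonneg (rearrFun_nonneg _ _), abs_of_nonneg (rearrFun_nonneg _ _)]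
    exact h t ht)
  obtain ⟨hxG, hxn⟩ := hG.rearr_inv X hXG x fun t _ => (hXr t).symm
  exact ⟨hxG, by rw [hxn, ← hYn]; exact hXn⟩

/-- Boundedness of dilations in symmetric spaces. -/
theorem IsSymmetric.mem_of_rearr_le_half {G : FunctionSpace} {K : ℝ} (hK : IsQuasiNormed K G)
    (hG : IsSymmetric G) {x w : S01} (hw : w ∈ G.carrier) {a : ℝ} (ha : 0 ≤ a)
    (h : ∀ t ∈ Ioo (0 : ℝ) 1, rearr x t ≤ a * rearr w (t / 2)) :
    x ∈ G.carrier ∧ G.qnorm x ≤ a * (2 * K) * G.qnorm w := by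
  have hm : AEMeasurable w leb := w.aestronglyMeasurable.aemeasurable
  have hm1 := rearrFun_aemeasurable hm
  have hm2 : AEMeasurable (fun s => rearrFun w (1 - s)) leb :=
    hm1.comp_quasiMeasurePreserving measurePreserving_one_sub.quasiMeasurePreserving
  set Y₁ : S01 := AEEqFun.mk (rearrFun w) hm1.aestronglyMeasurable
  set Y₂ : S01 := AEEqFun.mk (fun s => rearrFun w (1 - s)) hm2.aestronglyMeasurable
  obtain ⟨h1, hn1⟩ := hG.rearr_inv w hw Y₁ fun t _ => by
    rw [rearr_mk, rearrFun_rearrFun hm]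
    rfl
  obtain ⟨h2, hn2⟩ := hG.rearr_inv w hw Y₂ fun t _ => by
    rw [rearr_mk, rearrFun_one_sub hm1, rearrFun_rearrFun hm]
    rfl
  have hadd := hK.add_le _ h1 _ h2
  have hmem := hK.smul_mem a _ (hK.add_mem _ h1 _ h2)
  have hsmul := hK.smul_eq a _ (hK.add_mem _ h1 _ h2)
  have hr : ∀ t ∈ Ioo (0 : ℝ) 1, rearr x t ≤ rearr (a • (Y₁ + Y₂)) t := fun t ht => by
    have hcongr : (a • (Y₁ + Y₂) : S01) =ᵐ[leb]
        fun u => a * (rearrFun w + fun s => rearrFun w (1 - s)) u := by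
      filter_upwards [AEEqFun.coeFn_smul a (Y₁ + Y₂), AEEqFun.coeFn_add Y₁ Y₂,
        AEEqFun.coeFn_mk (rearrFun w) hm1.aestronglyMeasurable,
        AEEqFun.coeFn_mk (fun s => rearrFun w (1 - s)) hm2.aestronglyMeasurable] with u e1 e2 e3 e4
      rw [e1, Pi.smul_apply, e2, Pi.add_apply, e3, e4, smul_eq_mul, Pi.add_apply]
    rw [rearr_eq_rearrFun, rearr_eq_rearrFun, rearrFun_congr hcongr,
      rearrFun_const_mul a (hm1.add hm2) ht.1, abs_of_nonneg ha]
    exact (h t ht).trans (mul_le_mul_of_nonneg_left (rearrFun_half_le hm ht) ha)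
  obtain ⟨hx, hn⟩ := hG.mem_of_rearr_le hmem hr
  refine ⟨hx, hn.trans ?_⟩
  rw [hsmul, abs_of_nonneg ha, mul_assoc]
  rw [hn1, hn2] at hadd
  exact mul_le_mul_of_nonneg_left (hadd.trans (le_of_eq (by ring))) ha

/-- Every symmetric range of the martingale transform on `Λ_φ` contains `Λ_ψ`. -/
theorem embeds_of_transformBounded {φ : ℝ → ℝ} (hφ : IsQuasiconcave φ) {G : FunctionSpace}
    (hG : IsSymmetricQuasiBanach G) (hT : TransformBounded (lorentz φ hφ.toIsWeight) G) :
    Embeds (lorentz (psi φ) hφ.toIsWeight.psi) G := by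
  obtain ⟨⟨K, hK⟩, -, hsym⟩ := hG
  obtain ⟨C, hC⟩ := hT
  obtain ⟨D, hD, hz⟩ := exists_le_hardy hφ
  have key : ∀ x ∈ (lorentz (psi φ) hφ.toIsWeight.psi).carrier, x ∈ G.carrier ∧
      G.qnorm x ≤ 16 * (2 * max K 0) *
        (max C 0 * ((4 * D).toReal * (lorentz (psi φ) hφ.toIsWeight.psi).qnorm x)) := by
    intro x hx
    obtain ⟨z, hza, hz0, hxz, hzn⟩ := hz x x.aestronglyMeasurable.aemeasurable hx
    have hm := aemeasurable_extremal hza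
    have hle : lnorm hφ.toIsWeight.measure (extremal z) ≤
        4 * D * lnorm hφ.psi.toIsWeight.measure x := by
      rw [mul_assoc]
      exact (lnorm_extremal_le hφ hza hz0).trans (mul_le_mul_right hzn 4)
    have hDt : 4 * D ≠ ⊤ := ENNReal.mul_ne_top (by norm_num) hD
    have hfin : 4 * D * lnorm hφ.psi.toIsWeight.measure x < ⊤ :=
      ENNReal.mul_lt_top hDt.lt_top (mem_lorentz.1 hx)
    set x' : S01 := AEEqFun.mk (extremal z) hm.aestronglyMeasurable with hx'
    have hcoe : x' =ᵐ[leb] extremal z := AEEqFun.coeFn_mk _ _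
    have hxl : lnorm hφ.toIsWeight.measure x' = lnorm hφ.toIsWeight.measure (extremal z) :=
      lnorm_congr _ hcoe
    have hxφ : x' ∈ (lorentz φ hφ.toIsWeight).carrier := by
      rw [mem_lorentz, hxl]
      exact hle.trans_lt hfin
    have hi := integrable_of_lnorm hφ hm (hle.trans_lt hfin)
    obtain ⟨w, hwG, hw, hwn⟩ := hC x' hxφ
    rw [isTransform_iff (hi.congr hcoe.symm)] at hw
    have htree : ∀ n, treeFun x' n = treeFun (extremal z) n := fun n => by
      unfold treeFun
      rw [tree_congr hcoe]
    simp only [htree] at hw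
    have hr : ∀ t ∈ Ioo (0 : ℝ) 1, rearr x t ≤ 16 * rearr w (t / 2) := fun t ht => by
      have h := (hxz t ht).trans
        (hardy_le_rearrFun hza hz0 hi w.aestronglyMeasurable.aemeasurable hw ht)
      exact (ENNReal.ofReal_le_ofReal_iff (mul_nonneg (by norm_num) (rearrFun_nonneg _ _))).1 h
    -- Optimality needs only this: `x` is dominated, up to a dilation by two, by the transform `w`
    -- of a function of `Λ_φ` whose norm is controlled by that of `x`.
    obtain ⟨hxG, hxn⟩ := IsSymmetric.mem_of_rearr_le_half hK hsym hwG (by norm_num) hr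
    refine ⟨hxG, hxn.trans ?_⟩
    have hw0 := hK.nonneg w hwG
    have hqn : (lorentz φ hφ.toIsWeight).qnorm x' ≤
        (4 * D).toReal * (lorentz (psi φ) hφ.toIsWeight.psi).qnorm x := by
      rw [qnorm_lorentz, qnorm_lorentz, hxl, ← ENNReal.toReal_mul]
      exact ENNReal.toReal_mono hfin.ne hle
    have hq0 : 0 ≤ (lorentz φ hφ.toIsWeight).qnorm x' := ENNReal.toReal_nonneg
    have hwn' : G.qnorm w ≤ max C 0 *
        ((4 * D).toReal * (lorentz (psi φ) hφ.toIsWeight.psi).qnorm x) :=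
      (hwn.trans (mul_le_mul_of_nonneg_right (le_max_left _ _) hq0)).trans
        (mul_le_mul_of_nonneg_left hqn (le_max_right _ _))
    have hK0 : 0 ≤ max K 0 := le_max_right _ _
    calc 16 * (2 * K) * G.qnorm w ≤ 16 * (2 * max K 0) * G.qnorm w := by
          gcongr
          exact le_max_left _ _
      _ ≤ _ := by gcongr
  refine ⟨fun x hx => (key x hx).1, 16 * (2 * max K 0) * (max C 0 * (4 * D).toReal),
    fun x hx => (key x hx).2.trans (le_of_eq ?_)⟩
  ring

end HaarRange

end

/-! ### Assembly of the theorem -/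

theorem mainTheorem7 (φ : ℝ → ℝ) (hφ : HaarRange.IsLorentzFunction φ)
    (hcrit : ∃ c : ℝ, ∀ u ∈ Set.Ioo (0 : ℝ) 1,
      (∫⁻ t in Set.Ioo 0 u, ENNReal.ofReal (HaarRange.psi φ t / t))
        + ENNReal.ofReal u * (∫⁻ t in Set.Ioo u 1, ENNReal.ofReal (HaarRange.psi φ t / t ^ 2))
        ≤ ENNReal.ofReal (c * φ u)) :
    HaarRange.SameSpace
        (HaarRange.calderonRange (HaarRange.lorentz φ hφ.toIsWeight))
        (HaarRange.lorentz (HaarRange.psi φ) hφ.toIsWeight.psi) ∧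
      HaarRange.IsOptimalRange HaarRange.IsSymmetricQuasiBanach
        (HaarRange.lorentz φ hφ.toIsWeight)
        (HaarRange.lorentz (HaarRange.psi φ) hφ.toIsWeight.psi) ∧
      ∃ F : HaarRange.FunctionSpace,
        HaarRange.SameSpace F (HaarRange.lorentz (HaarRange.psi φ) hφ.toIsWeight.psi) ∧
        HaarRange.IsOptimalRange HaarRange.IsSymmetricBanach
          (HaarRange.lorentz φ hφ.toIsWeight) F := by
  obtain ⟨c, hc⟩ := hcrit
  have h := hφ.isQuasiconcave
  have hF := (HaarRange.isLorentzFunction_concaveHull h.psi).isQuasiconcave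
  have hconc := HaarRange.concaveOn_concaveHull h.psi
  have hsame := HaarRange.sameSpace_concaveHull h.psi
  -- The concave weight lies below `ψ`, so it inherits the critical estimate with the same constant.
  have hc' : ∀ u ∈ Set.Ioo (0 : ℝ) 1,
      (∫⁻ t in Set.Ioo 0 u, ENNReal.ofReal (HaarRange.concaveHull (HaarRange.psi φ) t / t)) +
        ENNReal.ofReal u * (∫⁻ t in Set.Ioo u 1,
          ENNReal.ofReal (HaarRange.concaveHull (HaarRange.psi φ) t / t ^ 2)) ≤
        ENNReal.ofReal (c * φ u) := fun u hu => by
    refine le_trans (add_le_add ?_ (mul_le_mul_right ?_ _)) (hc u hu)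
    · refine setLIntegral_mono' measurableSet_Ioo fun t ht => ENNReal.ofReal_le_ofReal ?_
      exact div_le_div_of_nonneg_right
        (HaarRange.concaveHull_le h.psi ⟨ht.1, ht.2.trans hu.2⟩) ht.1.le
    · refine setLIntegral_mono' measurableSet_Ioo fun t ht => ENNReal.ofReal_le_ofReal ?_
      exact div_le_div_of_nonneg_right
        (HaarRange.concaveHull_le h.psi ⟨hu.1.trans ht.1, ht.2⟩) (sq_nonneg t)
  obtain ⟨C, hC, hle⟩ := HaarRange.exists_lnorm_treeFun_le h hF hconc hc'
  have hT := HaarRange.transformBounded_lorentz h hF hC hle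
  exact ⟨HaarRange.sameSpace_calderonRange h hc,
    ⟨h.psi.isSymmetricQuasiBanach, hT.trans_embeds hsame.1 fun _ _ => ENNReal.toReal_nonneg,
      fun G hG hTG => HaarRange.embeds_of_transformBounded h hG hTG⟩,
    -- The renormed space is the Lorentz space of the concave weight. A symmetric Banach space is a
    -- quasi-Banach one with constant `1`, so optimality follows from the quasi-Banach case.
    _, hsame, hF.isSymmetricBanach hconc, hT, fun G hG hTG => hsame.1.trans
      (HaarRange.embeds_of_transformBounded h ⟨⟨1, hG.1⟩, hG.2⟩ hTG)
      fun _ _ => ENNReal.toReal_nonneg⟩
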